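/- **Setting.** Let $X$ be a countable set with a measure $m$ on all its subsets, $0<m(x):=m(\{x\})<\infty$ for all $x\in X$, and let $(b,c)$ be a graph over $X$: $b\colon X\times X\to[0,\infty)$ is symmetric with zero diagonal and $\sum_{y}b(x,y)<\infty$ for all $x$, and $c\colon X\to[0,\infty)$. Put $\mathcal Q(f)=\frac12\sum_{x,y}b(x,y)(f(x)-f(y))^2+\sum_x c(x)f(x)^2$. The Neumann form $Q^{(N)}$ is the restriction of $\mathcal Q$ to $D(Q^{(N)})=\{f\in\ell^2(X,m)\mid \mathcal Q(f)<\infty\}$; the form $Q^{(D)}$ is its restriction to the closure of the finitely supported functions in the form norm $(Q^{(N)}(f)+\|f\|^2)^{1/2}$. Let $\hat X$ be the Royden compactification, i.e. the (unique) compact Hausdorff space that contains $X$ as a dense subset of isolated points, to which all $f\in D(Q^{(N)})\cap\ell^\infty(X)$ extend continuously, and whose points are separated by these extensions. Let $\partial X$ be the set of all $\omega\in\hat X\setminus X$ at which the extensions of all $f\in D(Q^{(D)})\cap\ell^\infty(X)$ vanish, and give $X\cup\partial X\subset\hat X$ the subspace topology. Every $f\in D(Q^{(N)})$ has a unique continuous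 extension $\hat X\to[-\infty,\infty]$, again denoted by $f$. For a Dirichlet form $Q$ (closed, densely defined, compatible with all normal contractions) on $\ell^2(X,m)$ let $L$ be its self-adjoint operator; $L^{(D)}$ and $L^{(N)}$ are those of $Q^{(D)}$ and $Q^{(N)}$. Call $Q$ *sandwiched* if $e^{-tL^{(D)}}f\le e^{-tL}f\le e^{-tL^{(N)}}f$ for all $t\ge0$ and all $0\le f\in\ell^2(X,m)$. Write $C(X\cup\partial X)$ for the functions on $X$ that extend to a continuous real-valued function on $X\cup\partial X$, and $C_c(X\cup\partial X)$ for those for which this extension has compact support in $X\cup\partial X$. **Theorem (Arendt–Warma theorem).** Assume that $c=0$ and $m(X)<\infty$, and let $Q$ be a Dirichlet form on $\ell^2(X,m)$. The following assertions are equivalent: (i) $Q$ is sandwiched and $D(Q)\cap C(X\cup\partial X)$ is dense in $D(Q)$ with respect to the form norm of $Q$. (ii) There are a closed set $F\subset\partial X$ and a Radon measure $\nu$ on $\partial X\setminus F$ such that $$D(Q)=\Big\{f\in D(Q^{(N)})\ \Big|\ f=0\text{ on }F\text{ and }\int_{\partial X\setminus F}|f|^2\,d\nu<\infty\Big\}$$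 and $Q(f)=Q^{(N)}(f)+\int_{\partial X\setminus F}|f|^2\,d\nu$ for all $f\in D(Q)$. Moreover, (ii) follows whenever $Q$ is sandwiched and $D(Q)\cap C_c(X\cup\partial X)$ is form-norm dense in $D(Q)$; and if the space $X\cup\partial X$ is locally compact, then (ii) is also equivalent to (i) with $C_c(X\cup\partial X)$ in place of $C(X\cup\partial X)$. In particular, if (ii) holds, then $L$ is a restriction of the formal Laplacian: every $f\in D(L)$ satisfies $\sum_y b(x,y)|f(y)|<\infty$ and $Lf(x)=\frac1{m(x)}\sum_{y}b(x,y)(f(x)-f(y))$ for all $x\in X$. -/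

import Mathlib

open MeasureTheory Filter Topology Set
open scoped ENNReal NNReal

noncomputable section

/-! ### Symmetric positive forms on a real Hilbert space -/

/-- A symmetric positive form: a subspace `domain` of `H` with a symmetric, bilinear,
positive map on it. -/
structure SymForm (H : Type*) [NormedAddCommGroup H] [InnerProductSpace ℝ H] where
  domain : Submodule ℝ H
  bilin : domain →ₗ[ℝ] domain →ₗ[ℝ] ℝ
  symm : ∀ f g, bilin f g = bilin g f
  nonneg : ∀ f, 0 ≤ bilin f f

namespace SymForm

variable {H : Type*} [NormedAddCommGroup H] [InnerProductSpace ℝ H]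

/-- The quadratic form `f ↦ Q(f)`, with value `∞` outside of the domain. -/
def value (Q : SymForm H) (f : H) : ℝ≥0∞ :=
  open Classical in if h : f ∈ Q.domain then ENNReal.ofReal (Q.bilin ⟨f, h⟩ ⟨f, h⟩) else ⊤

/-- The square of the form norm, `Q₁(f) = Q(f) + ‖f‖²`. -/
def normSq (Q : SymForm H) (f : Q.domain) : ℝ := Q.bilin f f + ‖(f : H)‖ ^ 2

/-- The form is closed: the domain is complete with respect to the form norm. -/
def IsClosedForm (Q : SymForm H) : Prop :=
  ∀ u : ℕ → Q.domain,
    (∀ ε > 0, ∃ N, ∀ n ≥ N, ∀ k ≥ N, Q.normSq (u n - u k) < ε) →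
      ∃ v : Q.domain, Tendsto (fun n => Q.normSq (u n - v)) atTop (𝓝 0)

/-- The form is densely defined. -/
def IsDenselyDefined (Q : SymForm H) : Prop := Dense (Q.domain : Set H)

/-- A set `S ⊆ H` is such that `D(Q) ∩ S` is dense in `D(Q)` with respect to the form norm. -/
def IsFormDense (Q : SymForm H) (S : Set H) : Prop :=
  ∀ f : Q.domain, ∀ ε > 0, ∃ g : Q.domain, (g : H) ∈ S ∧ Q.normSq (f - g) < ε

/-- The graph of the self-adjoint operator `L` associated with `Q`:
`g ∈ D(L)` and `L g = h` iff `g ∈ D(Q)` and `Q(f, g) = ⟨f, h⟩` for all `f ∈ D(Q)`. -/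
def OperatorRel (Q : SymForm H) (g h : H) : Prop :=
  ∃ hg : g ∈ Q.domain, ∀ f : Q.domain, Q.bilin f ⟨g, hg⟩ = inner ℝ (f : H) h

/-- `T` is the semigroup `(e^{-tL})_{t ≥ 0}` of `Q`: the strongly continuous semigroup of bounded
operators whose generator is `-L`, with `L` the operator associated with `Q`. -/
structure IsSemigroup (Q : SymForm H) (T : ℝ≥0 → H →L[ℝ] H) : Prop where
  zero : T 0 = ContinuousLinearMap.id ℝ H
  add : ∀ s t, T (s + t) = (T s).comp (T t)
  continuous : ∀ f, Continuous fun t => T t f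
  generator : ∀ f h, Q.OperatorRel f h ↔
    Tendsto (fun t : ℝ≥0 => (t : ℝ)⁻¹ • (f - T t f)) (𝓝[>] 0) (𝓝 h)

/-- Restriction of a form to a smaller domain. -/
def restrict (Q : SymForm H) (D : Submodule ℝ H) (hD : D ≤ Q.domain) : SymForm H where
  domain := D
  bilin := Q.bilin.compl₁₂ (Submodule.inclusion hD) (Submodule.inclusion hD)
  symm _ _ := Q.symm _ _
  nonneg _ := Q.nonneg _

lemma bilin_add_le (Q : SymForm H) (f g : Q.domain) :
    Q.normSq (f + g) ≤ 2 * Q.normSq f + 2 * Q.normSq g := by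
  have h1 := Q.nonneg (f - g)
  have h2 := parallelogram_law_with_norm ℝ (f : H) (g : H)
  have h3 := mul_self_nonneg ‖(f : H) - (g : H)‖
  have h4 := Q.symm f g
  simp only [map_sub, LinearMap.sub_apply] at h1
  simp only [normSq, map_add, LinearMap.add_apply, Submodule.coe_add]
  nlinarith

lemma normSq_smul (Q : SymForm H) (a : ℝ) (f : Q.domain) :
    Q.normSq (a • f) = a ^ 2 * Q.normSq f := by
  simp only [normSq, map_smul, LinearMap.smul_apply, smul_eq_mul, Submodule.coe_smul, norm_smul,
    mul_pow, Real.norm_eq_abs, sq_abs]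
  ring

/-- The form-norm closure of a subspace `V` of `D(Q)`, as a subspace of `H`. -/
def formClosure (Q : SymForm H) (V : Submodule ℝ Q.domain) : Submodule ℝ H where
  carrier := {f | ∃ hf : f ∈ Q.domain, ∀ ε > 0, ∃ v ∈ V, Q.normSq (⟨f, hf⟩ - v) < ε}
  zero_mem' := ⟨Q.domain.zero_mem, fun ε hε => ⟨0, V.zero_mem, by
    have : (⟨0, Q.domain.zero_mem⟩ : Q.domain) - 0 = 0 := by ext; simp
    rw [this]; simpa [normSq] using hε⟩⟩
  add_mem' := by
    rintro f g ⟨hf, Hf⟩ ⟨hg, Hg⟩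
    refine ⟨Q.domain.add_mem hf hg, fun ε hε => ?_⟩
    obtain ⟨v, hv, h1⟩ := Hf (ε / 4) (by positivity)
    obtain ⟨w, hw, h2⟩ := Hg (ε / 4) (by positivity)
    refine ⟨v + w, V.add_mem hv hw, ?_⟩
    have h3 := Q.bilin_add_le (⟨f, hf⟩ - v) (⟨g, hg⟩ - w)
    have h4 : (⟨f + g, Q.domain.add_mem hf hg⟩ : Q.domain) - (v + w)
        = (⟨f, hf⟩ - v) + (⟨g, hg⟩ - w) := by
      ext; simp; abel
    rw [h4]; linarith
  smul_mem' := by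
    rintro a f ⟨hf, Hf⟩
    refine ⟨Q.domain.smul_mem a hf, fun ε hε => ?_⟩
    obtain ⟨v, hv, h1⟩ := Hf (ε / (a ^ 2 + 1)) (by positivity)
    refine ⟨a • v, V.smul_mem a hv, ?_⟩
    have h4 : (⟨a • f, Q.domain.smul_mem a hf⟩ : Q.domain) - a • v = a • (⟨f, hf⟩ - v) := by
      ext; simp [smul_sub]
    rw [h4, normSq_smul]
    rw [lt_div_iff₀ (by positivity)] at h1
    have h5 : 0 ≤ Q.normSq (⟨f, hf⟩ - v) := add_nonneg (Q.nonneg _) (by positivity)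
    nlinarith

lemma formClosure_le (Q : SymForm H) (V : Submodule ℝ Q.domain) : Q.formClosure V ≤ Q.domain :=
  fun _ hf => hf.1

end SymForm

/-! ### Dirichlet forms on an `L²`-space -/

/-- The form is compatible with all normal contractions. -/
def SymForm.IsMarkovian {X : Type*} [MeasurableSpace X] {m : Measure X}
    (Q : SymForm (Lp ℝ 2 m)) : Prop :=
  ∀ (C : ℝ → ℝ) (hC : LipschitzWith 1 C) (h0 : C 0 = 0) (f : Lp ℝ 2 m),
    Q.value (hC.compLp h0 f) ≤ Q.value f

/-- A Dirichlet form: closed, densely defined, Markovian. -/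
structure SymForm.IsDirichletForm {X : Type*} [MeasurableSpace X] {m : Measure X}
    (Q : SymForm (Lp ℝ 2 m)) : Prop where
  closed : Q.IsClosedForm
  dense : Q.IsDenselyDefined
  markovian : Q.IsMarkovian

/-- `Q` is sandwiched between `Q₀` and `Q₁`: the semigroups satisfy
`e^{-tL₀} f ≤ e^{-tL} f ≤ e^{-tL₁} f` for all `f ≥ 0` and `t ≥ 0`. -/
def SymForm.IsSandwiched {X : Type*} [MeasurableSpace X] {m : Measure X}
    (Q Q₀ Q₁ : SymForm (Lp ℝ 2 m)) : Prop :=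
  ∃ T T₀ T₁ : ℝ≥0 → Lp ℝ 2 m →L[ℝ] Lp ℝ 2 m,
    Q.IsSemigroup T ∧ Q₀.IsSemigroup T₀ ∧ Q₁.IsSemigroup T₁ ∧
      ∀ t, ∀ f : Lp ℝ 2 m, 0 ≤ f → T₀ t f ≤ T t f ∧ T t f ≤ T₁ t f

/-! ### Graphs over discrete measure spaces -/

/-- A measure on a discrete space with `0 < m({x}) < ∞` for all `x`. -/
class IsVertexMeasure {X : Type*} [MeasurableSpace X] (m : Measure X) : Prop where
  pos : ∀ x, 0 < m {x}
  lt_top : ∀ x, m {x} < ⊤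

/-- A graph `(b, c)` over `X`: edge weight `b` and killing term `c`. -/
structure WGraph (X : Type*) where
  b : X → X → ℝ
  c : X → ℝ
  b_nonneg : ∀ x y, 0 ≤ b x y
  b_symm : ∀ x y, b x y = b y x
  b_diag : ∀ x, b x x = 0
  b_summable : ∀ x, Summable (b x)
  c_nonneg : ∀ x, 0 ≤ c x

namespace WGraph

section Energy

variable {X : Type*} (G : WGraph X)

/-- `f` has finite energy. -/
def FiniteEnergy (f : X → ℝ) : Prop :=
  Summable (fun p : X × X => G.b p.1 p.2 * (f p.1 - f p.2) ^ 2) ∧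
    Summable fun x => G.c x * f x ^ 2

/-- The energy form
`𝒬(f,g) = ½ ∑ b(x,y)(f(x)-f(y))(g(x)-g(y)) + ∑ c(x) f(x) g(x)`, for `f, g` of finite energy. -/
def energy (f g : X → ℝ) : ℝ :=
  (1 / 2) * ∑' p : X × X, G.b p.1 p.2 * ((f p.1 - f p.2) * (g p.1 - g p.2)) +
    ∑' x, G.c x * (f x * g x)

/-- The domain `ℱ` of the formal Laplacian. -/
def MemF (f : X → ℝ) : Prop := ∀ x, Summable fun y => G.b x y * |f y|

/-- The formal Laplacian. -/
def formalLaplacian [MeasurableSpace X] (m : Measure X) (f : X → ℝ) (x : X) : ℝ :=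
  1 / m.real {x} * ∑' y, G.b x y * (f x - f y) + G.c x / m.real {x} * f x

lemma summable_mul_aux {ι : Type*} {w u v : ι → ℝ} (hw : ∀ i, 0 ≤ w i)
    (hu : Summable fun i => w i * u i ^ 2) (hv : Summable fun i => w i * v i ^ 2) :
    Summable fun i => w i * (u i * v i) := by
  refine Summable.of_norm_bounded (hu.add hv) fun i => ?_
  rw [Real.norm_eq_abs, abs_mul, abs_of_nonneg (hw i), ← mul_add]
  refine mul_le_mul_of_nonneg_left ?_ (hw i)
  rw [abs_le]
  constructor <;> nlinarith [sq_nonneg (u i - v i), sq_nonneg (u i + v i), sq_nonneg (u i),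
    sq_nonneg (v i)]

lemma FiniteEnergy.summable_b {f g : X → ℝ} (hf : G.FiniteEnergy f) (hg : G.FiniteEnergy g) :
    Summable fun p : X × X => G.b p.1 p.2 * ((f p.1 - f p.2) * (g p.1 - g p.2)) :=
  summable_mul_aux (w := fun p : X × X => G.b p.1 p.2) (fun p => G.b_nonneg p.1 p.2) hf.1 hg.1

lemma FiniteEnergy.summable_c {f g : X → ℝ} (hf : G.FiniteEnergy f) (hg : G.FiniteEnergy g) :
    Summable fun x => G.c x * (f x * g x) :=
  summable_mul_aux G.c_nonneg hf.2 hg.2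

lemma FiniteEnergy.add {f g : X → ℝ} (hf : G.FiniteEnergy f) (hg : G.FiniteEnergy g) :
    G.FiniteEnergy (f + g) := by
  constructor
  · refine ((hf.1.add hg.1).add ((hf.summable_b G hg).mul_left 2)).congr fun p => ?_
    simp only [Pi.add_apply]; ring
  · refine ((hf.2.add hg.2).add ((hf.summable_c G hg).mul_left 2)).congr fun p => ?_
    simp only [Pi.add_apply]; ring

lemma FiniteEnergy.smul {f : X → ℝ} (a : ℝ) (hf : G.FiniteEnergy f) :
    G.FiniteEnergy (a • f) := by
  constructor
  · refine (hf.1.mul_left (a ^ 2)).congr fun p => ?_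
    simp only [Pi.smul_apply, smul_eq_mul]; ring
  · refine (hf.2.mul_left (a ^ 2)).congr fun p => ?_
    simp only [Pi.smul_apply, smul_eq_mul]; ring

lemma finiteEnergy_zero : G.FiniteEnergy 0 := by
  constructor <;> simp

lemma energy_add {f f' g : X → ℝ} (hf : G.FiniteEnergy f) (hf' : G.FiniteEnergy f')
    (hg : G.FiniteEnergy g) : G.energy (f + f') g = G.energy f g + G.energy f' g := by
  have h1 : ∀ p : X × X, G.b p.1 p.2 * (((f + f') p.1 - (f + f') p.2) * (g p.1 - g p.2)) =
      G.b p.1 p.2 * ((f p.1 - f p.2) * (g p.1 - g p.2)) +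
        G.b p.1 p.2 * ((f' p.1 - f' p.2) * (g p.1 - g p.2)) := fun p => by
    simp only [Pi.add_apply]; ring
  have h2 : ∀ x, G.c x * ((f + f') x * g x) = G.c x * (f x * g x) + G.c x * (f' x * g x) :=
    fun x => by simp only [Pi.add_apply]; ring
  simp only [energy, h1, h2]
  rw [(hf.summable_b G hg).tsum_add (hf'.summable_b G hg),
    (hf.summable_c G hg).tsum_add (hf'.summable_c G hg)]
  ring

lemma energy_smul (a : ℝ) (f g : X → ℝ) : G.energy (a • f) g = a * G.energy f g := by
  have h1 : ∀ p : X × X, G.b p.1 p.2 * (((a • f) p.1 - (a • f) p.2) * (g p.1 - g p.2)) =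
      a * (G.b p.1 p.2 * ((f p.1 - f p.2) * (g p.1 - g p.2))) := fun p => by
    simp only [Pi.smul_apply, smul_eq_mul]; ring
  have h2 : ∀ x, G.c x * ((a • f) x * g x) = a * (G.c x * (f x * g x)) :=
    fun x => by simp only [Pi.smul_apply, smul_eq_mul]; ring
  simp only [energy, h1, h2, tsum_mul_left]
  ring

lemma energy_comm (f g : X → ℝ) : G.energy f g = G.energy g f := by
  simp only [energy, mul_comm (f _ - f _), mul_comm (f _)]

lemma energy_self_nonneg (f : X → ℝ) : 0 ≤ G.energy f f :=
  add_nonneg (mul_nonneg (by norm_num)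
      (tsum_nonneg fun p => mul_nonneg (G.b_nonneg _ _) (mul_self_nonneg _)))
    (tsum_nonneg fun x => mul_nonneg (G.c_nonneg _) (mul_self_nonneg _))

end Energy

section Forms

variable {X : Type*} [MeasurableSpace X] (G : WGraph X) (m : Measure X) [IsVertexMeasure m]

lemma eq_of_ae {f g : X → ℝ} (h : f =ᵐ[m] g) : f = g := by
  funext x
  by_contra hx
  have h0 : m {x} ≤ m {y | ¬ f y = g y} := measure_mono (by rintro y rfl; exact hx)
  rw [ae_iff.1 h] at h0
  exact absurd h0 (not_le.2 (IsVertexMeasure.pos x))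

lemma coe_add (f g : Lp ℝ 2 m) : (⇑(f + g) : X → ℝ) = f + g := eq_of_ae m (Lp.coeFn_add f g)

lemma coe_smul (a : ℝ) (f : Lp ℝ 2 m) : (⇑(a • f) : X → ℝ) = a • ⇑f :=
  eq_of_ae m (Lp.coeFn_smul a f)

lemma coe_zero : (⇑(0 : Lp ℝ 2 m) : X → ℝ) = 0 := eq_of_ae m (Lp.coeFn_zero ℝ 2 m)

/-- The Neumann form `Q^(N)`: the energy form on the functions of finite energy in `ℓ²(X,m)`. -/
def neumann : SymForm (Lp ℝ 2 m) where
  domain :=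
    { carrier := {f | G.FiniteEnergy f}
      zero_mem' := by simpa only [mem_ofPred_eq, coe_zero] using G.finiteEnergy_zero
      add_mem' := fun {f g} hf hg => by
        simpa only [mem_ofPred_eq, coe_add] using FiniteEnergy.add G hf hg
      smul_mem' := fun a f hf => by
        simpa only [mem_ofPred_eq, coe_smul] using FiniteEnergy.smul G a hf }
  bilin := LinearMap.mk₂ ℝ (fun f g => G.energy (f : Lp ℝ 2 m) (g : Lp ℝ 2 m))
    (fun f f' g => by
      simpa only [Submodule.coe_add, coe_add] using G.energy_add f.2 f'.2 g.2)
    (fun a f g => by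
      simpa only [Submodule.coe_smul, coe_smul, smul_eq_mul] using G.energy_smul a _ _)
    (fun f g g' => by
      simpa only [Submodule.coe_add, coe_add, G.energy_comm (f : Lp ℝ 2 m)] using
        G.energy_add g.2 g'.2 f.2)
    (fun a f g => by
      simpa only [Submodule.coe_smul, coe_smul, smul_eq_mul, G.energy_comm (f : Lp ℝ 2 m)] using
        G.energy_smul a _ _)
  symm f g := G.energy_comm _ _
  nonneg f := G.energy_self_nonneg _

/-- The finitely supported functions `C_c(X)`, as a subspace of `D(Q^(N))`. -/
def finSupp : Submodule ℝ (G.neumann m).domain where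
  carrier := {f | (Function.support ⇑(f : Lp ℝ 2 m)).Finite}
  zero_mem' := by
    change (Function.support ⇑(0 : Lp ℝ 2 m)).Finite
    rw [coe_zero]; simp
  add_mem' := fun {f g} hf hg => by
    simp only [mem_ofPred_eq, Submodule.coe_add, coe_add]
    exact (hf.union hg).subset (Function.support_add _ _)
  smul_mem' := fun a f hf => by
    simp only [mem_ofPred_eq, Submodule.coe_smul, coe_smul]
    exact hf.subset (Function.support_const_smul_subset a _)

/-- The Dirichlet form `Q^(D)`: the restriction of `Q^(N)` to the form-norm closure of `C_c(X)`. -/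
def dirichlet : SymForm (Lp ℝ 2 m) :=
  (G.neumann m).restrict ((G.neumann m).formClosure (G.finSupp m))
    ((G.neumann m).formClosure_le (G.finSupp m))

/-! ### The Royden compactification and the harmonic boundary -/

/-- The set `D(Q^(N)) ∩ ℓ^∞(X)`. -/
def BddFun : Type _ :=
  {f : Lp ℝ 2 m // f ∈ (G.neumann m).domain ∧ ∃ M : ℝ, ∀ x, |f x| ≤ M}

/-- The evaluation map of `X` into the product `ℝ^(D(Q^(N)) ∩ ℓ^∞(X))`. -/
def evalMap (x : X) : BddFun G m → ℝ := fun f => f.1 x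

/-- The Royden compactification `X̂`: the closure of the image of `X` in the product space
`ℝ^(D(Q^(N)) ∩ ℓ^∞(X))`. The continuous extension of `f ∈ D(Q^(N)) ∩ ℓ^∞(X)` to `X̂` is the
coordinate `ω ↦ ω f`. -/
def Royden : Type _ := closure (range (evalMap G m))

instance : TopologicalSpace (Royden G m) := instTopologicalSpaceSubtype

instance : MeasurableSpace (Royden G m) := borel _

instance : BorelSpace (Royden G m) := ⟨rfl⟩

/-- The inclusion `X → X̂`. -/
def incl (x : X) : Royden G m := ⟨evalMap G m x, subset_closure (mem_range_self x)⟩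

/-- The `1`-harmonic boundary `∂X`: the points of `X̂ \ X` at which all (extensions of) functions
in `D(Q^(D)) ∩ ℓ^∞(X)` vanish. -/
def boundary : Set (Royden G m) :=
  {ω | ω ∉ range (incl G m) ∧ ∀ f : BddFun G m, f.1 ∈ (G.dirichlet m).domain → ω.1 f = 0}

/-- The space `X ∪ ∂X`, a subset of `X̂`. -/
def withBoundary : Set (Royden G m) := range (incl G m) ∪ boundary G m

/-- The continuous extension `X̂ → [-∞,∞]` of a function on `X`, given by its limits along `X`. -/
def extend (f : X → ℝ) (ω : Royden G m) : EReal :=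
  limUnder (comap (incl G m) (𝓝 ω)) fun x => (f x : EReal)

/-- Elements of `ℓ²(X,m)` with a continuous real-valued extension to `X ∪ ∂X`. -/
def contFun : Set (Lp ℝ 2 m) :=
  {f | ∃ g : withBoundary G m → ℝ, Continuous g ∧ ∀ x, g ⟨incl G m x, Or.inl ⟨x, rfl⟩⟩ = f x}

/-- Elements of `ℓ²(X,m)` with a continuous real-valued extension to `X ∪ ∂X` that has compact
support in `X ∪ ∂X`. -/
def compactSuppFun : Set (Lp ℝ 2 m) :=
  {f | ∃ g : withBoundary G m → ℝ, Continuous g ∧ HasCompactSupport g ∧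
    ∀ x, g ⟨incl G m x, Or.inl ⟨x, rfl⟩⟩ = f x}

/-- The integral `∫ |f|² dν` over `∂X \ F` of the continuous extension of `f`. -/
def boundaryIntegral {F : Set (Royden G m)} (ν : Measure ↥(boundary G m \ F)) (f : X → ℝ) :
    ℝ≥0∞ :=
  ∫⁻ ω, (extend G m f ω.1).abs ^ 2 ∂ν

/-- `Q` is given by a closed set `F ⊆ ∂X` and a Radon measure `ν` on `∂X \ F`:
`D(Q) = {f ∈ D(Q^(N)) | f = 0 on F, ∫ |f|² dν < ∞}` and `Q(f) = Q^(N)(f) + ∫ |f|² dν`. -/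
def HasBoundaryRepresentation (Q : SymForm (Lp ℝ 2 m)) : Prop :=
  ∃ F : Set (Royden G m), F ⊆ boundary G m ∧ IsClosed F ∧
    ∃ ν : Measure ↥(boundary G m \ F), ν.Regular ∧
      (∀ f : Lp ℝ 2 m, f ∈ Q.domain ↔ f ∈ (G.neumann m).domain ∧
        (∀ ω ∈ F, extend G m f ω = 0) ∧ boundaryIntegral G m ν f < ⊤) ∧
      ∀ f ∈ Q.domain, Q.value f = (G.neumann m).value f + boundaryIntegral G m ν f

/-- The self-adjoint operator of `Q` is a restriction of the formal Laplacian. -/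
def OperatorRestrictsLaplacian (Q : SymForm (Lp ℝ 2 m)) : Prop :=
  ∀ f h : Lp ℝ 2 m, Q.OperatorRel f h →
    G.MemF f ∧ (⇑h : X → ℝ) = G.formalLaplacian m f

end Forms

end WGraph

end

noncomputable section

set_option linter.unusedSectionVars false

namespace SymForm

variable {H : Type*} [NormedAddCommGroup H] [InnerProductSpace ℝ H]

/-! ### Elementary properties of symmetric forms -/

/-! Write q = Q - Q^(N) on D(Q), called `excess` below.

The first task is to replace the order relation between semigroups by one between forms
(`isSandwiched_iff`). An inequality between semigroups passes to the resolvents by a Laplace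
transform, then to the approximating forms a⟨f - a(L + a)⁻¹f, g⟩, and, as a → ∞, to the forms.
Conversely, domination of forms compares the resolvents, by testing with the positive part of their
difference, and the exponentials of the Yosida approximations carry this over to the semigroups.
Since being sandwiched includes the existence of the three semigroups, these are constructed as
well.

In terms of forms, Q is sandwiched when D(Q^(D)) ⊆ D(Q) ⊆ D(Q^(N)) are successive order ideals, q is
nonnegative on pairs of positive functions, and q vanishes on pairs from D(Q^(D)). The decisive fact
is that q is local (`excess_eq_zero_of_disjoint`). Let f, g ≥ 0 be disjoint. The Markov property
gives Q(f, g') ≤ 0 for every restriction g' of g; finitely supported functions do not contribute to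
q(f, g); and Q^(N)(f, g') → 0 when g' is g cut off outside growing finite sets. Hence q(f, g) ≤ 0.
It follows that D(Q^(D)) lies in the kernel of q, so that q only sees values on ∂X.

Locality makes I(f) = q(f, 1) meaningful, with 1 replaced by any plateau function equal to 1 where f
≠ 0. Bisecting the range of f shows that q(f, f) = I(f²) (`exists_excess_self_eq`). A function whose
extension is nonnegative on ∂X has its negative part in D(Q^(D)), so I is positive as a functional
of boundary values. With F the set of common zeros on ∂X of the bounded functions in D(Q), the
extension theorem of M. Riesz and the Riesz–Markov theorem represent I by a Radon measure ν on ∂X \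
F (`exists_boundary_measure`). Cut-offs, monotone convergence and lower semicontinuity of closed
forms extend q(f, f) = ∫ |f|² dν to all of D(Q) and identify the domain.

For the converse, q is the quadratic form of a measure on ∂X. It vanishes on D(Q^(D)) by
Cauchy–Schwarz and is nonnegative on positive pairs because |f - g| ≤ f + g, so Q is sandwiched.
Bounded functions are form dense by cut-offs and extend continuously. If X ∪ ∂X is locally compact,
it is open in the compactification, and bounded functions can be modified inside D(Q^(D)) so as to
have compact support. Testing Q against point masses, which lie in D(Q^(D)), identifies the
operator. -/

lemma normSq_nonneg (Q : SymForm H) (f : Q.domain) : 0 ≤ Q.normSq f :=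
  add_nonneg (Q.nonneg f) (by positivity)

lemma bilin_add_add (Q : SymForm H) (f g : Q.domain) :
    Q.bilin (f + g) (f + g) = Q.bilin f f + 2 * Q.bilin f g + Q.bilin g g := by
  simp only [map_add, LinearMap.add_apply, Q.symm g f]
  ring

lemma bilin_sub_sub (Q : SymForm H) (f g : Q.domain) :
    Q.bilin (f - g) (f - g) = Q.bilin f f - 2 * Q.bilin f g + Q.bilin g g := by
  simp only [map_sub, LinearMap.sub_apply, Q.symm g f]
  ring

lemma bilin_parallelogram (Q : SymForm H) (f g : Q.domain) :
    Q.bilin (f + g) (f + g) + Q.bilin (f - g) (f - g) = 2 * Q.bilin f f + 2 * Q.bilin g g := by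
  rw [bilin_add_add, bilin_sub_sub]
  ring

/-- Cauchy–Schwarz for a possibly degenerate form, from the discriminant of t ↦ Q(f + t g). It is
also applied to the difference of two forms, for which definiteness is out of the question. -/
lemma bilin_sq_le (Q : SymForm H) (f g : Q.domain) :
    Q.bilin f g ^ 2 ≤ Q.bilin f f * Q.bilin g g := by
  have key : ∀ t : ℝ, 0 ≤ Q.bilin g g * (t * t) + (2 * Q.bilin f g) * t + Q.bilin f f := by
    intro t
    have h := Q.nonneg (f + t • g)
    rw [bilin_add_add] at h
    simp only [map_smul, LinearMap.smul_apply, smul_eq_mul] at h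
    nlinarith
  have := discrim_le_zero key
  rw [discrim] at this
  nlinarith

lemma abs_bilin_le (Q : SymForm H) (f g : Q.domain) :
    |Q.bilin f g| ≤ √(Q.bilin f f) * √(Q.bilin g g) := by
  rw [← Real.sqrt_mul (Q.nonneg f)]
  exact Real.abs_le_sqrt (Q.bilin_sq_le f g)

/-- Convergence of a sequence in the form norm. -/
def FormTendsto (Q : SymForm H) (u : ℕ → Q.domain) (v : Q.domain) : Prop :=
  Tendsto (fun n => Q.normSq (u n - v)) atTop (𝓝 0)

variable {Q : SymForm H} {u : ℕ → Q.domain} {v : Q.domain}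

lemma formTendsto_iff : Q.FormTendsto u v ↔
    Tendsto (fun n => Q.bilin (u n - v) (u n - v)) atTop (𝓝 0) ∧
      Tendsto (fun n => (u n : H)) atTop (𝓝 v) := by
  constructor
  · intro h
    refine ⟨squeeze_zero (fun n => Q.nonneg _) (fun n => ?_) h, ?_⟩
    · simp only [normSq]
      have : 0 ≤ ‖((u n - v : Q.domain) : H)‖ ^ 2 := by positivity
      linarith
    · rw [tendsto_iff_norm_sub_tendsto_zero]
      have h2 : Tendsto (fun n => ‖(u n : H) - v‖ ^ 2) atTop (𝓝 0) := by
        refine squeeze_zero (fun n => by positivity) (fun n => ?_) h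
        have := Q.nonneg (u n - v)
        simp only [normSq, Submodule.coe_sub]
        linarith
      simpa [Real.sqrt_sq] using h2.sqrt
  · rintro ⟨h1, h2⟩
    rw [tendsto_iff_norm_sub_tendsto_zero] at h2
    have := h1.add (h2.pow 2)
    simpa [FormTendsto, normSq] using this

lemma FormTendsto.tendsto (h : Q.FormTendsto u v) :
    Tendsto (fun n => (u n : H)) atTop (𝓝 v) := (formTendsto_iff.1 h).2

lemma FormTendsto.bilin_left (h : Q.FormTendsto u v) (g : Q.domain) :
    Tendsto (fun n => Q.bilin (u n) g) atTop (𝓝 (Q.bilin v g)) := by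
  rw [tendsto_iff_norm_sub_tendsto_zero]
  have h1 := ((formTendsto_iff.1 h).1.sqrt).mul_const √(Q.bilin g g)
  rw [Real.sqrt_zero, zero_mul] at h1
  refine squeeze_zero (fun n => norm_nonneg _) (fun n => ?_) h1
  rw [← LinearMap.sub_apply, ← map_sub]
  exact Q.abs_bilin_le _ _

lemma FormTendsto.bilin_self (h : Q.FormTendsto u v) :
    Tendsto (fun n => Q.bilin (u n) (u n)) atTop (𝓝 (Q.bilin v v)) := by
  have h1 := (formTendsto_iff.1 h).1.add ((h.bilin_left v).const_mul 2)
  have h2 := h1.sub_const (Q.bilin v v)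
  refine (h2.congr fun n => ?_).trans (by ring_nf; rfl)
  rw [bilin_sub_sub]
  ring

/-- The working version of closedness: the Hilbert space limit is known beforehand, and only the
energies have to be Cauchy. -/
lemma IsClosedForm.exists_formTendsto (hQ : Q.IsClosedForm) {w : H}
    (hw : Tendsto (fun n => (u n : H)) atTop (𝓝 w))
    (hc : ∀ ε > 0, ∃ N, ∀ n ≥ N, ∀ k ≥ N, Q.bilin (u n - u k) (u n - u k) < ε) :
    ∃ h : w ∈ Q.domain, Q.FormTendsto u ⟨w, h⟩ := by
  obtain ⟨v, hv⟩ := hQ u (by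
    intro ε hε
    obtain ⟨N₁, h1⟩ := hc (ε / 2) (by positivity)
    obtain ⟨N₂, h2⟩ := Metric.cauchySeq_iff.1 hw.cauchySeq √(ε / 2) (by positivity)
    refine ⟨max N₁ N₂, fun n hn k hk => ?_⟩
    have h3 := h1 n (le_of_max_le_left hn) k (le_of_max_le_left hk)
    have h4 := h2 n (le_of_max_le_right hn) k (le_of_max_le_right hk)
    rw [dist_eq_norm, Real.lt_sqrt (norm_nonneg _)] at h4
    simp only [normSq, Submodule.coe_sub]
    linarith)
  have : w = v := tendsto_nhds_unique hw (FormTendsto.tendsto hv)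
  subst this
  exact ⟨v.2, hv⟩

/-! ### Resolvents -/

/-- Fréchet–Riesz in the inner product B. The norm of `E` is built from B inside the proof, so that
the completeness hypothesis can be phrased for a bare bilinear map. -/
lemma exists_bilin_eq_of_complete {E : Type*} [AddCommGroup E] [Module ℝ E]
    (B : E →ₗ[ℝ] E →ₗ[ℝ] ℝ) (hsymm : ∀ x y, B x y = B y x) (hpos : ∀ x, x ≠ 0 → 0 < B x x)
    (hcomplete : ∀ s : ℕ → E, (∀ ε > 0, ∃ N, ∀ n ≥ N, ∀ k ≥ N, B (s n - s k) (s n - s k) < ε) →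
      ∃ v, Tendsto (fun n => B (s n - v) (s n - v)) atTop (𝓝 0))
    (ℓ : E →ₗ[ℝ] ℝ) (C : ℝ) (hC : 0 ≤ C) (hℓ : ∀ x, ℓ x ^ 2 ≤ C ^ 2 * B x x) :
    ∃ u, ∀ g, B u g = ℓ g := by
  let core : InnerProductSpace.Core ℝ E :=
    { inner := fun x y => B x y
      conj_inner_symm := fun x y => by simpa using hsymm y x
      re_inner_nonneg := fun x => by
        rcases eq_or_ne x 0 with rfl | hx
        · simp
        · simpa using (hpos x hx).le
      add_left := fun x y z => by simp
      smul_left := fun x y r => by simp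
      definite := fun x hx => by
        by_contra h
        exact (hpos x h).ne' hx }
  let _ : NormedAddCommGroup E := core.toNormedAddCommGroup
  let _ : InnerProductSpace ℝ E := InnerProductSpace.ofCore core.toCore
  have inner_def : ∀ x y : E, inner ℝ x y = B x y := fun _ _ => rfl
  have norm_def : ∀ x : E, ‖x‖ ^ 2 = B x x := fun x => by
    rw [← real_inner_self_eq_norm_sq, inner_def]
  have : CompleteSpace E := by
    refine Metric.complete_of_cauchySeq_tendsto fun s hs => ?_
    obtain ⟨v, hv⟩ := hcomplete s (by
      intro ε hε
      obtain ⟨N, hN⟩ := Metric.cauchySeq_iff.1 hs √ε (by positivity)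
      refine ⟨N, fun n hn k hk => ?_⟩
      have h := hN n hn k hk
      rwa [dist_eq_norm, Real.lt_sqrt (norm_nonneg _), norm_def] at h)
    refine ⟨v, ?_⟩
    rw [tendsto_iff_norm_sub_tendsto_zero]
    simp only [← norm_def] at hv
    simpa [Real.sqrt_sq] using hv.sqrt
  have hb : ∀ x : E, ‖ℓ x‖ ≤ C * ‖x‖ := by
    intro x
    refine le_of_sq_le_sq ?_ (by positivity)
    rw [Real.norm_eq_abs, sq_abs, mul_pow, norm_def]
    exact hℓ x
  refine ⟨(InnerProductSpace.toDual ℝ E).symm (ℓ.mkContinuous _ hb), fun g => ?_⟩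
  rw [← inner_def, InnerProductSpace.toDual_symm_apply]
  rfl

/-- The bilinear map `Q(f, g) + a ⟨f, g⟩`. -/
def shifted (Q : SymForm H) (a : ℝ) : Q.domain →ₗ[ℝ] Q.domain →ₗ[ℝ] ℝ :=
  Q.bilin + a • (innerₗ H).compl₁₂ Q.domain.subtype Q.domain.subtype

lemma shifted_apply (Q : SymForm H) (a : ℝ) (f g : Q.domain) :
    Q.shifted a f g = Q.bilin f g + a * inner ℝ (f : H) (g : H) := rfl

lemma shifted_self (Q : SymForm H) (a : ℝ) (f : Q.domain) :
    Q.shifted a f f = Q.bilin f f + a * ‖(f : H)‖ ^ 2 := by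
  rw [shifted_apply, real_inner_self_eq_norm_sq]

lemma IsClosedForm.exists_resolvent (hQ : Q.IsClosedForm) {a : ℝ} (ha : 0 < a) (f : H) :
    ∃ u : Q.domain, ∀ g : Q.domain, Q.bilin u g + a * inner ℝ (u : H) g = inner ℝ f (g : H) := by
  refine exists_bilin_eq_of_complete (Q.shifted a) (fun x y => ?_) (fun x hx => ?_)
    (fun s hs => ?_) ((innerₗ H f).comp Q.domain.subtype) (‖f‖ / √a) (by positivity) fun x => ?_
  · rw [shifted_apply, shifted_apply, Q.symm, real_inner_comm]
  · have : (x : H) ≠ 0 := fun h => hx (Subtype.ext h)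
    have := Q.nonneg x
    rw [shifted_self]
    positivity
  · obtain ⟨v, hv⟩ := hQ s (by
      intro ε hε
      -- Closedness refers to Q + ‖·‖², whereas the sequence is Cauchy for Q + a‖·‖²; the factor
      -- comes from A + B ≤ (1 + 1/a)(A + aB).
      obtain ⟨N, hN⟩ := hs (ε / (1 + 1 / a)) (by positivity)
      refine ⟨N, fun n hn k hk => ?_⟩
      have h := hN n hn k hk
      rw [lt_div_iff₀ (by positivity), shifted_self] at h
      have h1 := Q.nonneg (s n - s k)
      set A := Q.bilin (s n - s k) (s n - s k) with hA
      set B := ‖((s n - s k : Q.domain) : H)‖ ^ 2 with hB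
      have hB0 : 0 ≤ B := by positivity
      have h3 : (A + a * B) * (1 + 1 / a) = A + A * (1 / a) + a * B + B := by
        field_simp
        ring
      have h4 : 0 ≤ A * (1 / a) := by positivity
      have h5 : 0 ≤ a * B := by positivity
      change A + B < ε
      linarith)
    refine ⟨v, ?_⟩
    obtain ⟨h1, h2⟩ := formTendsto_iff.1 hv
    rw [tendsto_iff_norm_sub_tendsto_zero] at h2
    have h3 := h1.add ((h2.pow 2).const_mul a)
    simp only [ne_eq, OfNat.ofNat_ne_zero, not_false_eq_true, zero_pow, mul_zero, add_zero] at h3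
    exact h3.congr fun n => (Q.shifted_self a _).symm
  · have h1 : inner ℝ f (x : H) ^ 2 ≤ ‖f‖ ^ 2 * ‖(x : H)‖ ^ 2 := by
      rw [← mul_pow, ← sq_abs (inner ℝ f (x : H))]
      gcongr
      exact abs_real_inner_le_norm _ _
    have h2 := Q.nonneg x
    rw [shifted_self, div_pow, Real.sq_sqrt ha.le]
    refine h1.trans ?_
    rw [div_mul_eq_mul_div, le_div_iff₀ ha]
    nlinarith [sq_nonneg ‖f‖]

lemma shifted_injective {a : ℝ} (ha : 0 < a) {u v : Q.domain}
    (h : ∀ g : Q.domain, Q.bilin u g + a * inner ℝ (u : H) g =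
      Q.bilin v g + a * inner ℝ (v : H) g) : u = v := by
  have h1 := h (u - v)
  have h2 : Q.shifted a (u - v) (u - v) = 0 := by
    rw [LinearMap.map_sub₂, shifted_apply, shifted_apply, h1, sub_self]
  rw [shifted_self] at h2
  have h3 := Q.nonneg (u - v)
  have h4 : ‖((u - v : Q.domain) : H)‖ ^ 2 = 0 := by
    have : 0 ≤ ‖((u - v : Q.domain) : H)‖ ^ 2 := by positivity
    nlinarith
  have h5 : ((u - v : Q.domain) : H) = 0 := by simpa using h4
  exact sub_eq_zero.1 (Subtype.ext h5)

/-- The resolvent as a linear map into the domain of the form. -/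
def IsClosedForm.resolventDom (hQ : Q.IsClosedForm) {a : ℝ} (ha : 0 < a) : H →ₗ[ℝ] Q.domain where
  toFun f := (hQ.exists_resolvent ha f).choose
  map_add' f g := shifted_injective ha fun h => by
    have h1 := (hQ.exists_resolvent ha f).choose_spec h
    have h2 := (hQ.exists_resolvent ha g).choose_spec h
    rw [(hQ.exists_resolvent ha (f + g)).choose_spec h, map_add, LinearMap.add_apply,
      Submodule.coe_add, inner_add_left, inner_add_left]
    linarith
  map_smul' r f := shifted_injective ha fun h => by
    have h1 := (hQ.exists_resolvent ha f).choose_spec h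
    rw [(hQ.exists_resolvent ha (r • f)).choose_spec h, map_smul, LinearMap.smul_apply,
      Submodule.coe_smul, RingHom.id_apply, real_inner_smul_left, real_inner_smul_left,
      smul_eq_mul, ← h1]
    ring

lemma IsClosedForm.resolventDom_spec (hQ : Q.IsClosedForm) {a : ℝ} (ha : 0 < a) (f : H)
    (g : Q.domain) : Q.bilin (hQ.resolventDom ha f) g +
      a * inner ℝ (hQ.resolventDom ha f : H) g = inner ℝ f (g : H) :=
  (hQ.exists_resolvent ha f).choose_spec g

lemma IsClosedForm.norm_resolventDom_le (hQ : Q.IsClosedForm) {a : ℝ} (ha : 0 < a) (f : H) :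
    ‖(hQ.resolventDom ha f : H)‖ ≤ a⁻¹ * ‖f‖ := by
  have h1 := hQ.resolventDom_spec ha f (hQ.resolventDom ha f)
  have h2 := Q.nonneg (hQ.resolventDom ha f)
  rw [real_inner_self_eq_norm_sq] at h1
  have h3 := real_inner_le_norm f (hQ.resolventDom ha f : H)
  rw [inv_mul_eq_div, le_div_iff₀ ha]
  rcases eq_or_lt_of_le (norm_nonneg (hQ.resolventDom ha f : H)) with h | h
  · rw [← h]
    simp
  · nlinarith

/-- The resolvent `(L + a)⁻¹`. -/
def IsClosedForm.resolvent (hQ : Q.IsClosedForm) {a : ℝ} (ha : 0 < a) : H →L[ℝ] H :=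
  (Q.domain.subtype.comp (hQ.resolventDom ha)).mkContinuous a⁻¹ (hQ.norm_resolventDom_le ha)

lemma IsClosedForm.coe_resolventDom (hQ : Q.IsClosedForm) {a : ℝ} (ha : 0 < a) (f : H) :
    (hQ.resolventDom ha f : H) = hQ.resolvent ha f := rfl

lemma IsClosedForm.norm_resolvent_le (hQ : Q.IsClosedForm) {a : ℝ} (ha : 0 < a) :
    ‖hQ.resolvent ha‖ ≤ a⁻¹ :=
  LinearMap.mkContinuous_norm_le _ (by positivity) _

lemma operatorRel_iff {g h : H} : Q.OperatorRel g h ↔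
    ∃ hg : g ∈ Q.domain, ∀ f : Q.domain, Q.bilin ⟨g, hg⟩ f = inner ℝ h (f : H) := by
  refine exists_congr fun hg => forall_congr' fun f => ?_
  rw [Q.symm, real_inner_comm]

/-- `(L + a) g = h` if and only if `g` is the resolvent of `h`. -/
lemma IsClosedForm.operatorRel_iff_resolvent (hQ : Q.IsClosedForm) {a : ℝ} (ha : 0 < a)
    {g h : H} : Q.OperatorRel g h ↔ g = hQ.resolvent ha (h + a • g) := by
  rw [operatorRel_iff]
  constructor
  · rintro ⟨hg, H⟩
    have : (⟨g, hg⟩ : Q.domain) = hQ.resolventDom ha (h + a • g) := by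
      refine shifted_injective ha fun f => ?_
      rw [hQ.resolventDom_spec, H, inner_add_left, real_inner_smul_left]
    rw [← hQ.coe_resolventDom, ← this]
  · intro H
    have hg : g ∈ Q.domain := by
      rw [H, ← hQ.coe_resolventDom]
      exact Subtype.coe_prop _
    refine ⟨hg, fun f => ?_⟩
    have h1 := hQ.resolventDom_spec ha (h + a • g) f
    have h2 : hQ.resolventDom ha (h + a • g) = ⟨g, hg⟩ := Subtype.ext H.symm
    rw [h2, inner_add_left, real_inner_smul_left] at h1
    linarith

lemma IsClosedForm.operatorRel_resolvent (hQ : Q.IsClosedForm) {a : ℝ} (ha : 0 < a) (f : H) :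
    Q.OperatorRel (hQ.resolvent ha f) (f - a • hQ.resolvent ha f) := by
  rw [hQ.operatorRel_iff_resolvent ha, sub_add_cancel]

/-- The resolvent identity. -/
lemma IsClosedForm.resolvent_sub (hQ : Q.IsClosedForm) {a b : ℝ} (ha : 0 < a) (hb : 0 < b)
    (f : H) : hQ.resolvent ha f - hQ.resolvent hb f =
      (b - a) • hQ.resolvent ha (hQ.resolvent hb f) := by
  have h := (hQ.operatorRel_iff_resolvent ha).1 (hQ.operatorRel_resolvent hb f)
  have h1 : f - b • hQ.resolvent hb f + a • hQ.resolvent hb f =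
      f - (b - a) • hQ.resolvent hb f := by module
  rw [h1, map_sub, map_smul] at h
  rw [sub_eq_iff_eq_add', ← sub_eq_iff_eq_add, ← h]

lemma IsClosedForm.resolvent_comm (hQ : Q.IsClosedForm) {a b : ℝ} (ha : 0 < a) (hb : 0 < b)
    (f : H) : hQ.resolvent ha (hQ.resolvent hb f) = hQ.resolvent hb (hQ.resolvent ha f) := by
  rcases eq_or_ne a b with rfl | hab
  · rfl
  have h1 := hQ.resolvent_sub ha hb f
  have h2 := hQ.resolvent_sub hb ha f
  have h3 : (b - a) • hQ.resolvent ha (hQ.resolvent hb f) =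
      (b - a) • hQ.resolvent hb (hQ.resolvent ha f) := by
    rw [← h1, ← neg_sub a b, neg_smul, ← h2, neg_sub]
  exact smul_right_injective H (sub_ne_zero.2 hab.symm) h3

/-! ### Approximation by resolvents and lower semicontinuity -/

/-- The element `a (L + a)⁻¹ f` of the domain. -/
def IsClosedForm.approx (hQ : Q.IsClosedForm) {a : ℝ} (ha : 0 < a) (f : H) : Q.domain :=
  a • hQ.resolventDom ha f

lemma IsClosedForm.coe_approx (hQ : Q.IsClosedForm) {a : ℝ} (ha : 0 < a) (f : H) :
    (hQ.approx ha f : H) = a • hQ.resolvent ha f := rfl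

lemma IsClosedForm.bilin_approx (hQ : Q.IsClosedForm) {a : ℝ} (ha : 0 < a) (f : H)
    (g : Q.domain) : Q.bilin (hQ.approx ha f) g = a * inner ℝ (f - hQ.approx ha f) (g : H) := by
  have h := hQ.resolventDom_spec ha f g
  rw [approx, map_smul, LinearMap.smul_apply, inner_sub_left, Submodule.coe_smul,
    real_inner_smul_left, smul_eq_mul, ← h]
  ring

/-- The approximating form at `f` is the minimum of `Q(w) + a ‖f - w‖²` over `w ∈ D(Q)`. -/
lemma IsClosedForm.inner_approx_le (hQ : Q.IsClosedForm) {a : ℝ} (ha : 0 < a) (f : H)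
    (w : Q.domain) : a * inner ℝ (f - hQ.approx ha f) f ≤
      Q.bilin w w + a * ‖f - w‖ ^ 2 := by
  set v := hQ.approx ha f
  have h1 := hQ.bilin_approx ha f w
  have h2 := hQ.bilin_approx ha f v
  have h3 := Q.nonneg (w - v)
  rw [bilin_sub_sub, Q.symm w v] at h3
  have h4 : ‖f - w‖ ^ 2 = ‖f - v‖ ^ 2 - 2 * inner ℝ (f - v) (w - v : H) + ‖(w - v : H)‖ ^ 2 := by
    rw [← norm_sub_sq_real]
    congr 2
    abel
  have h5 : inner ℝ (f - v) f = ‖f - v‖ ^ 2 + inner ℝ (f - v) (v : H) := by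
    rw [← real_inner_self_eq_norm_sq, ← inner_add_right]
    congr 1
    abel
  have h6 : 0 ≤ a * ‖(w - v : H)‖ ^ 2 := by positivity
  change Q.bilin v w = a * inner ℝ (f - v) (w : H) at h1
  change Q.bilin v v = a * inner ℝ (f - v) (v : H) at h2
  rw [inner_sub_right] at h4
  rw [h4, h5]
  nlinarith

lemma IsClosedForm.inner_approx_eq (hQ : Q.IsClosedForm) {a : ℝ} (ha : 0 < a) (f : H) :
    a * inner ℝ (f - hQ.approx ha f) f =
      Q.bilin (hQ.approx ha f) (hQ.approx ha f) + a * ‖f - hQ.approx ha f‖ ^ 2 := by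
  rw [hQ.bilin_approx, ← real_inner_self_eq_norm_sq, ← mul_add, ← inner_add_right,
    add_sub_cancel]

/-- Amounts to Q(v, w - v) ≥ 0 for the approximations v, w at a < b. Subtracting the two resolvent
equations tested with w - v gives Q(w - v) = (b - a)⟨f - w, w - v⟩ - a‖w - v‖², which forces ⟨f - w,
w - v⟩ ≥ 0. The estimate yields monotonicity of the energies and the Cauchy property at once. -/
lemma IsClosedForm.bilin_approx_sub_le (hQ : Q.IsClosedForm) {a b : ℝ} (ha : 0 < a)
    (hab : a < b) (f : H) :
    Q.bilin (hQ.approx (ha.trans hab) f - hQ.approx ha f)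
      (hQ.approx (ha.trans hab) f - hQ.approx ha f) ≤
    Q.bilin (hQ.approx (ha.trans hab) f) (hQ.approx (ha.trans hab) f) -
      Q.bilin (hQ.approx ha f) (hQ.approx ha f) := by
  set v := hQ.approx ha f with hv
  set w := hQ.approx (ha.trans hab) f with hw
  have h1 : Q.bilin v (w - v) = a * inner ℝ (f - v) ((w - v : Q.domain) : H) :=
    hQ.bilin_approx ha f _
  have h2 : Q.bilin w (w - v) = b * inner ℝ (f - w) ((w - v : Q.domain) : H) :=
    hQ.bilin_approx (ha.trans hab) f _
  have h3 : inner ℝ (f - v) ((w - v : Q.domain) : H) =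
      inner ℝ (f - w) ((w - v : Q.domain) : H) + ‖((w - v : Q.domain) : H)‖ ^ 2 := by
    rw [← real_inner_self_eq_norm_sq, ← inner_add_left]
    congr 1
    simp
  have h4 := Q.nonneg (w - v)
  have h5 : Q.bilin (w - v) (w - v) = Q.bilin w (w - v) - Q.bilin v (w - v) := by
    rw [LinearMap.map_sub₂]
  have h6 : 0 ≤ ‖((w - v : Q.domain) : H)‖ ^ 2 := by positivity
  have h7 : 0 ≤ inner ℝ (f - w) ((w - v : Q.domain) : H) := by
    rw [h5, h1, h2, h3] at h4
    have : 0 ≤ (b - a) * inner ℝ (f - w) ((w - v : Q.domain) : H) := by nlinarith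
    exact nonneg_of_mul_nonneg_right this (sub_pos.2 hab)
  have h8 : 0 ≤ Q.bilin v (w - v) := by
    rw [h1, h3]
    positivity
  rw [map_sub] at h8
  rw [bilin_sub_sub, Q.symm w v]
  linarith

/-- A sequence of positive parameters tending to infinity. -/
lemma natCast_succ_pos (n : ℕ) : (0 : ℝ) < (n : ℝ) + 1 := by positivity

/-- If the approximating forms are bounded at `f`, then `f ∈ D(Q)` and the approximations
converge in the form norm. -/
lemma IsClosedForm.formTendsto_approx_of_le (hQ : Q.IsClosedForm) {f : H} {C : ℝ}
    (hC : ∀ a (ha : 0 < a), a * inner ℝ (f - hQ.approx ha f) f ≤ C) :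
    ∃ hf : f ∈ Q.domain,
      Q.FormTendsto (fun n => hQ.approx (natCast_succ_pos n) f) ⟨f, hf⟩ := by
  have hmono : Monotone fun n : ℕ => Q.bilin (hQ.approx (natCast_succ_pos n) f)
      (hQ.approx (natCast_succ_pos n) f) := by
    refine monotone_nat_of_le_succ fun n => ?_
    have h1 := hQ.bilin_approx_sub_le (natCast_succ_pos n)
      (b := ((n + 1 : ℕ) : ℝ) + 1) (by push_cast; linarith) f
    have h2 := Q.nonneg (hQ.approx (natCast_succ_pos (n + 1)) f - hQ.approx (natCast_succ_pos n) f)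
    linarith
  have hbdd : ∀ n : ℕ, Q.bilin (hQ.approx (natCast_succ_pos n) f)
      (hQ.approx (natCast_succ_pos n) f) ≤ C := fun n => by
    have h1 := hC _ (natCast_succ_pos n)
    rw [hQ.inner_approx_eq] at h1
    have : 0 ≤ ((n : ℝ) + 1) * ‖f - hQ.approx (natCast_succ_pos n) f‖ ^ 2 := by positivity
    linarith
  refine hQ.exists_formTendsto ?_ ?_
  · rw [tendsto_iff_norm_sub_tendsto_zero]
    have h1 : Tendsto (fun n : ℕ => √(C * (1 / ((n : ℝ) + 1)))) atTop (𝓝 0) := by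
      simpa using ((tendsto_one_div_add_atTop_nhds_zero_nat (𝕜 := ℝ)).const_mul C).sqrt
    refine squeeze_zero (fun n => norm_nonneg _) (fun n => Real.le_sqrt_of_sq_le ?_) h1
    have h1 := hC _ (natCast_succ_pos n)
    rw [hQ.inner_approx_eq] at h1
    have h2 := Q.nonneg (hQ.approx (natCast_succ_pos n) f)
    rw [norm_sub_rev, mul_one_div, le_div_iff₀ (natCast_succ_pos n)]
    linarith
  -- The energies increase and are bounded, hence form a Cauchy sequence, and their differences
  -- control the energies of the differences.
  · have hcau := (tendsto_atTop_ciSup hmono ⟨C, by rintro _ ⟨n, rfl⟩; exact hbdd n⟩).cauchySeq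
    intro ε hε
    obtain ⟨N, hN⟩ := Metric.cauchySeq_iff.1 hcau ε hε
    have key : ∀ n k, k < n → N ≤ k →
        Q.bilin (hQ.approx (natCast_succ_pos n) f - hQ.approx (natCast_succ_pos k) f)
          (hQ.approx (natCast_succ_pos n) f - hQ.approx (natCast_succ_pos k) f) < ε := by
      intro n k hnk hk
      have h1 := hQ.bilin_approx_sub_le (natCast_succ_pos k) (b := (n : ℝ) + 1)
        (by have : (k : ℝ) < n := by exact_mod_cast hnk
            linarith) f
      have h2 := hN n (hk.trans hnk.le) k hk
      rw [Real.dist_eq] at h2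
      exact h1.trans_lt ((le_abs_self _).trans_lt h2)
    refine ⟨N, fun n hn k hk => ?_⟩
    rcases lt_trichotomy n k with h | rfl | h
    · rw [← neg_sub, LinearMap.map_neg₂, map_neg, neg_neg]
      exact key k n h hn
    · simpa using hε
    · exact key n k h hk

lemma IsClosedForm.formTendsto_approx (hQ : Q.IsClosedForm) (f : Q.domain) :
    Q.FormTendsto (fun n => hQ.approx (natCast_succ_pos n) (f : H)) f := by
  obtain ⟨_, h⟩ := hQ.formTendsto_approx_of_le (f := (f : H)) (C := Q.bilin f f)
    fun a ha => by simpa using hQ.inner_approx_le ha (f : H) f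
  exact h

lemma IsClosedForm.continuous_inner_approx (hQ : Q.IsClosedForm) {a : ℝ} (ha : 0 < a) :
    Continuous fun f : H => a * inner ℝ (f - hQ.approx ha f) f := by
  simp only [coe_approx]
  fun_prop

/-- Lower semicontinuity of a closed form. -/
lemma IsClosedForm.mem_domain_of_tendsto (hQ : Q.IsClosedForm) {w : H} {C : ℝ}
    (hu : Tendsto (fun n => (u n : H)) atTop (𝓝 w)) (hC : ∀ n, Q.bilin (u n) (u n) ≤ C) :
    ∃ h : w ∈ Q.domain, Q.bilin ⟨w, h⟩ ⟨w, h⟩ ≤ C := by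
  -- For fixed a the approximating form is continuous on all of H and at most Q on D(Q), so the
  -- bound survives the limit.
  have hb : ∀ a (ha : 0 < a), a * inner ℝ (w - hQ.approx ha w) w ≤ C := by
    intro a ha
    refine le_of_tendsto (((hQ.continuous_inner_approx ha).tendsto w).comp hu)
      (Eventually.of_forall fun n => ?_)
    have := hQ.inner_approx_le ha (u n : H) (u n)
    simp only [sub_self, norm_zero, ne_eq, OfNat.ofNat_ne_zero, not_false_eq_true, zero_pow,
      mul_zero, add_zero] at this
    exact this.trans (hC n)
  obtain ⟨h, hw⟩ := hQ.formTendsto_approx_of_le hb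
  refine ⟨h, le_of_tendsto hw.bilin_self (Eventually.of_forall fun n => ?_)⟩
  have h1 := hb _ (natCast_succ_pos n)
  rw [hQ.inner_approx_eq] at h1
  have : 0 ≤ ((n : ℝ) + 1) * ‖w - hQ.approx (natCast_succ_pos n) w‖ ^ 2 := by positivity
  linarith

/-- Convergence in `H` together with a bound of the forms by the form of the limit implies
convergence in the form norm. -/
lemma IsClosedForm.formTendsto_of_le (hQ : Q.IsClosedForm)
    (hu : Tendsto (fun n => (u n : H)) atTop (𝓝 v)) (hle : ∀ n, Q.bilin (u n) (u n) ≤ Q.bilin v v) :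
    Q.FormTendsto u v := by
  rw [formTendsto_iff]
  refine ⟨?_, hu⟩
  -- Lower semicontinuity is applied to the midpoints (u n + v)/2, which also tend to v; the
  -- parallelogram law then turns the lower bound for them into smallness of Q(u n - v).
  have hlsc : ∀ ε > 0, ∀ᶠ n in atTop,
      Q.bilin v v - ε < Q.bilin ((1 / 2 : ℝ) • (u n + v)) ((1 / 2 : ℝ) • (u n + v)) := by
    intro ε hε
    by_contra hcon
    obtain ⟨φ, hφ, hφ'⟩ := extraction_of_frequently_atTop (not_eventually.1 hcon)
    have h1 : Tendsto (fun n => (((1 / 2 : ℝ) • (u (φ n) + v) : Q.domain) : H)) atTop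
        (𝓝 (v : H)) := by
      have := ((hu.comp hφ.tendsto_atTop).add_const (v : H)).const_smul (1 / 2 : ℝ)
      convert! this using 2
      rw [← two_smul ℝ (v : H), smul_smul]
      norm_num
    obtain ⟨h, h2⟩ := hQ.mem_domain_of_tendsto h1 fun n => not_lt.1 (hφ' n)
    have h3 : Q.bilin v v ≤ Q.bilin v v - ε := h2
    linarith
  rw [Metric.tendsto_atTop]
  intro ε hε
  obtain ⟨N, hN⟩ := eventually_atTop.1 (hlsc (ε / 4) (by positivity))
  refine ⟨N, fun n hn => ?_⟩
  have h1 := hN n hn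
  have h2 := Q.bilin_parallelogram (u n) v
  have h3 := Q.nonneg (u n - v)
  simp only [map_smul, LinearMap.smul_apply, smul_eq_mul] at h1
  rw [Real.dist_eq, sub_zero, abs_of_nonneg h3]
  have h4 := hle n
  linarith

end SymForm

namespace SymForm

variable {H : Type*} [NormedAddCommGroup H] [InnerProductSpace ℝ H]
variable {Q : SymForm H} {T : ℝ≥0 → H →L[ℝ] H}

/-! ### Properties of the semigroup of a form -/

lemma OperatorRel.nonneg {f g : H} (h : Q.OperatorRel f g) : 0 ≤ inner ℝ f g := by
  obtain ⟨hf, h⟩ := h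
  exact (Q.nonneg _).trans_eq (h ⟨f, hf⟩)

/-- The elements a(L + a)⁻¹f belong to D(L) and tend to f for f in D(Q), which is dense. -/
lemma dense_range_resolvent (hQ : Q.IsClosedForm) (hd : Q.IsDenselyDefined) :
    Dense {f : H | ∃ g, Q.OperatorRel f g} := by
  refine Dense.of_closure ?_
  refine (hd.mono fun f hf => ?_)
  refine mem_closure_of_tendsto (hQ.formTendsto_approx ⟨f, hf⟩).tendsto
    (Eventually.of_forall fun n => ?_)
  rw [hQ.coe_approx, ← map_smul]
  exact ⟨_, hQ.operatorRel_resolvent _ _⟩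

lemma IsSemigroup.operatorRel_apply (hT : Q.IsSemigroup T) {f g : H} (h : Q.OperatorRel f g)
    (t : ℝ≥0) : Q.OperatorRel (T t f) (T t g) := by
  rw [hT.generator] at h ⊢
  refine (((T t).continuous.tendsto g).comp h).congr fun s => ?_
  have : T t (T s f) = T s (T t f) := by
    rw [← ContinuousLinearMap.comp_apply, ← hT.add, add_comm, hT.add,
      ContinuousLinearMap.comp_apply]
  simp [this]

/-- The generator is defined by a limit at 0+, so only right derivatives come for free. They suffice
for the monotonicity arguments below. -/
lemma IsSemigroup.hasDerivWithinAt (hT : Q.IsSemigroup T) {f g : H} (h : Q.OperatorRel f g)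
    {t : ℝ} (ht : 0 ≤ t) :
    HasDerivWithinAt (fun s : ℝ => T s.toNNReal f) (-(T t.toNNReal g)) (Ici t) t := by
  rw [← hasDerivWithinAt_Ioi_iff_Ici, hasDerivWithinAt_iff_tendsto_slope' self_notMem_Ioi]
  have h1 := (hT.generator _ _).1 (hT.operatorRel_apply h t.toNNReal)
  have h2 : Tendsto (fun s : ℝ => (s - t).toNNReal) (𝓝[>] t) (𝓝[>] 0) := by
    refine tendsto_nhdsWithin_iff.2 ⟨?_, ?_⟩
    · have : Continuous fun s : ℝ => (s - t).toNNReal := by fun_prop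
      simpa using (this.tendsto t).mono_left nhdsWithin_le_nhds
    · filter_upwards [self_mem_nhdsWithin] with s hs
      simpa using hs
  refine ((h1.comp h2).neg).congr' ?_
  filter_upwards [self_mem_nhdsWithin] with s hs
  have hs' : t < s := hs
  have h3 : s.toNNReal = (s - t).toNNReal + t.toNNReal := by
    rw [← Real.toNNReal_add (by linarith) ht, sub_add_cancel]
  have h4 : T s.toNNReal f = T (s - t).toNNReal (T t.toNNReal f) := by
    rw [h3, hT.add, ContinuousLinearMap.comp_apply]
  simp only [Function.comp_apply, slope_def_module, h4, Real.coe_toNNReal _ (sub_nonneg.2 hs'.le)]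
  rw [← smul_neg, neg_sub]

lemma IsSemigroup.continuous_real (hT : Q.IsSemigroup T) (f : H) :
    Continuous fun s : ℝ => T s.toNNReal f :=
  (hT.continuous f).comp continuous_real_toNNReal

/-- The semigroup of a form consists of contractions. -/
lemma IsSemigroup.norm_apply_le (hQ : Q.IsClosedForm) (hd : Q.IsDenselyDefined)
    (hT : Q.IsSemigroup T) (t : ℝ≥0) (f : H) : ‖T t f‖ ≤ ‖f‖ := by
  have key : ∀ f ∈ {f : H | ∃ g, Q.OperatorRel f g}, ‖T t f‖ ≤ ‖f‖ := by
    rintro f ⟨g, hg⟩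
    -- The derivative of ‖T_s f‖² is -2⟨T_s f, L T_s f⟩, which is nonpositive.
    have h1 : ∀ x ∈ Ico (0 : ℝ) t, HasDerivWithinAt (fun s : ℝ => ‖T s.toNNReal f‖ ^ 2)
        (2 * inner ℝ (T x.toNNReal f) (-(T x.toNNReal g))) (Ici x) x := fun x hx =>
      (hT.hasDerivWithinAt hg hx.1).norm_sq
    have h2 : ‖T (t : ℝ).toNNReal f‖ ^ 2 ≤ ‖f‖ ^ 2 := image_le_of_deriv_right_le_deriv_boundary
      ((hT.continuous_real f).norm.pow 2).continuousOn h1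
      (B := fun _ => ‖f‖ ^ 2) (B' := fun _ => 0) (by simp [hT.zero]) continuousOn_const
      (fun x _ => hasDerivWithinAt_const _ _ _)
      (fun x hx => by
        have := (hT.operatorRel_apply hg x.toNNReal).nonneg
        rw [inner_neg_right]
        linarith) (right_mem_Icc.2 t.2)
    rw [Real.toNNReal_coe] at h2
    exact le_of_sq_le_sq h2 (norm_nonneg _)
  have hclosed : IsClosed {f : H | ‖T t f‖ ≤ ‖f‖} := isClosed_le (by fun_prop) (by fun_prop)
  exact hclosed.closure_subset_iff.2 key (dense_range_resolvent hQ hd f)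

/-- An inequality between semigroups implies the inequality between the resolvents. -/
lemma IsSemigroup.inner_resolvent_le {Q' : SymForm H} {T' : ℝ≥0 → H →L[ℝ] H}
    (hQ : Q.IsClosedForm) (hd : Q.IsDenselyDefined) (hT : Q.IsSemigroup T)
    (hQ' : Q'.IsClosedForm) (hd' : Q'.IsDenselyDefined) (hT' : Q'.IsSemigroup T')
    {f g : H} (h : ∀ t, inner ℝ (T t f) g ≤ inner ℝ (T' t f) g) {a : ℝ} (ha : 0 < a) :
    inner ℝ (hQ.resolvent ha f) g ≤ inner ℝ (hQ'.resolvent ha f) g := by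
  -- This function is the tail, from s to ∞, of the Laplace transform of ⟨T f, g⟩ at a. Working with
  -- its derivative avoids vector-valued integrals.
  have hderiv : ∀ {Q : SymForm H} {T : ℝ≥0 → H →L[ℝ] H} (hQ : Q.IsClosedForm)
      (_ : Q.IsSemigroup T) (x : ℝ), 0 ≤ x →
      HasDerivWithinAt (fun s : ℝ => Real.exp (-a * s) *
        inner ℝ (T s.toNNReal (hQ.resolvent ha f)) g)
        (-(Real.exp (-a * x) * inner ℝ (T x.toNNReal f) g)) (Ici x) x := by
    intro Q T hQ hT x hx
    have h1 := (hT.hasDerivWithinAt (hQ.operatorRel_resolvent ha f) hx).inner ℝ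
      (hasDerivWithinAt_const x (Ici x) g)
    have h2 : HasDerivWithinAt (fun s : ℝ => Real.exp (-a * s)) (Real.exp (-a * x) * (-a * 1))
        (Ici x) x := ((hasDerivAt_id x).const_mul (-a)).exp.hasDerivWithinAt
    convert! h2.mul h1 using 1
    simp only [map_sub, map_smul, inner_neg_left, inner_sub_left, real_inner_smul_left,
      inner_zero_right]
    ring
  have hlim : ∀ {Q : SymForm H} {T : ℝ≥0 → H →L[ℝ] H} (hQ : Q.IsClosedForm)
      (_ : Q.IsDenselyDefined) (_ : Q.IsSemigroup T),
      Tendsto (fun s : ℝ => Real.exp (-a * s) *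
        inner ℝ (T s.toNNReal (hQ.resolvent ha f)) g) atTop (𝓝 0) := by
    intro Q T hQ hd hT
    have h0 : Tendsto (fun s : ℝ => Real.exp (-a * s) * (‖hQ.resolvent ha f‖ * ‖g‖)) atTop
        (𝓝 0) := by
      rw [← zero_mul (‖hQ.resolvent ha f‖ * ‖g‖)]
      refine Tendsto.mul_const _ (Real.tendsto_exp_atBot.comp ?_)
      exact tendsto_id.const_mul_atTop_of_neg (neg_lt_zero.2 ha)
    refine squeeze_zero_norm (fun s => ?_) h0
    rw [norm_mul, Real.norm_eq_abs, abs_of_pos (Real.exp_pos _)]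
    gcongr
    refine (norm_inner_le_norm _ _).trans ?_
    gcongr
    exact hT.norm_apply_le hQ hd _ _
  have hcont : ∀ {Q : SymForm H} {T : ℝ≥0 → H →L[ℝ] H} (hQ : Q.IsClosedForm)
      (_ : Q.IsSemigroup T), Continuous (fun s : ℝ => Real.exp (-a * s) *
        inner ℝ (T s.toNNReal (hQ.resolvent ha f)) g) := by
    intro Q T hQ hT
    have := hT.continuous_real (hQ.resolvent ha f)
    exact (by fun_prop : Continuous fun s : ℝ => Real.exp (-a * s)).mul
      (this.inner continuous_const)
  -- The difference of the two tails decreases, by the assumed inequality, to the limit 0; its value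
  -- at 0 is the difference of the resolvents and is therefore nonnegative.
  set ψ : ℝ → ℝ := fun s => Real.exp (-a * s) * inner ℝ (T' s.toNNReal (hQ'.resolvent ha f)) g -
    Real.exp (-a * s) * inner ℝ (T s.toNNReal (hQ.resolvent ha f)) g with hψ
  have hmono : ∀ t, 0 ≤ t → ψ t ≤ ψ 0 := fun t ht =>
    image_le_of_deriv_right_le_deriv_boundary (f := ψ) (b := t)
      ((hcont hQ' hT').sub (hcont hQ hT)).continuousOn
      (fun x hx => (hderiv hQ' hT' x hx.1).sub (hderiv hQ hT x hx.1))
      (B := fun _ => ψ 0) (B' := fun _ => 0) le_rfl continuousOn_const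
      (fun x _ => hasDerivWithinAt_const _ _ _)
      (fun x hx => by
        have := mul_le_mul_of_nonneg_left (h x.toNNReal) (Real.exp_pos (-a * x)).le
        linarith) (right_mem_Icc.2 ht)
  have hψlim : Tendsto ψ atTop (𝓝 0) := by
    rw [← sub_zero (0 : ℝ)]
    exact (hlim hQ' hd' hT').sub (hlim hQ hd hT)
  have h0 : 0 ≤ ψ 0 := le_of_tendsto hψlim <| by
    filter_upwards [eventually_ge_atTop 0] with t ht using hmono t ht
  simpa [hψ, hT.zero, hT'.zero] using h0

/-! ### Exponentials of bounded operators -/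

section Exponential

variable {A : Type*} [NormedRing A] [NormedAlgebra ℝ A]

/-- The inequality ‖1‖ ≤ 1 is assumed instead of equality so that operators on the zero space are
covered. -/
lemma norm_normedSpace_exp_le (h1 : ‖(1 : A)‖ ≤ 1) (x : A) :
    ‖NormedSpace.exp x‖ ≤ Real.exp ‖x‖ := by
  rw [Real.exp_eq_exp_ℝ, NormedSpace.exp_eq_tsum ℝ, NormedSpace.exp_eq_tsum ℝ]
  refine tsum_of_norm_bounded (NormedSpace.expSeries_summable' (𝕂 := ℝ) ‖x‖).hasSum fun n => ?_
  rw [norm_smul, smul_eq_mul, Real.norm_eq_abs, abs_of_nonneg (by positivity)]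
  gcongr
  rcases n.eq_zero_or_pos with rfl | hn
  · simpa using h1
  · exact norm_pow_le' x hn

end Exponential

variable [CompleteSpace H]

lemma hasDerivAt_exp_add_smul {x y : H →L[ℝ] H} (hxy : Commute x y) (f : H) (s : ℝ) :
    HasDerivAt (fun s : ℝ => NormedSpace.exp (x + s • y) f)
      (NormedSpace.exp (x + s • y) (y f)) s := by
  let _ : NormedAlgebra ℚ (H →L[ℝ] H) := .restrictScalars ℚ ℝ _
  have h1 := (hasDerivAt_exp_smul_const (𝕂 := ℝ) y s).const_mul (NormedSpace.exp x)
  have h2 : ∀ s : ℝ, NormedSpace.exp x * NormedSpace.exp (s • y) = NormedSpace.exp (x + s • y) :=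
    fun s => (NormedSpace.exp_add_of_commute (hxy.smul_right s)).symm
  rw [← mul_assoc, h2] at h1
  simp only [h2] at h1
  exact (h1.clm_apply (hasDerivAt_const s f)).congr_deriv (by simp)

/-- Mean value inequality along s ↦ exp(x + s y) f, whose derivative is the contraction exp(x + s y)
applied to y f. -/
lemma norm_exp_add_sub_exp_le {x y : H →L[ℝ] H} (hxy : Commute x y)
    (h : ∀ s ∈ Icc (0 : ℝ) 1, ‖NormedSpace.exp (x + s • y)‖ ≤ 1) (f : H) :
    ‖NormedSpace.exp (x + y) f - NormedSpace.exp x f‖ ≤ ‖y f‖ := by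
  have := norm_image_sub_le_of_norm_deriv_le_segment_01' (C := ‖y f‖)
    (fun s _ => (hasDerivAt_exp_add_smul hxy f s).hasDerivWithinAt) fun s hs => by
      refine (ContinuousLinearMap.le_opNorm _ _).trans ?_
      exact mul_le_of_le_one_left (norm_nonneg _) (h s ⟨hs.1, hs.2.le⟩)
  simpa using this

/-- The same argument for s ↦ exp(s y) f - s y f; this controls the second-order error needed for
the generator. -/
lemma norm_exp_sub_sub_le {y : H →L[ℝ] H} {f : H} {C : ℝ}
    (h : ∀ s ∈ Icc (0 : ℝ) 1, ‖NormedSpace.exp (s • y) (y f) - y f‖ ≤ C) :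
    ‖NormedSpace.exp y f - f - y f‖ ≤ C := by
  have := norm_image_sub_le_of_norm_deriv_le_segment_01' (C := C)
    (f := fun s : ℝ => NormedSpace.exp (0 + s • y) f - s • y f)
    (fun s _ => ((hasDerivAt_exp_add_smul (Commute.zero_left y) f s).sub
      ((hasDerivAt_id s).smul_const (y f))).hasDerivWithinAt) fun s hs => by
      simpa using h s ⟨hs.1, hs.2.le⟩
  simp only [one_smul, zero_add, zero_smul, NormedSpace.exp_zero] at this
  convert! this using 2
  simp
  abel

end SymForm

namespace SymForm

variable {H : Type*} [NormedAddCommGroup H] [InnerProductSpace ℝ H]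
variable {Q : SymForm H}

/-! ### Existence of the semigroup of a closed form -/

/-- The contraction `a (L + a)⁻¹` for `a = n + 1`. -/
def IsClosedForm.approxOp (hQ : Q.IsClosedForm) (n : ℕ) : H →L[ℝ] H :=
  ((n : ℝ) + 1) • hQ.resolvent (natCast_succ_pos n)

/-- The Yosida approximation `-a L (L + a)⁻¹` of `-L`, for `a = n + 1`. -/
def IsClosedForm.yosida (hQ : Q.IsClosedForm) (n : ℕ) : H →L[ℝ] H :=
  ((n : ℝ) + 1) • (hQ.approxOp n - 1)

lemma IsClosedForm.norm_approxOp_le (hQ : Q.IsClosedForm) (n : ℕ) : ‖hQ.approxOp n‖ ≤ 1 := by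
  rw [approxOp, norm_smul, Real.norm_eq_abs, abs_of_pos (natCast_succ_pos n)]
  have := hQ.norm_resolvent_le (natCast_succ_pos n)
  have h := natCast_succ_pos n
  calc ((n : ℝ) + 1) * ‖hQ.resolvent (natCast_succ_pos n)‖ ≤ ((n : ℝ) + 1) * ((n : ℝ) + 1)⁻¹ := by
        gcongr
    _ = 1 := mul_inv_cancel₀ h.ne'

lemma IsClosedForm.norm_approxOp_apply_le (hQ : Q.IsClosedForm) (n : ℕ) (f : H) :
    ‖hQ.approxOp n f‖ ≤ ‖f‖ :=
  ((hQ.approxOp n).le_opNorm f).trans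
    (mul_le_of_le_one_left (norm_nonneg _) (hQ.norm_approxOp_le n))

lemma IsClosedForm.tendsto_approxOp (hQ : Q.IsClosedForm) (hd : Q.IsDenselyDefined) (f : H) :
    Tendsto (fun n => hQ.approxOp n f) atTop (𝓝 f) := by
  rw [Metric.tendsto_atTop]
  intro ε hε
  obtain ⟨g, hg, hfg⟩ := Metric.mem_closure_iff.1 (hd f) (ε / 3) (by positivity)
  obtain ⟨N, hN⟩ := Metric.tendsto_atTop.1 (hQ.formTendsto_approx ⟨g, hg⟩).tendsto (ε / 3)
    (by positivity)
  refine ⟨N, fun n hn => ?_⟩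
  have h1 : dist (hQ.approxOp n g) g < ε / 3 := hN n hn
  have h2 : dist (hQ.approxOp n f) (hQ.approxOp n g) ≤ dist f g := by
    rw [dist_eq_norm, dist_eq_norm, ← map_sub]
    exact hQ.norm_approxOp_apply_le n _
  have h3 := dist_triangle4 (hQ.approxOp n f) (hQ.approxOp n g) g f
  rw [dist_comm g f] at h3
  linarith

lemma IsClosedForm.commute_approxOp (hQ : Q.IsClosedForm) (n k : ℕ) :
    Commute (hQ.approxOp n) (hQ.approxOp k) := by
  have : Commute (hQ.resolvent (natCast_succ_pos n)) (hQ.resolvent (natCast_succ_pos k)) :=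
    ContinuousLinearMap.ext fun f => hQ.resolvent_comm _ _ f
  exact (this.smul_left _).smul_right _

lemma IsClosedForm.commute_yosida (hQ : Q.IsClosedForm) (n k : ℕ) :
    Commute (hQ.yosida n) (hQ.yosida k) :=
  ((((hQ.commute_approxOp n k).sub_left (Commute.one_left _)).sub_right
    (Commute.one_right _)).smul_left _).smul_right _

lemma IsClosedForm.yosida_apply (hQ : Q.IsClosedForm) (n : ℕ) {f g : H}
    (h : Q.OperatorRel f g) : hQ.yosida n f = -hQ.approxOp n g := by
  have h1 := (hQ.operatorRel_iff_resolvent (natCast_succ_pos n)).1 h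
  rw [map_add, map_smul] at h1
  have h2 : ((n : ℝ) + 1) • hQ.resolvent (natCast_succ_pos n) f - f =
      -hQ.resolvent (natCast_succ_pos n) g := by
    nth_rewrite 2 [h1]
    abel
  change ((n : ℝ) + 1) • (((n : ℝ) + 1) • hQ.resolvent (natCast_succ_pos n) f - f) =
    -(((n : ℝ) + 1) • hQ.resolvent (natCast_succ_pos n) g)
  rw [h2, smul_neg]

lemma exp_real_smul_one (c : ℝ) :
    NormedSpace.exp (c • (1 : H →L[ℝ] H)) = Real.exp c • (1 : H →L[ℝ] H) := by
  have := NormedSpace.algebraMap_exp_comm (𝕂 := ℝ) (𝔸 := H →L[ℝ] H) c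
  rw [Algebra.algebraMap_eq_smul_one, Algebra.algebraMap_eq_smul_one, ← Real.exp_eq_exp_ℝ] at this
  exact this.symm

variable [CompleteSpace H]

/-- The semigroup of the Yosida approximation. -/
def IsClosedForm.yosidaExp (hQ : Q.IsClosedForm) (n : ℕ) (t : ℝ) : H →L[ℝ] H :=
  NormedSpace.exp (t • hQ.yosida n)

/-- Splitting off the scalar part of the exponent leaves the exponential of a multiple of a(L +
a)⁻¹. For t ≥ 0 this gives contractivity, and later the comparison of semigroups, since a(L + a)⁻¹
preserves positivity. -/
lemma IsClosedForm.yosidaExp_eq (hQ : Q.IsClosedForm) (n : ℕ) (t : ℝ) :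
    hQ.yosidaExp n t = Real.exp (-(t * ((n : ℝ) + 1))) •
      NormedSpace.exp ((t * ((n : ℝ) + 1)) • hQ.approxOp n) := by
  let _ : NormedAlgebra ℚ (H →L[ℝ] H) := .restrictScalars ℚ ℝ _
  have h1 : t • hQ.yosida n = (t * ((n : ℝ) + 1)) • hQ.approxOp n +
      (-(t * ((n : ℝ) + 1))) • (1 : H →L[ℝ] H) := by
    rw [yosida]
    module
  rw [yosidaExp, h1, NormedSpace.exp_add_of_commute ((Commute.one_right _).smul_right _),
    exp_real_smul_one, mul_smul_one]

lemma IsClosedForm.norm_yosidaExp_le (hQ : Q.IsClosedForm) (n : ℕ) {t : ℝ} (ht : 0 ≤ t) :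
    ‖hQ.yosidaExp n t‖ ≤ 1 := by
  have h0 : 0 ≤ t * ((n : ℝ) + 1) := by positivity
  rw [yosidaExp_eq, norm_smul, Real.norm_eq_abs, abs_of_pos (Real.exp_pos _)]
  have h1 := norm_normedSpace_exp_le (ContinuousLinearMap.norm_id_le (𝕜 := ℝ) (E := H))
    ((t * ((n : ℝ) + 1)) • hQ.approxOp n)
  have h2 : ‖(t * ((n : ℝ) + 1)) • hQ.approxOp n‖ ≤ t * ((n : ℝ) + 1) := by
    rw [norm_smul, Real.norm_eq_abs, abs_of_nonneg h0]
    exact mul_le_of_le_one_right h0 (hQ.norm_approxOp_le n)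
  calc _ ≤ Real.exp (-(t * ((n : ℝ) + 1))) * Real.exp (t * ((n : ℝ) + 1)) := by
        gcongr
        exact h1.trans (Real.exp_le_exp.2 h2)
    _ = 1 := by rw [← Real.exp_add, neg_add_cancel, Real.exp_zero]

lemma IsClosedForm.norm_yosidaExp_apply_le (hQ : Q.IsClosedForm) (n : ℕ) {t : ℝ} (ht : 0 ≤ t)
    (f : H) : ‖hQ.yosidaExp n t f‖ ≤ ‖f‖ :=
  ((hQ.yosidaExp n t).le_opNorm f).trans
    (mul_le_of_le_one_left (norm_nonneg _) (hQ.norm_yosidaExp_le n ht))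

lemma IsClosedForm.yosidaExp_add (hQ : Q.IsClosedForm) (n : ℕ) (s t : ℝ) :
    hQ.yosidaExp n (s + t) = hQ.yosidaExp n s * hQ.yosidaExp n t := by
  let _ : NormedAlgebra ℚ (H →L[ℝ] H) := .restrictScalars ℚ ℝ _
  rw [yosidaExp, add_smul, NormedSpace.exp_add_of_commute]
  · rfl
  · exact ((Commute.refl _).smul_left _).smul_right _

lemma IsClosedForm.norm_yosidaExp_sub_le (hQ : Q.IsClosedForm) (n k : ℕ) {t : ℝ} (ht : 0 ≤ t)
    (f : H) : ‖hQ.yosidaExp k t f - hQ.yosidaExp n t f‖ ≤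
      t * ‖hQ.yosida k f - hQ.yosida n f‖ := by
  let _ : NormedAlgebra ℚ (H →L[ℝ] H) := .restrictScalars ℚ ℝ _
  have hcomm : Commute (t • hQ.yosida n) (t • (hQ.yosida k - hQ.yosida n)) :=
    (((hQ.commute_yosida n k).sub_right (Commute.refl _)).smul_left _).smul_right _
  have h := norm_exp_add_sub_exp_le hcomm (fun s hs => ?_) f
  · have h1 : t • hQ.yosida n + t • (hQ.yosida k - hQ.yosida n) = t • hQ.yosida k := by module
    rw [h1] at h
    refine h.trans_eq ?_
    simp [norm_smul, abs_of_nonneg ht]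
  -- The interpolated exponent is a convex combination of commuting ones, so its exponential is a
  -- product of two contractions.
  · have h1 : t • hQ.yosida n + s • t • (hQ.yosida k - hQ.yosida n) =
        ((1 - s) * t) • hQ.yosida n + (s * t) • hQ.yosida k := by module
    rw [h1, NormedSpace.exp_add_of_commute
      (((hQ.commute_yosida n k).smul_left _).smul_right _)]
    have h2 := hQ.norm_yosidaExp_le n (mul_nonneg (sub_nonneg.2 hs.2) ht)
    have h3 := hQ.norm_yosidaExp_le k (mul_nonneg hs.1 ht)
    exact (norm_mul_le _ _).trans (mul_le_one₀ h2 (norm_nonneg _) h3)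

lemma IsClosedForm.norm_yosidaExp_sub_self_le (hQ : Q.IsClosedForm) (n : ℕ) {t : ℝ}
    (ht : 0 ≤ t) {f g : H} (h : Q.OperatorRel f g) : ‖hQ.yosidaExp n t f - f‖ ≤ t * ‖g‖ := by
  have h1 := norm_exp_add_sub_exp_le (Commute.zero_left (t • hQ.yosida n)) (fun s hs => by
    rw [zero_add, smul_smul]
    exact hQ.norm_yosidaExp_le n (mul_nonneg hs.1 ht)) f
  rw [zero_add, NormedSpace.exp_zero] at h1
  refine h1.trans ?_
  rw [smul_apply, hQ.yosida_apply n h, norm_smul, norm_neg,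
    Real.norm_eq_abs, abs_of_nonneg ht]
  gcongr
  exact hQ.norm_approxOp_apply_le n g

/-- On D(L) the Yosida approximations converge to -L, and exponentials differ by at most t times the
difference of the exponents. Contractivity and density of D(L) do the rest. -/
lemma IsClosedForm.cauchySeq_yosidaExp (hQ : Q.IsClosedForm) (hd : Q.IsDenselyDefined) {t : ℝ}
    (ht : 0 ≤ t) (f : H) : CauchySeq fun n => hQ.yosidaExp n t f := by
  rw [Metric.cauchySeq_iff]
  intro ε hε
  obtain ⟨f', ⟨g, hg⟩, hff'⟩ := Metric.mem_closure_iff.1 (dense_range_resolvent hQ hd f) (ε / 3)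
    (by positivity)
  obtain ⟨N, hN⟩ := Metric.cauchySeq_iff.1 (hQ.tendsto_approxOp hd g).cauchySeq
    (ε / (3 * (t + 1))) (by positivity)
  refine ⟨N, fun n hn k hk => ?_⟩
  have h1 : ∀ n, dist (hQ.yosidaExp n t f) (hQ.yosidaExp n t f') ≤ dist f f' := fun n => by
    rw [dist_eq_norm, dist_eq_norm, ← map_sub]
    exact hQ.norm_yosidaExp_apply_le n ht _
  have h2 := hQ.norm_yosidaExp_sub_le k n ht f'
  have h3 : ‖hQ.yosida n f' - hQ.yosida k f'‖ < ε / (3 * (t + 1)) := by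
    rw [hQ.yosida_apply n hg, hQ.yosida_apply k hg, neg_sub_neg, norm_sub_rev, ← dist_eq_norm]
    exact hN n hn k hk
  have h4 : t * ‖hQ.yosida n f' - hQ.yosida k f'‖ ≤ ε / 3 := by
    calc _ ≤ (t + 1) * (ε / (3 * (t + 1))) := by gcongr; linarith
      _ = ε / 3 := by field_simp
  rw [← dist_eq_norm] at h2
  have h5 := dist_triangle4 (hQ.yosidaExp n t f) (hQ.yosidaExp n t f') (hQ.yosidaExp k t f')
    (hQ.yosidaExp k t f)
  have h6 := h1 n
  have h7 := h1 k
  rw [dist_comm] at h7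
  linarith

lemma IsClosedForm.exists_tendsto_yosidaExp (hQ : Q.IsClosedForm) (hd : Q.IsDenselyDefined)
    {t : ℝ} (ht : 0 ≤ t) : ∃ S : H →L[ℝ] H,
      ∀ f, Tendsto (fun n => hQ.yosidaExp n t f) atTop (𝓝 (S f)) := by
  choose S hS using fun f => cauchySeq_tendsto_of_complete (hQ.cauchySeq_yosidaExp hd ht f)
  refine ⟨continuousLinearMapOfTendsto (fun n => hQ.yosidaExp n t) (tendsto_pi_nhds.2 hS), hS⟩

/-- The semigroup `e^{-tL}` of a closed densely defined form. -/
def IsClosedForm.semigroup (hQ : Q.IsClosedForm) (hd : Q.IsDenselyDefined) (t : ℝ≥0) :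
    H →L[ℝ] H :=
  (hQ.exists_tendsto_yosidaExp hd t.2).choose

lemma IsClosedForm.tendsto_yosidaExp (hQ : Q.IsClosedForm) (hd : Q.IsDenselyDefined) (t : ℝ≥0)
    (f : H) : Tendsto (fun n => hQ.yosidaExp n t f) atTop (𝓝 (hQ.semigroup hd t f)) :=
  (hQ.exists_tendsto_yosidaExp hd t.2).choose_spec f

lemma IsClosedForm.norm_semigroup_apply_le (hQ : Q.IsClosedForm) (hd : Q.IsDenselyDefined)
    (t : ℝ≥0) (f : H) : ‖hQ.semigroup hd t f‖ ≤ ‖f‖ :=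
  le_of_tendsto (hQ.tendsto_yosidaExp hd t f).norm
    (Eventually.of_forall fun n => hQ.norm_yosidaExp_apply_le n t.2 f)

lemma IsClosedForm.semigroup_add (hQ : Q.IsClosedForm) (hd : Q.IsDenselyDefined) (s t : ℝ≥0) :
    hQ.semigroup hd (s + t) = (hQ.semigroup hd s).comp (hQ.semigroup hd t) := by
  ext f
  refine tendsto_nhds_unique (hQ.tendsto_yosidaExp hd (s + t) f) ?_
  rw [ContinuousLinearMap.comp_apply]
  have h1 := hQ.tendsto_yosidaExp hd s (hQ.semigroup hd t f)
  have h2 : Tendsto (fun n => hQ.yosidaExp n s (hQ.yosidaExp n t f - hQ.semigroup hd t f)) atTop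
      (𝓝 0) := by
    have h3 := tendsto_iff_norm_sub_tendsto_zero.1 (hQ.tendsto_yosidaExp hd t f)
    exact squeeze_zero_norm (fun n => hQ.norm_yosidaExp_apply_le n s.2 _) h3
  have h4 := h1.add h2
  rw [add_zero] at h4
  refine h4.congr fun n => ?_
  rw [← map_add, add_sub_cancel, NNReal.coe_add, yosidaExp_add]
  rfl

lemma IsClosedForm.semigroup_zero (hQ : Q.IsClosedForm) (hd : Q.IsDenselyDefined) :
    hQ.semigroup hd 0 = ContinuousLinearMap.id ℝ H := by
  ext f
  refine tendsto_nhds_unique (hQ.tendsto_yosidaExp hd 0 f) ?_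
  simp [yosidaExp, NormedSpace.exp_zero]

lemma IsClosedForm.norm_semigroup_sub_le (hQ : Q.IsClosedForm) (hd : Q.IsDenselyDefined)
    {f g : H} (h : Q.OperatorRel f g) (t : ℝ≥0) : ‖hQ.semigroup hd t f - f‖ ≤ t * ‖g‖ :=
  le_of_tendsto ((hQ.tendsto_yosidaExp hd t f).sub_const f).norm
    (Eventually.of_forall fun n => hQ.norm_yosidaExp_sub_self_le n t.2 h)

/-- Orbits starting in D(L) are Lipschitz, and every orbit is a uniform limit of such orbits. -/
lemma IsClosedForm.continuous_semigroup (hQ : Q.IsClosedForm) (hd : Q.IsDenselyDefined) (f : H) :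
    Continuous fun t => hQ.semigroup hd t f := by
  have h1 : ∀ f g, Q.OperatorRel f g → Continuous fun t => hQ.semigroup hd t f := by
    intro f g hg
    have hle : ∀ s t : ℝ≥0, s ≤ t →
        dist (hQ.semigroup hd t f) (hQ.semigroup hd s f) ≤ ‖g‖₊ * dist t s := by
      intro s t hst
      obtain ⟨r, rfl⟩ := exists_add_of_le hst
      rw [dist_eq_norm, hQ.semigroup_add, ContinuousLinearMap.comp_apply, ← map_sub]
      refine (hQ.norm_semigroup_apply_le hd _ _).trans
        ((hQ.norm_semigroup_sub_le hd hg r).trans_eq ?_)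
      rw [NNReal.dist_eq, NNReal.coe_add, add_sub_cancel_left, NNReal.abs_eq, mul_comm]
      rfl
    refine (LipschitzWith.of_dist_le_mul (K := ‖g‖₊) fun s t => ?_).continuous
    rcases le_total s t with hst | hst
    · rw [dist_comm, dist_comm s t]
      exact hle s t hst
    · exact hle t s hst
  refine continuous_of_uniform_approx_of_continuous fun u hu => ?_
  obtain ⟨ε, hε, hu⟩ := Metric.mem_uniformity_dist.1 hu
  obtain ⟨f', ⟨g, hg⟩, hff'⟩ := Metric.mem_closure_iff.1 (dense_range_resolvent hQ hd f) ε hε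
  refine ⟨_, h1 f' g hg, fun t => hu ?_⟩
  rw [dist_eq_norm, ← map_sub]
  refine (hQ.norm_semigroup_apply_le hd t _).trans_lt ?_
  rwa [← dist_eq_norm]

/-- A quantitative derivative at 0. Since g = Lf need not lie in D(L), it is compared with some g'
that does; the error after division by t is 2‖g - g'‖ up to a term of order t. -/
lemma IsClosedForm.norm_semigroup_sub_sub_le (hQ : Q.IsClosedForm) (hd : Q.IsDenselyDefined)
    {f g g' k : H} (h : Q.OperatorRel f g) (h' : Q.OperatorRel g' k) (t : ℝ≥0) :
    ‖f - hQ.semigroup hd t f - (t : ℝ) • g‖ ≤ t * (2 * ‖g - g'‖ + t * ‖k‖) := by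
  have hn : ∀ n, ‖hQ.yosidaExp n t f - f - (t : ℝ) • hQ.yosida n f‖ ≤
      t * (2 * ‖hQ.approxOp n g - g'‖ + t * ‖k‖) := by
    intro n
    refine norm_exp_sub_sub_le fun s hs => ?_
    have hst : 0 ≤ s * (t : ℝ) := mul_nonneg hs.1 t.2
    have h1 : ‖hQ.yosidaExp n (s * t) (hQ.yosida n f) - hQ.yosida n f‖ ≤
        2 * ‖hQ.approxOp n g - g'‖ + t * ‖k‖ := by
      rw [hQ.yosida_apply n h, map_neg, neg_sub_neg, norm_sub_rev]
      have h2 : hQ.yosidaExp n (s * t) (hQ.approxOp n g) - hQ.approxOp n g =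
          hQ.yosidaExp n (s * t) (hQ.approxOp n g - g') - (hQ.approxOp n g - g') +
            (hQ.yosidaExp n (s * t) g' - g') := by
        rw [map_sub]
        abel
      have h3 := hQ.norm_yosidaExp_apply_le n hst (hQ.approxOp n g - g')
      have h4 := hQ.norm_yosidaExp_sub_self_le n hst h'
      have h5 : s * t * ‖k‖ ≤ t * ‖k‖ := by
        gcongr
        exact mul_le_of_le_one_left t.2 hs.2
      rw [h2]
      refine (norm_add_le _ _).trans ?_
      have h6 := norm_sub_le (hQ.yosidaExp n (s * t) (hQ.approxOp n g - g'))
        (hQ.approxOp n g - g')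
      linarith
    rw [smul_smul, smul_apply, map_smul, ← smul_sub, norm_smul,
      Real.norm_eq_abs, NNReal.abs_eq]
    exact mul_le_mul_of_nonneg_left h1 t.2
  have hA := hQ.tendsto_approxOp hd g
  have hlim : Tendsto (fun n => hQ.yosidaExp n t f - f - (t : ℝ) • hQ.yosida n f) atTop
      (𝓝 (hQ.semigroup hd t f - f - (t : ℝ) • (-g))) := by
    refine ((hQ.tendsto_yosidaExp hd t f).sub_const f).sub (Tendsto.const_smul ?_ _)
    simpa only [hQ.yosida_apply _ h] using hA.neg
  have hlim' : Tendsto (fun n => (t : ℝ) * (2 * ‖hQ.approxOp n g - g'‖ + t * ‖k‖)) atTop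
      (𝓝 (t * (2 * ‖g - g'‖ + t * ‖k‖))) :=
    (((hA.sub_const g').norm.const_mul 2).add_const _).const_mul _
  have := le_of_tendsto_of_tendsto' hlim.norm hlim' hn
  rw [← norm_neg]
  convert! this using 2
  rw [smul_neg]
  abel

/-- A closed densely defined form has a semigroup. -/
theorem IsClosedForm.isSemigroup (hQ : Q.IsClosedForm) (hd : Q.IsDenselyDefined) :
    Q.IsSemigroup (hQ.semigroup hd) := by
  have hgen : ∀ f h, Q.OperatorRel f h →
      Tendsto (fun t : ℝ≥0 => (t : ℝ)⁻¹ • (f - hQ.semigroup hd t f)) (𝓝[>] 0) (𝓝 h) := by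
    intro f g hg
    rw [Metric.tendsto_nhds]
    intro ε hε
    obtain ⟨g', ⟨k, hk⟩, hgg'⟩ := Metric.mem_closure_iff.1 (dense_range_resolvent hQ hd g) (ε / 4)
      (by positivity)
    have hev : ∀ᶠ t : ℝ≥0 in 𝓝[>] 0, (t : ℝ) * ‖k‖ < ε / 2 := by
      have hc : Continuous fun t : ℝ≥0 => (t : ℝ) * ‖k‖ := by fun_prop
      have := hc.tendsto 0
      rw [NNReal.coe_zero, zero_mul] at this
      exact (this.mono_left nhdsWithin_le_nhds).eventually_lt_const (by positivity)
    filter_upwards [hev, self_mem_nhdsWithin] with t ht ht0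
    have ht0' : (0 : ℝ) < t := ht0
    have h1 := hQ.norm_semigroup_sub_sub_le hd hg hk t
    have h2 : (t : ℝ)⁻¹ • (f - hQ.semigroup hd t f) - g =
        (t : ℝ)⁻¹ • (f - hQ.semigroup hd t f - (t : ℝ) • g) := by
      rw [smul_sub _ _ ((t : ℝ) • g), smul_smul, inv_mul_cancel₀ ht0'.ne', one_smul]
    rw [dist_eq_norm, h2, norm_smul, norm_inv, Real.norm_eq_abs, abs_of_pos ht0',
      inv_mul_lt_iff₀ ht0']
    refine h1.trans_lt (mul_lt_mul_of_pos_left ?_ ht0')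
    rw [dist_eq_norm] at hgg'
    linarith
  refine ⟨hQ.semigroup_zero hd, hQ.semigroup_add hd, hQ.continuous_semigroup hd,
    fun f h => ⟨hgen f h, fun hf => ?_⟩⟩
  -- Maximality of L: if the generator limit exists at f, solve (L + 1)f' = f + h. On f - f' the
  -- difference quotients then tend to -(f - f'), while contractivity makes their inner products
  -- with f - f' nonnegative. Hence f = f'.
  set f' := hQ.resolvent one_pos (f + h) with hf'
  have hrel : Q.OperatorRel f' (f + h - f') := by
    have := hQ.operatorRel_resolvent one_pos (f + h)
    rwa [one_smul] at this
  have hlim : Tendsto (fun t : ℝ≥0 => (t : ℝ)⁻¹ • ((f - f') - hQ.semigroup hd t (f - f')))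
      (𝓝[>] 0) (𝓝 (-(f - f'))) := by
    have := hf.sub (hgen _ _ hrel)
    rw [show h - (f + h - f') = -(f - f') by abel] at this
    refine this.congr fun t => ?_
    rw [← smul_sub, map_sub]
    congr 1
    abel
  have hpos : 0 ≤ inner ℝ (-(f - f')) (f - f') := by
    refine ge_of_tendsto (hlim.inner tendsto_const_nhds) (Eventually.of_forall fun t => ?_)
    rw [real_inner_smul_left, inner_sub_left, real_inner_self_eq_norm_sq]
    have h1 := real_inner_le_norm (hQ.semigroup hd t (f - f')) (f - f')
    have h2 := hQ.norm_semigroup_apply_le hd t (f - f')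
    have h3 := norm_nonneg (f - f')
    exact mul_nonneg (by positivity) (by nlinarith)
  have hzero : f = f' := by
    rw [inner_neg_left, real_inner_self_eq_norm_sq] at hpos
    have : ‖f - f'‖ ^ 2 = 0 := le_antisymm (by linarith) (by positivity)
    exact sub_eq_zero.1 (norm_eq_zero.1 (pow_eq_zero_iff two_ne_zero |>.1 this))
  rw [← hzero] at hrel
  simpa using hrel

end SymForm

/-! ### Pointwise calculus in `ℓ²(X, m)` -/

namespace IsVertexMeasure

variable {X : Type*} [MeasurableSpace X] {m : Measure X} [IsVertexMeasure m]

/-- Points have positive measure, so null sets are empty. All statements about elements of `Lp`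
below are therefore pointwise. -/
lemma forall_of_ae {p : X → Prop} (h : ∀ᵐ x ∂m, p x) (x : X) : p x := by
  by_contra hx
  have h0 : m {x} ≤ m {y | ¬ p y} := measure_mono (by rintro y rfl; exact hx)
  rw [ae_iff.1 h] at h0
  exact absurd h0 (not_le.2 (IsVertexMeasure.pos x))

lemma le_iff {f g : Lp ℝ 2 m} : f ≤ g ↔ ∀ x, f x ≤ g x := by
  rw [← Lp.coeFn_le]
  exact ⟨fun h => forall_of_ae h, fun h => Eventually.of_forall h⟩

lemma nonneg_iff {f : Lp ℝ 2 m} : 0 ≤ f ↔ ∀ x, 0 ≤ f x := by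
  rw [← Lp.coeFn_nonneg]
  exact ⟨fun h => forall_of_ae h, fun h => Eventually.of_forall h⟩

lemma lp_add_apply (f g : Lp ℝ 2 m) (x : X) : (f + g) x = f x + g x :=
  congrFun (WGraph.coe_add m f g) x

lemma lp_sub_apply (f g : Lp ℝ 2 m) (x : X) : (f - g) x = f x - g x :=
  forall_of_ae (Lp.coeFn_sub f g) x

lemma lp_smul_apply (a : ℝ) (f : Lp ℝ 2 m) (x : X) : (a • f) x = a * f x :=
  congrFun (WGraph.coe_smul m a f) x

lemma lp_zero_apply (x : X) : (0 : Lp ℝ 2 m) x = 0 := congrFun (WGraph.coe_zero m) x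

lemma compLp_apply {C : ℝ → ℝ} (hC : LipschitzWith 1 C) (h0 : C 0 = 0) (f : Lp ℝ 2 m) (x : X) :
    hC.compLp h0 f x = C (f x) :=
  forall_of_ae (hC.coeFn_compLp h0 f) x

lemma toLp_apply {f : X → ℝ} (hf : MemLp f 2 m) (x : X) : hf.toLp f x = f x :=
  forall_of_ae hf.coeFn_toLp x

lemma ext {f g : Lp ℝ 2 m} (h : ∀ x, f x = g x) : f = g :=
  Lp.ext (Eventually.of_forall h)

lemma inner_nonneg {f g : Lp ℝ 2 m} (hf : 0 ≤ f) (hg : 0 ≤ g) : 0 ≤ inner ℝ f g := by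
  rw [L2.inner_def]
  refine integral_nonneg fun x => ?_
  have h1 := nonneg_iff.1 hf x
  have h2 := nonneg_iff.1 hg x
  simpa using mul_nonneg h2 h1

lemma inner_eq_zero {f g : Lp ℝ 2 m} (h : ∀ x, f x * g x = 0) : inner ℝ f g = 0 := by
  rw [L2.inner_def]
  refine integral_eq_zero_of_ae (Eventually.of_forall fun x => ?_)
  have := h x
  simp only [RCLike.inner_apply, conj_trivial, Pi.zero_apply]
  linarith

lemma smul_nonneg {a : ℝ} (ha : 0 ≤ a) {f : Lp ℝ 2 m} (hf : 0 ≤ f) : 0 ≤ a • f :=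
  nonneg_iff.2 fun x => by
    rw [lp_smul_apply]
    exact mul_nonneg ha (nonneg_iff.1 hf x)

lemma smul_le_smul {a : ℝ} (ha : 0 ≤ a) {f g : Lp ℝ 2 m} (h : f ≤ g) : a • f ≤ a • g := by
  rw [← sub_nonneg, ← smul_sub]
  exact smul_nonneg ha (sub_nonneg.2 h)

lemma inner_le_inner_left {f g h : Lp ℝ 2 m} (hfg : f ≤ g) (hh : 0 ≤ h) :
    inner ℝ f h ≤ inner ℝ g h := by
  rw [← sub_nonneg, ← inner_sub_left]
  exact inner_nonneg (sub_nonneg.2 hfg) hh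

lemma exists_lp_of_abs_le [DiscreteMeasurableSpace X] (f : Lp ℝ 2 m) {g : X → ℝ} {C : ℝ}
    (h : ∀ x, |g x| ≤ C * |f x|) : ∃ u : Lp ℝ 2 m, ∀ x, u x = g x := by
  have hg : MemLp g 2 m := (Lp.memLp f).of_le_mul (c := C)
    (Measurable.of_discrete.aestronglyMeasurable) (Eventually.of_forall h)
  exact ⟨hg.toLp g, toLp_apply hg⟩

end IsVertexMeasure

open IsVertexMeasure

namespace SymForm

variable {X : Type*} [MeasurableSpace X] {m : Measure X} [IsVertexMeasure m]
variable {Q Q' : SymForm (Lp ℝ 2 m)}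

/-! ### Markovian forms -/

lemma value_of_mem {f : Lp ℝ 2 m} (h : f ∈ Q.domain) :
    Q.value f = ENNReal.ofReal (Q.bilin ⟨f, h⟩ ⟨f, h⟩) := dif_pos h

lemma IsMarkovian.exists_comp (hQ : Q.IsMarkovian) {C : ℝ → ℝ} (hC : LipschitzWith 1 C)
    (h0 : C 0 = 0) (f : Q.domain) : ∃ g : Q.domain,
      (∀ x, (g : Lp ℝ 2 m) x = C ((f : Lp ℝ 2 m) x)) ∧ Q.bilin g g ≤ Q.bilin f f := by
  have h := hQ C hC h0 f
  rw [value_of_mem f.2] at h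
  have hmem : hC.compLp h0 (f : Lp ℝ 2 m) ∈ Q.domain := by
    by_contra hcon
    rw [value, dif_neg hcon] at h
    exact absurd (top_le_iff.1 h) ENNReal.ofReal_ne_top
  rw [value_of_mem hmem, ENNReal.ofReal_le_ofReal_iff (Q.nonneg _)] at h
  exact ⟨⟨_, hmem⟩, compLp_apply hC h0 _, h⟩

lemma isMarkovian_of_exists (h : ∀ (C : ℝ → ℝ), LipschitzWith 1 C → C 0 = 0 → ∀ f : Q.domain,
    ∃ g : Q.domain, (∀ x, (g : Lp ℝ 2 m) x = C ((f : Lp ℝ 2 m) x)) ∧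
      Q.bilin g g ≤ Q.bilin f f) : Q.IsMarkovian := by
  intro C hC h0 f
  by_cases hf : f ∈ Q.domain
  · obtain ⟨g, hg, hle⟩ := h C hC h0 ⟨f, hf⟩
    have : hC.compLp h0 f = g := ext fun x => by rw [compLp_apply, hg]
    rw [this, value_of_mem g.2, value_of_mem hf]
    exact ENNReal.ofReal_le_ofReal hle
  · rw [value, value, dif_neg hf]
    exact le_top

lemma lipschitzWith_max_zero : LipschitzWith 1 fun t : ℝ => max t 0 :=
  LipschitzWith.id.max_const 0

lemma lipschitzWith_abs : LipschitzWith 1 fun t : ℝ => |t| :=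
  lipschitzWith_one_norm

lemma domain_ext {f g : Q.domain} (h : ∀ x, (f : Lp ℝ 2 m) x = (g : Lp ℝ 2 m) x) : f = g :=
  Subtype.ext (ext h)

/-- For disjoint positive functions |f - g| = f + g, so the Markov property gives Q(f + g) ≤ Q(f -
g), that is 4 Q(f, g) ≤ 0. -/
lemma IsMarkovian.bilin_nonpos (hQ : Q.IsMarkovian) {f g : Q.domain} (hf : 0 ≤ (f : Lp ℝ 2 m))
    (hg : 0 ≤ (g : Lp ℝ 2 m)) (h : ∀ x, (f : Lp ℝ 2 m) x * (g : Lp ℝ 2 m) x = 0) :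
    Q.bilin f g ≤ 0 := by
  obtain ⟨k, hk, hle⟩ := hQ.exists_comp lipschitzWith_abs abs_zero (f - g)
  have hk' : k = f + g := domain_ext fun x => by
    have h1 := nonneg_iff.1 hf x
    have h2 := nonneg_iff.1 hg x
    rw [hk, Submodule.coe_sub, Submodule.coe_add, lp_sub_apply, lp_add_apply]
    rcases mul_eq_zero.1 (h x) with h3 | h3
    · rw [h3, zero_sub, abs_neg, abs_of_nonneg h2, zero_add]
    · rw [h3, sub_zero, abs_of_nonneg h1, add_zero]
  rw [hk', bilin_add_add, bilin_sub_sub] at hle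
  linarith

/-- The decomposition into positive and negative part. -/
lemma IsMarkovian.exists_pos_sub_neg (hQ : Q.IsMarkovian) (f : Q.domain) : ∃ p n : Q.domain,
    f = p - n ∧ 0 ≤ (p : Lp ℝ 2 m) ∧ 0 ≤ (n : Lp ℝ 2 m) ∧
      (∀ x, (p : Lp ℝ 2 m) x = max ((f : Lp ℝ 2 m) x) 0) ∧
      ∀ x, (p : Lp ℝ 2 m) x * (n : Lp ℝ 2 m) x = 0 := by
  obtain ⟨p, hp, -⟩ := hQ.exists_comp lipschitzWith_max_zero (max_self 0) f
  have hn : ∀ x, ((p - f : Q.domain) : Lp ℝ 2 m) x = max (-(f : Lp ℝ 2 m) x) 0 := fun x => by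
    rw [Submodule.coe_sub, lp_sub_apply, hp]
    rcases le_total ((f : Lp ℝ 2 m) x) 0 with h | h
    · rw [max_eq_right h, max_eq_left (by linarith)]
      ring
    · rw [max_eq_left h, max_eq_right (by linarith)]
      ring
  refine ⟨p, p - f, by abel, nonneg_iff.2 fun x => ?_, nonneg_iff.2 fun x => ?_, hp, fun x => ?_⟩
  · rw [hp]
    exact le_max_right _ _
  · rw [hn]
    exact le_max_right _ _
  · rw [hp, hn]
    rcases le_total ((f : Lp ℝ 2 m) x) 0 with h | h
    · rw [max_eq_right h, zero_mul]
    · rw [max_eq_right (by linarith : -(f : Lp ℝ 2 m) x ≤ 0), mul_zero]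

/-- Testing the resolvent equation with the negative part n of the solution makes the left side at
most -Q(n) - a‖n‖², while the right side ⟨f, n⟩ is nonnegative. -/
lemma IsClosedForm.resolvent_nonneg (hQ : Q.IsClosedForm) (hM : Q.IsMarkovian) {a : ℝ}
    (ha : 0 < a) {f : Lp ℝ 2 m} (hf : 0 ≤ f) : 0 ≤ hQ.resolvent ha f := by
  obtain ⟨p, n, hpn, hp, hn, -, h0⟩ := hM.exists_pos_sub_neg (hQ.resolventDom ha f)
  have h1 := hQ.resolventDom_spec ha f n
  have h2 := hM.bilin_nonpos hp hn h0
  have h3 := inner_eq_zero h0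
  have h4 := inner_nonneg hf hn
  have h5 := Q.nonneg n
  rw [hpn, LinearMap.map_sub₂, Submodule.coe_sub, inner_sub_left, h3,
    real_inner_self_eq_norm_sq] at h1
  have h6 : ‖(n : Lp ℝ 2 m)‖ ^ 2 = 0 := by
    have : 0 ≤ ‖(n : Lp ℝ 2 m)‖ ^ 2 := by positivity
    nlinarith
  have h7 : (n : Lp ℝ 2 m) = 0 := by simpa using h6
  rw [← hQ.coe_resolventDom, hpn, Submodule.coe_sub, h7, sub_zero]
  exact hp

/-! ### Domination -/

/-- `D(Q)` is an order ideal in `D(Q')` and `Q' ≤ Q` on positive elements. -/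
structure IsDominated (Q Q' : SymForm (Lp ℝ 2 m)) : Prop where
  le : Q.domain ≤ Q'.domain
  ideal : ∀ f ∈ Q'.domain, ∀ g ∈ Q.domain, 0 ≤ f → f ≤ g → f ∈ Q.domain
  bilin_le : ∀ f g : Q.domain, 0 ≤ (f : Lp ℝ 2 m) → 0 ≤ (g : Lp ℝ 2 m) →
    Q'.bilin (Submodule.inclusion le f) (Submodule.inclusion le g) ≤ Q.bilin f g

/-- The test function is w = (u - v)⁺. It is admissible for Q because 0 ≤ w ≤ u and D(Q) is an
ideal. Comparing both resolvent equations gives Q'(u - v, w) + a‖w‖² ≤ 0, while Q'(u - v, w) ≥ Q'(w,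
w). -/
lemma IsDominated.resolvent_le (h : Q.IsDominated Q') (hQ : Q.IsClosedForm) (hM : Q.IsMarkovian)
    (hQ' : Q'.IsClosedForm) (hM' : Q'.IsMarkovian) {a : ℝ} (ha : 0 < a) {f : Lp ℝ 2 m}
    (hf : 0 ≤ f) : hQ.resolvent ha f ≤ hQ'.resolvent ha f := by
  set u := hQ.resolventDom ha f with hu
  set v := hQ'.resolventDom ha f with hv
  obtain ⟨w, n, hwn, hw, hn, hwx, h0⟩ :=
    hM'.exists_pos_sub_neg (Submodule.inclusion h.le u - v)
  have hu0 : 0 ≤ (u : Lp ℝ 2 m) := hQ.resolvent_nonneg hM ha hf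
  have hv0 : 0 ≤ (v : Lp ℝ 2 m) := hQ'.resolvent_nonneg hM' ha hf
  have hwQ : (w : Lp ℝ 2 m) ∈ Q.domain := by
    refine h.ideal _ w.2 _ u.2 hw (le_iff.2 fun x => ?_)
    rw [hwx, Submodule.coe_sub, lp_sub_apply, Submodule.coe_inclusion]
    exact max_le (by linarith [nonneg_iff.1 hv0 x]) (nonneg_iff.1 hu0 x)
  have h1 : Q.bilin u ⟨w, hwQ⟩ + a * inner ℝ (u : Lp ℝ 2 m) w = inner ℝ f (w : Lp ℝ 2 m) :=
    hQ.resolventDom_spec ha f ⟨w, hwQ⟩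
  have h2 : Q'.bilin v w + a * inner ℝ (v : Lp ℝ 2 m) w = inner ℝ f (w : Lp ℝ 2 m) :=
    hQ'.resolventDom_spec ha f w
  have h3 : Q'.bilin (Submodule.inclusion h.le u) w ≤ Q.bilin u ⟨w, hwQ⟩ :=
    h.bilin_le u ⟨w, hwQ⟩ hu0 hw
  have h4 : Q'.bilin (Submodule.inclusion h.le u - v) w = Q'.bilin w w - Q'.bilin n w := by
    rw [hwn, LinearMap.map_sub₂]
  have h5 : inner ℝ (u : Lp ℝ 2 m) (w : Lp ℝ 2 m) - inner ℝ (v : Lp ℝ 2 m) (w : Lp ℝ 2 m) =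
      ‖(w : Lp ℝ 2 m)‖ ^ 2 := by
    rw [← inner_sub_left]
    have : (u : Lp ℝ 2 m) - v = w - n := congrArg Subtype.val hwn
    rw [this, inner_sub_left, real_inner_self_eq_norm_sq, real_inner_comm, inner_eq_zero h0,
      sub_zero]
  have h6 := hM'.bilin_nonpos hw hn h0
  rw [Q'.symm] at h6
  rw [LinearMap.map_sub₂] at h4
  have h7 := Q'.nonneg w
  have h8 : ‖(w : Lp ℝ 2 m)‖ ^ 2 = 0 := by
    have : 0 ≤ ‖(w : Lp ℝ 2 m)‖ ^ 2 := by positivity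
    nlinarith
  have h9 : (w : Lp ℝ 2 m) = 0 := by simpa using h8
  refine le_iff.2 fun x => ?_
  have h10 := hwx x
  rw [h9, lp_zero_apply, Submodule.coe_sub, lp_sub_apply, Submodule.coe_inclusion] at h10
  have h11 : (u : Lp ℝ 2 m) x - (v : Lp ℝ 2 m) x ≤ 0 := h10 ▸ le_max_left _ _
  exact sub_nonpos.1 h11

/-- Both power series have positive terms, and the powers are compared one by one. -/
lemma exp_apply_le_exp_apply {P P' : Lp ℝ 2 m →L[ℝ] Lp ℝ 2 m} (h0 : ∀ f, 0 ≤ f → 0 ≤ P f)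
    (h : ∀ f, 0 ≤ f → P f ≤ P' f) {f : Lp ℝ 2 m} (hf : 0 ≤ f) :
    NormedSpace.exp P f ≤ NormedSpace.exp P' f := by
  have h0' : ∀ f, 0 ≤ f → 0 ≤ P' f := fun f hf => (h0 f hf).trans (h f hf)
  have hpow : ∀ n, 0 ≤ (P ^ n) f ∧ (P ^ n) f ≤ (P' ^ n) f := by
    intro n
    induction n with
    | zero => exact ⟨hf, le_rfl⟩
    | succ n ih =>
      rw [pow_succ', pow_succ']
      refine ⟨h0 _ ih.1, (h _ ih.1).trans ?_⟩
      have := h0' _ (sub_nonneg.2 ih.2)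
      rw [map_sub] at this
      exact sub_nonneg.1 this
  have hs : ∀ P : Lp ℝ 2 m →L[ℝ] Lp ℝ 2 m,
      HasSum (fun n : ℕ => ((n.factorial : ℝ)⁻¹ • P ^ n) f) (NormedSpace.exp P f) := fun P =>
    (NormedSpace.exp_series_hasSum_exp' (𝕂 := ℝ) P).mapL (ContinuousLinearMap.apply ℝ _ f)
  exact hasSum_le (fun n => smul_le_smul (by positivity) (hpow n).2) (hs P) (hs _)

/-- Domination of forms implies domination of the semigroups. -/
theorem IsDominated.semigroup_le (h : Q.IsDominated Q') (hQ : Q.IsDirichletForm)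
    (hQ' : Q'.IsDirichletForm) (t : ℝ≥0) {f : Lp ℝ 2 m} (hf : 0 ≤ f) :
    hQ.closed.semigroup hQ.dense t f ≤ hQ'.closed.semigroup hQ'.dense t f := by
  refine le_of_tendsto_of_tendsto' (hQ.closed.tendsto_yosidaExp hQ.dense t f)
    (hQ'.closed.tendsto_yosidaExp hQ'.dense t f) fun n => ?_
  rw [hQ.closed.yosidaExp_eq, hQ'.closed.yosidaExp_eq]
  have hn := natCast_succ_pos n
  refine smul_le_smul (Real.exp_pos _).le (exp_apply_le_exp_apply (fun g hg => ?_)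
    (fun g hg => ?_) hf)
  · exact smul_nonneg (by positivity) (smul_nonneg hn.le
      (hQ.closed.resolvent_nonneg hQ.markovian hn hg))
  · exact smul_le_smul (by positivity) (smul_le_smul hn.le
      (h.resolvent_le hQ.closed hQ.markovian hQ'.closed hQ'.markovian hn hg))

/-- The larger resolvent has the smaller approximating form on positive pairs. Boundedness of these
forms as a → ∞ decides membership in the domain, and their limit is the form. -/
lemma isDominated_of_inner_resolvent_le (hQ : Q.IsDirichletForm) (hQ' : Q'.IsDirichletForm)
    (h : ∀ a (ha : 0 < a) (f g : Lp ℝ 2 m), 0 ≤ f → 0 ≤ g →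
      inner ℝ (hQ.closed.resolvent ha f) g ≤ inner ℝ (hQ'.closed.resolvent ha f) g) :
    Q.IsDominated Q' := by
  have hform : ∀ a (ha : 0 < a) (f g : Lp ℝ 2 m), 0 ≤ f → 0 ≤ g →
      a * inner ℝ (f - hQ'.closed.approx ha f) g ≤ a * inner ℝ (f - hQ.closed.approx ha f) g := by
    intro a ha f g hf hg
    have := mul_le_mul_of_nonneg_left (h a ha f g hf hg) ha.le
    rw [inner_sub_left, inner_sub_left, IsClosedForm.coe_approx, IsClosedForm.coe_approx,
      real_inner_smul_left, real_inner_smul_left]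
    gcongr
  have hbound : ∀ a (ha : 0 < a) (f : Q.domain),
      a * inner ℝ ((f : Lp ℝ 2 m) - hQ.closed.approx ha (f : Lp ℝ 2 m)) (f : Lp ℝ 2 m) ≤
        Q.bilin f f := fun a ha f => by
    simpa using hQ.closed.inner_approx_le ha (f : Lp ℝ 2 m) f
  have hle : Q.domain ≤ Q'.domain := by
    have key : ∀ f : Q.domain, 0 ≤ (f : Lp ℝ 2 m) → (f : Lp ℝ 2 m) ∈ Q'.domain := fun f hf =>
      (hQ'.closed.formTendsto_approx_of_le fun a ha =>
        (hform a ha f f hf hf).trans (hbound a ha f)).1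
    intro f hf
    obtain ⟨p, n, hpn, hp, hn, -, -⟩ := hQ.markovian.exists_pos_sub_neg ⟨f, hf⟩
    have : f = p - n := congrArg Subtype.val hpn
    rw [this]
    exact Q'.domain.sub_mem (key p hp) (key n hn)
  refine ⟨hle, fun f hf g hg hf0 hfg => ?_, fun f g hf hg => ?_⟩
  -- With E, E' the approximating forms of Q, Q', the difference D = E - E' is nonnegative on
  -- positive pairs. From 0 ≤ f ≤ g it follows that D(f, f) ≤ D(f, g) ≤ D(g, g), hence E(f, f) ≤
  -- E'(f, f) + E(g, g), uniformly in a.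
  · refine (hQ.closed.formTendsto_approx_of_le (C := Q'.bilin ⟨f, hf⟩ ⟨f, hf⟩ +
      Q.bilin ⟨g, hg⟩ ⟨g, hg⟩) fun a ha => ?_).1
    have h1 : a * inner ℝ (f - hQ'.closed.approx ha f) f ≤ Q'.bilin ⟨f, hf⟩ ⟨f, hf⟩ := by
      simpa using hQ'.closed.inner_approx_le ha f ⟨f, hf⟩
    have h2 := hbound a ha ⟨g, hg⟩
    have h3 : 0 ≤ a * inner ℝ (g - hQ'.closed.approx ha g) g := by
      rw [hQ'.closed.inner_approx_eq]
      have := Q'.nonneg (hQ'.closed.approx ha g)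
      positivity
    have h4 := hform a ha f (g - f) hf0 (sub_nonneg.2 hfg)
    have h5 := hform a ha (g - f) g (sub_nonneg.2 hfg) (hf0.trans hfg)
    simp only [IsClosedForm.coe_approx, map_sub, smul_sub, inner_sub_left, inner_sub_right] at *
    nlinarith
  · refine le_of_tendsto_of_tendsto'
      ((hQ'.closed.formTendsto_approx (Submodule.inclusion hle f)).bilin_left
        (Submodule.inclusion hle g)) ((hQ.closed.formTendsto_approx f).bilin_left g) fun n => ?_
    rw [IsClosedForm.bilin_approx, IsClosedForm.bilin_approx]
    exact hform _ (natCast_succ_pos n) f g hf hg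

/-- Domination of the semigroups implies domination of the forms. -/
theorem isDominated_of_semigroup_le {T T' : ℝ≥0 → Lp ℝ 2 m →L[ℝ] Lp ℝ 2 m}
    (hQ : Q.IsDirichletForm) (hQ' : Q'.IsDirichletForm) (hT : Q.IsSemigroup T)
    (hT' : Q'.IsSemigroup T') (h : ∀ t f, 0 ≤ f → T t f ≤ T' t f) : Q.IsDominated Q' :=
  isDominated_of_inner_resolvent_le hQ hQ' fun _ ha f _ hf hg =>
    IsSemigroup.inner_resolvent_le hQ.closed hQ.dense hT hQ'.closed hQ'.dense hT'
      (fun t => inner_le_inner_left (h t f hf) hg) ha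

/-- A Dirichlet form is sandwiched if and only if it is so in the sense of domination of forms. -/
theorem isSandwiched_iff {Q₀ Q₁ : SymForm (Lp ℝ 2 m)} (hQ : Q.IsDirichletForm)
    (hQ₀ : Q₀.IsDirichletForm) (hQ₁ : Q₁.IsDirichletForm) :
    Q.IsSandwiched Q₀ Q₁ ↔ Q₀.IsDominated Q ∧ Q.IsDominated Q₁ := by
  constructor
  · rintro ⟨T, T₀, T₁, hT, hT₀, hT₁, h⟩
    exact ⟨isDominated_of_semigroup_le hQ₀ hQ hT₀ hT fun t f hf => (h t f hf).1,
      isDominated_of_semigroup_le hQ hQ₁ hT hT₁ fun t f hf => (h t f hf).2⟩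
  · rintro ⟨h₀, h₁⟩
    exact ⟨_, _, _, hQ.closed.isSemigroup hQ.dense, hQ₀.closed.isSemigroup hQ₀.dense,
      hQ₁.closed.isSemigroup hQ₁.dense, fun t f hf =>
        ⟨h₀.semigroup_le hQ₀ hQ t hf, h₁.semigroup_le hQ hQ₁ t hf⟩⟩

end SymForm

/-! ### Point evaluations and finitely supported functions in `ℓ²(X, m)` -/

namespace IsVertexMeasure

variable {X : Type*} [MeasurableSpace X] [DiscreteMeasurableSpace X] (m : Measure X)
  [IsVertexMeasure m]

lemma real_pos (x : X) : 0 < m.real {x} :=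
  ENNReal.toReal_pos (IsVertexMeasure.pos x).ne' (IsVertexMeasure.lt_top x).ne

/-- The indicator function of a point. -/
def delta (x : X) : Lp ℝ 2 m :=
  indicatorConstLp 2 (MeasurableSet.of_discrete (s := {x})) (IsVertexMeasure.lt_top x).ne 1

lemma delta_apply (x y : X) : delta m x y = ({x} : Set X).indicator (fun _ => (1 : ℝ)) y :=
  forall_of_ae indicatorConstLp_coeFn y

lemma delta_apply_self (x : X) : delta m x x = 1 := by simp [delta_apply]

lemma delta_apply_of_ne {x y : X} (h : y ≠ x) : delta m x y = 0 := by simp [delta_apply, h]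

lemma delta_nonneg (x : X) : 0 ≤ delta m x := nonneg_iff.2 fun y => by
  rw [delta_apply]
  exact indicator_nonneg (fun _ _ => zero_le_one) y

lemma inner_delta (x : X) (f : Lp ℝ 2 m) : inner ℝ (delta m x) f = m.real {x} * f x := by
  rw [delta, L2.inner_indicatorConstLp_one, Measure.restrict_singleton, integral_smul_measure,
    integral_dirac]
  rfl

variable {m}

lemma apply_eq_inner (f : Lp ℝ 2 m) (x : X) : f x = (m.real {x})⁻¹ * inner ℝ (delta m x) f := by
  rw [inner_delta, inv_mul_cancel_left₀ (real_pos m x).ne']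

lemma tendsto_apply {ι : Type*} {l : Filter ι} {u : ι → Lp ℝ 2 m} {v : Lp ℝ 2 m}
    (h : Tendsto u l (𝓝 v)) (x : X) : Tendsto (fun n => u n x) l (𝓝 (v x)) := by
  simp only [apply_eq_inner _ x]
  exact (tendsto_const_nhds.inner h).const_mul _

lemma sum_smul_delta_apply (S : Finset X) (f : X → ℝ) (y : X) :
    (∑ x ∈ S, f x • delta m x : Lp ℝ 2 m) y = (S : Set X).indicator f y := by
  classical
  induction S using Finset.induction_on with
  | empty =>
    rw [Finset.sum_empty, Finset.coe_empty, indicator_empty]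
    exact lp_zero_apply y
  | insert a S ha ih =>
    rw [Finset.sum_insert ha, lp_add_apply, ih, lp_smul_apply, delta_apply]
    by_cases h : y = a
    · subst h
      simp [ha]
    · simp [indicator, h]

lemma eq_sum_delta {f : Lp ℝ 2 m} (hf : (Function.support f).Finite) :
    f = ∑ x ∈ hf.toFinset, f x • delta m x := ext fun y => by
  rw [sum_smul_delta_apply, Finite.coe_toFinset, indicator_support]

lemma norm_le_norm_of_abs_le {f g : Lp ℝ 2 m} (h : ∀ x, |f x| ≤ |g x|) : ‖f‖ ≤ ‖g‖ :=
  Lp.norm_le_norm_of_ae_le (Eventually.of_forall h)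

/-- An element orthogonal to all point masses vanishes at every point. -/
lemma dense_of_delta_mem {D : Submodule ℝ (Lp ℝ 2 m)} (h : ∀ x, delta m x ∈ D) :
    Dense (D : Set (Lp ℝ 2 m)) := by
  rw [Submodule.dense_iff_topologicalClosure_eq_top, Submodule.topologicalClosure_eq_top_iff,
    Submodule.eq_bot_iff]
  intro f hf
  refine ext fun x => ?_
  rw [apply_eq_inner, (Submodule.mem_orthogonal _ _).1 hf _ (h x), mul_zero, lp_zero_apply]

end IsVertexMeasure

/-! ### The Neumann form -/

namespace WGraph

open SymForm

variable {X : Type*} (G : WGraph X)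

lemma finiteEnergy_iff (hc : ∀ x, G.c x = 0) (f : X → ℝ) :
    G.FiniteEnergy f ↔ Summable fun p : X × X => G.b p.1 p.2 * (f p.1 - f p.2) ^ 2 := by
  simp [FiniteEnergy, hc, summable_zero]

lemma energy_eq (hc : ∀ x, G.c x = 0) (f g : X → ℝ) : G.energy f g =
    (1 / 2) * ∑' p : X × X, G.b p.1 p.2 * ((f p.1 - f p.2) * (g p.1 - g p.2)) := by
  simp [energy, hc]

lemma energy_self_eq (hc : ∀ x, G.c x = 0) (f : X → ℝ) : G.energy f f =
    (1 / 2) * ∑' p : X × X, G.b p.1 p.2 * (f p.1 - f p.2) ^ 2 := by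
  simp only [energy_eq G hc, sq]

/-- Serves for clamps and for products of bounded functions alike; the explicit energy bound, from
(Ar + Bs)² ≤ 2A²r² + 2B²s², is what later passes to limits. -/
lemma finiteEnergy_of_abs_sub_le (hc : ∀ x, G.c x = 0) {f g u : X → ℝ} (hf : G.FiniteEnergy f)
    (hg : G.FiniteEnergy g) {A B : ℝ}
    (h : ∀ x y, |u x - u y| ≤ A * |f x - f y| + B * |g x - g y|) :
    G.FiniteEnergy u ∧ G.energy u u ≤ 2 * A ^ 2 * G.energy f f + 2 * B ^ 2 * G.energy g g := by
  rw [finiteEnergy_iff G hc] at *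
  have hs := (hf.mul_left (2 * A ^ 2)).add (hg.mul_left (2 * B ^ 2))
  have hle : ∀ p : X × X, G.b p.1 p.2 * (u p.1 - u p.2) ^ 2 ≤
      2 * A ^ 2 * (G.b p.1 p.2 * (f p.1 - f p.2) ^ 2) +
        2 * B ^ 2 * (G.b p.1 p.2 * (g p.1 - g p.2) ^ 2) := by
    intro p
    have h1 : (u p.1 - u p.2) ^ 2 ≤
        2 * A ^ 2 * (f p.1 - f p.2) ^ 2 + 2 * B ^ 2 * (g p.1 - g p.2) ^ 2 := by
      rw [← sq_abs (u p.1 - u p.2), ← sq_abs (f p.1 - f p.2), ← sq_abs (g p.1 - g p.2)]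
      calc |u p.1 - u p.2| ^ 2 ≤ (A * |f p.1 - f p.2| + B * |g p.1 - g p.2|) ^ 2 := by
            gcongr
            exact h _ _
        _ ≤ _ := by nlinarith [sq_nonneg (A * |f p.1 - f p.2| - B * |g p.1 - g p.2|)]
    nlinarith [mul_le_mul_of_nonneg_left h1 (G.b_nonneg p.1 p.2)]
  have hu : Summable fun p : X × X => G.b p.1 p.2 * (u p.1 - u p.2) ^ 2 :=
    Summable.of_nonneg_of_le (fun p => mul_nonneg (G.b_nonneg _ _) (sq_nonneg _)) hle hs
  refine ⟨hu, ?_⟩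
  have := hu.tsum_le_tsum hle hs
  rw [(hf.mul_left _).tsum_add (hg.mul_left _), tsum_mul_left, tsum_mul_left] at this
  rw [energy_self_eq G hc, energy_self_eq G hc, energy_self_eq G hc]
  linarith

lemma finiteEnergy_of_contraction (hc : ∀ x, G.c x = 0) {f u : X → ℝ} (hf : G.FiniteEnergy f)
    (h : ∀ x y, |u x - u y| ≤ |f x - f y|) :
    G.FiniteEnergy u ∧ G.energy u u ≤ G.energy f f := by
  rw [finiteEnergy_iff G hc] at *
  have hle : ∀ p : X × X, G.b p.1 p.2 * (u p.1 - u p.2) ^ 2 ≤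
      G.b p.1 p.2 * (f p.1 - f p.2) ^ 2 := fun p =>
    mul_le_mul_of_nonneg_left (sq_le_sq.2 (h _ _)) (G.b_nonneg _ _)
  have hu : Summable fun p : X × X => G.b p.1 p.2 * (u p.1 - u p.2) ^ 2 :=
    Summable.of_nonneg_of_le (fun p => mul_nonneg (G.b_nonneg _ _) (sq_nonneg _)) hle hf
  refine ⟨hu, ?_⟩
  rw [energy_self_eq G hc, energy_self_eq G hc]
  linarith [hu.tsum_le_tsum hle hf]

/-- Fatou's lemma for the energy. -/
lemma finiteEnergy_of_tendsto (hc : ∀ x, G.c x = 0) {w : ℕ → X → ℝ} {v : X → ℝ} {C : ℝ}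
    (hw : ∀ n, G.FiniteEnergy (w n)) (hC : ∀ᶠ n in atTop, G.energy (w n) (w n) ≤ C)
    (h : ∀ x, Tendsto (fun n => w n x) atTop (𝓝 (v x))) :
    G.FiniteEnergy v ∧ G.energy v v ≤ C := by
  have hsum : ∀ S : Finset (X × X), ∑ p ∈ S, G.b p.1 p.2 * (v p.1 - v p.2) ^ 2 ≤ 2 * C := by
    intro S
    have hlim : Tendsto (fun n => ∑ p ∈ S, G.b p.1 p.2 * (w n p.1 - w n p.2) ^ 2) atTop
        (𝓝 (∑ p ∈ S, G.b p.1 p.2 * (v p.1 - v p.2) ^ 2)) :=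
      tendsto_finsetSum _ fun p _ => (((h p.1).sub (h p.2)).pow 2).const_mul _
    refine le_of_tendsto hlim ?_
    filter_upwards [hC] with n hn
    rw [energy_self_eq G hc] at hn
    have := ((finiteEnergy_iff G hc _).1 (hw n)).sum_le_tsum S
      (fun p _ => mul_nonneg (G.b_nonneg _ _) (sq_nonneg _))
    linarith
  have hnn : ∀ p : X × X, 0 ≤ G.b p.1 p.2 * (v p.1 - v p.2) ^ 2 := fun p =>
    mul_nonneg (G.b_nonneg _ _) (sq_nonneg _)
  have hs := summable_of_sum_le hnn hsum
  refine ⟨(finiteEnergy_iff G hc v).2 hs, ?_⟩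
  rw [energy_self_eq G hc]
  have := hs.tsum_le_of_sum_le hsum
  linarith

lemma summable_b_left (x : X) :
    Summable fun p : X × X => ({x} : Set X).indicator (fun _ => (1 : ℝ)) p.1 * G.b p.1 p.2 := by
  have hinj : Function.Injective fun y : X => (x, y) := fun y z h => (Prod.mk.inj h).2
  refine (hinj.summable_iff ?_).1 ?_
  · rintro ⟨a, b⟩ hab
    have : a ≠ x := by
      rintro rfl
      exact hab ⟨b, rfl⟩
    simp [this]
  · simpa [Function.comp_def] using G.b_summable x

lemma summable_b_right (x : X) :
    Summable fun p : X × X => ({x} : Set X).indicator (fun _ => (1 : ℝ)) p.2 * G.b p.1 p.2 := by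
  rw [← (Equiv.prodComm X X).summable_iff]
  refine (G.summable_b_left x).congr fun p => ?_
  simp [G.b_symm p.1 p.2]

section Forms

variable [MeasurableSpace X] [DiscreteMeasurableSpace X] (m : Measure X) [IsVertexMeasure m]

lemma neumann_apply (f g : (G.neumann m).domain) :
    (G.neumann m).bilin f g = G.energy (f : Lp ℝ 2 m) (g : Lp ℝ 2 m) := rfl

lemma mem_neumann {f : Lp ℝ 2 m} : f ∈ (G.neumann m).domain ↔ G.FiniteEnergy f := Iff.rfl

lemma delta_mem_neumann (hc : ∀ x, G.c x = 0) (x : X) : delta m x ∈ (G.neumann m).domain := by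
  rw [mem_neumann, finiteEnergy_iff G hc]
  refine Summable.of_nonneg_of_le (fun p => mul_nonneg (G.b_nonneg _ _) (sq_nonneg _)) (fun p => ?_)
    ((G.summable_b_left x).add (G.summable_b_right x))
  rw [← add_mul, mul_comm]
  refine mul_le_mul_of_nonneg_right ?_ (G.b_nonneg _ _)
  rw [delta_apply, delta_apply]
  by_cases h1 : p.1 = x <;> by_cases h2 : p.2 = x <;> simp [h1, h2]

lemma mem_neumann_of_finite (hc : ∀ x, G.c x = 0) {f : Lp ℝ 2 m}
    (hf : (Function.support f).Finite) : f ∈ (G.neumann m).domain := by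
  rw [eq_sum_delta hf]
  exact Submodule.sum_mem _ fun x _ => Submodule.smul_mem _ _ (G.delta_mem_neumann m hc x)

/-- Convergence in ℓ² implies pointwise convergence, and Fatou's lemma, applied to u n - u k as k →
∞, transfers the Cauchy estimate to u n - v. -/
lemma neumann_isClosedForm (hc : ∀ x, G.c x = 0) : (G.neumann m).IsClosedForm := by
  intro u hu
  have hcau : CauchySeq fun n => (u n : Lp ℝ 2 m) := by
    rw [Metric.cauchySeq_iff]
    intro ε hε
    obtain ⟨N, hN⟩ := hu (ε ^ 2) (by positivity)
    refine ⟨N, fun n hn k hk => ?_⟩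
    have h1 := hN n hn k hk
    have h2 := (G.neumann m).nonneg (u n - u k)
    rw [dist_eq_norm]
    refine lt_of_pow_lt_pow_left₀ 2 hε.le ?_
    simp only [normSq, Submodule.coe_sub] at h1
    linarith
  obtain ⟨v, hv⟩ := cauchySeq_tendsto_of_complete hcau
  have hpt : ∀ x, Tendsto (fun n => (u n : Lp ℝ 2 m) x) atTop (𝓝 (v x)) := tendsto_apply hv
  have key : ∀ ε > 0, ∃ N, ∀ n ≥ N, G.FiniteEnergy (((u n : Lp ℝ 2 m) - v : Lp ℝ 2 m)) ∧
      G.energy ((u n : Lp ℝ 2 m) - v : Lp ℝ 2 m) ((u n : Lp ℝ 2 m) - v : Lp ℝ 2 m) ≤ ε := by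
    intro ε hε
    obtain ⟨N, hN⟩ := hu ε hε
    refine ⟨N, fun n hn => ?_⟩
    refine G.finiteEnergy_of_tendsto hc (w := fun k => ((u n - u k : (G.neumann m).domain) : Lp ℝ 2 m))
      (fun k => (u n - u k).2) ?_ fun x => ?_
    · filter_upwards [eventually_ge_atTop N] with k hk
      have h1 := hN n hn k hk
      have h2 : 0 ≤ ‖((u n - u k : (G.neumann m).domain) : Lp ℝ 2 m)‖ ^ 2 := by positivity
      simp only [normSq, neumann_apply] at h1
      linarith
    · simp only [Submodule.coe_sub, lp_sub_apply]
      exact (hpt x).const_sub _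
  have hvmem : v ∈ (G.neumann m).domain := by
    obtain ⟨N, hN⟩ := key 1 one_pos
    have h1 : (u N : Lp ℝ 2 m) - v ∈ (G.neumann m).domain := (hN N le_rfl).1
    have := (G.neumann m).domain.sub_mem (u N).2 h1
    rwa [sub_sub_cancel] at this
  refine ⟨⟨v, hvmem⟩, formTendsto_iff.2 ⟨?_, hv⟩⟩
  rw [Metric.tendsto_atTop]
  intro ε hε
  obtain ⟨N, hN⟩ := key (ε / 2) (by positivity)
  refine ⟨N, fun n hn => ?_⟩
  rw [Real.dist_eq, sub_zero, abs_of_nonneg ((G.neumann m).nonneg _)]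
  exact (hN n hn).2.trans_lt (by linarith)

lemma neumann_isMarkovian (hc : ∀ x, G.c x = 0) : (G.neumann m).IsMarkovian := by
  refine isMarkovian_of_exists fun C hC h0 f => ?_
  have h := G.finiteEnergy_of_contraction hc f.2 (u := hC.compLp h0 (f : Lp ℝ 2 m)) fun x y => by
    rw [compLp_apply, compLp_apply]
    simpa [Real.dist_eq] using hC.dist_le_mul ((f : Lp ℝ 2 m) x) ((f : Lp ℝ 2 m) y)
  exact ⟨⟨_, h.1⟩, compLp_apply hC h0 _, h.2⟩

lemma neumann_isDirichletForm (hc : ∀ x, G.c x = 0) : (G.neumann m).IsDirichletForm :=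
  ⟨G.neumann_isClosedForm m hc, dense_of_delta_mem (G.delta_mem_neumann m hc),
    G.neumann_isMarkovian m hc⟩

/-! ### The Dirichlet form -/

lemma dirichlet_le : (G.dirichlet m).domain ≤ (G.neumann m).domain :=
  (G.neumann m).formClosure_le (G.finSupp m)

lemma dirichlet_apply (f g : (G.dirichlet m).domain) :
    (G.dirichlet m).bilin f g = G.energy (f : Lp ℝ 2 m) (g : Lp ℝ 2 m) := rfl

lemma mem_dirichlet_of_finite (hc : ∀ x, G.c x = 0) {f : Lp ℝ 2 m}
    (hf : (Function.support f).Finite) : f ∈ (G.dirichlet m).domain :=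
  ⟨G.mem_neumann_of_finite m hc hf, fun ε hε => ⟨⟨f, G.mem_neumann_of_finite m hc hf⟩, hf, by
    rw [sub_self]
    simpa [normSq] using hε⟩⟩

lemma delta_mem_dirichlet (hc : ∀ x, G.c x = 0) (x : X) : delta m x ∈ (G.dirichlet m).domain :=
  G.mem_dirichlet_of_finite m hc ((finite_singleton x).subset fun y hy => by
    by_contra h
    exact hy (delta_apply_of_ne m h))

lemma exists_formTendsto_of_mem_dirichlet {f : Lp ℝ 2 m} (hf : f ∈ (G.dirichlet m).domain) :
    ∃ φ : ℕ → (G.neumann m).domain, (∀ n, (Function.support (φ n : Lp ℝ 2 m)).Finite) ∧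
      (G.neumann m).FormTendsto φ ⟨f, G.dirichlet_le m hf⟩ := by
  obtain ⟨hfN, h⟩ := hf
  choose φ hφ hlt using fun n : ℕ => h (1 / ((n : ℝ) + 1)) (by positivity)
  refine ⟨φ, hφ, squeeze_zero (fun n => normSq_nonneg _ _) (fun n => ?_)
    tendsto_one_div_add_atTop_nhds_zero_nat⟩
  have h1 : φ n - ⟨f, hfN⟩ = (-1 : ℝ) • (⟨f, hfN⟩ - φ n) := by
    rw [neg_one_smul, neg_sub]
  rw [h1, normSq_smul]
  linarith [hlt n]

lemma dirichlet_isClosedForm (hc : ∀ x, G.c x = 0) : (G.dirichlet m).IsClosedForm := by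
  intro u hu
  let u' : ℕ → (G.neumann m).domain := fun n => Submodule.inclusion (G.dirichlet_le m) (u n)
  obtain ⟨v, hv⟩ := G.neumann_isClosedForm m hc u' hu
  have hvmem : (v : Lp ℝ 2 m) ∈ (G.dirichlet m).domain := by
    refine ⟨v.2, fun ε hε => ?_⟩
    obtain ⟨n, hn⟩ := (hv.eventually_lt_const (by positivity : 0 < ε / 4)).exists
    obtain ⟨hfN, h⟩ := (u n).2
    obtain ⟨φ, hφ, hlt⟩ := h (ε / 4) (by positivity)
    refine ⟨φ, hφ, ?_⟩
    have h1 := (G.neumann m).bilin_add_le ((-1 : ℝ) • (u' n - v)) (u' n - φ)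
    rw [normSq_smul] at h1
    have h2 : (-1 : ℝ) • (u' n - v) + (u' n - φ) = v - φ := by
      rw [neg_one_smul]
      abel
    rw [h2] at h1
    have h3 : (G.neumann m).normSq (u' n - φ) < ε / 4 := hlt
    change (G.neumann m).normSq (v - φ) < ε
    linarith
  exact ⟨⟨v, hvmem⟩, hv⟩

/-- Because C 0 = 0, contractions of finitely supported functions are finitely supported. Their
energies stay bounded, so lower semicontinuity puts the limit in D(Q^(D)); the sharp energy estimate
is that of Q^(N). -/
lemma dirichlet_isMarkovian (hc : ∀ x, G.c x = 0) : (G.dirichlet m).IsMarkovian := by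
  refine isMarkovian_of_exists fun C hC h0 f => ?_
  obtain ⟨φ, hφ, hlim⟩ := G.exists_formTendsto_of_mem_dirichlet m f.2
  choose ψ hψ hle using fun n => (G.neumann_isMarkovian m hc).exists_comp hC h0 (φ n)
  have hψC : ∀ n, (ψ n : Lp ℝ 2 m) = hC.compLp h0 (φ n : Lp ℝ 2 m) := fun n =>
    ext fun x => by rw [hψ, compLp_apply]
  have hψmem : ∀ n, (ψ n : Lp ℝ 2 m) ∈ (G.dirichlet m).domain := fun n =>
    G.mem_dirichlet_of_finite m hc ((hφ n).subset fun x hx hx0 => hx (by rw [hψ, hx0, h0]))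
  obtain ⟨B, hB⟩ := hlim.bilin_self.bddAbove_range
  have h1 := (G.dirichlet_isClosedForm m hc).mem_domain_of_tendsto (C := B)
    (u := fun n => (⟨(ψ n : Lp ℝ 2 m), hψmem n⟩ : (G.dirichlet m).domain)) (w := hC.compLp h0 (f : Lp ℝ 2 m))
    (by
      simp only [hψC]
      exact ((hC.continuous_compLp h0).tendsto _).comp hlim.tendsto)
    (fun n => (hle n).trans (hB ⟨n, rfl⟩))
  obtain ⟨hmem, -⟩ := h1
  refine ⟨⟨_, hmem⟩, compLp_apply hC h0 _, ?_⟩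
  obtain ⟨g, hg, hgle⟩ := (G.neumann_isMarkovian m hc).exists_comp hC h0
    (Submodule.inclusion (G.dirichlet_le m) f)
  have : (g : Lp ℝ 2 m) = hC.compLp h0 (f : Lp ℝ 2 m) := ext fun x => by
    rw [hg, compLp_apply]
    rfl
  rw [neumann_apply, this] at hgle
  exact hgle

lemma dirichlet_isDirichletForm (hc : ∀ x, G.c x = 0) : (G.dirichlet m).IsDirichletForm :=
  ⟨G.dirichlet_isClosedForm m hc, dense_of_delta_mem (G.delta_mem_dirichlet m hc),
    G.dirichlet_isMarkovian m hc⟩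

/-! ### Clamping, the ideal property of D(Q^(D)), and products. -/

lemma abs_clamp_sub_clamp_le (s t s' t' : ℝ) :
    |max (-|t|) (min s |t|) - max (-|t'|) (min s' |t'|)| ≤ 1 * |s - s'| + 1 * |t - t'| := by
  have h1 := abs_max_sub_max_le_max (-|t|) (min s |t|) (-|t'|) (min s' |t'|)
  have h2 := abs_min_sub_min_le_max s |t| s' |t'|
  have h3 : |(-|t|) - (-|t'|)| ≤ |t - t'| := by
    rw [neg_sub_neg, abs_sub_comm]
    exact abs_abs_sub_abs_le _ _
  have h4 := abs_abs_sub_abs_le t t'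
  have h5 := abs_nonneg (s - s')
  have h6 := abs_nonneg (t - t')
  refine h1.trans (max_le (by linarith) (h2.trans (max_le (by linarith) (by linarith))))

lemma abs_clamp_le (s t : ℝ) : |max (-|t|) (min s |t|)| ≤ |t| :=
  abs_le.2 ⟨le_max_left _ _, max_le (by linarith [abs_nonneg t]) (min_le_right _ _)⟩

lemma abs_clamp_sub_le {s t v : ℝ} (h : |s| ≤ v) : |max (-|t|) (min s |t|) - s| ≤ |t - v| := by
  have h1 := neg_abs_le (t - v)
  have h2 := le_abs_self t
  have h3 := abs_le.1 h
  have h4 := abs_nonneg (t - v)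
  rw [abs_le]
  constructor
  · have : min s |t| ≥ s - |t - v| := le_min (by linarith) (by linarith)
    linarith [le_max_right (-|t|) (min s |t|)]
  · have : max (-|t|) (min s |t|) ≤ s + |t - v| :=
      max_le (by linarith) ((min_le_left _ _).trans (by linarith))
    linarith

/-- `D(Q^(D))` is an order ideal in `D(Q^(N))`. -/
lemma mem_dirichlet_of_abs_le (hc : ∀ x, G.c x = 0) {u v : Lp ℝ 2 m}
    (hu : u ∈ (G.neumann m).domain) (hv : v ∈ (G.dirichlet m).domain)
    (h : ∀ x, |u x| ≤ v x) : u ∈ (G.dirichlet m).domain := by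
  obtain ⟨φ, hφ, hlim⟩ := G.exists_formTendsto_of_mem_dirichlet m hv
  -- Clamping u to [-|φ n|, |φ n|] gives finitely supported functions of bounded energy that tend to
  -- u, because |u| ≤ v and φ n → v.
  choose w hw using fun n => exists_lp_of_abs_le (φ n : Lp ℝ 2 m)
    (g := fun x => max (-|(φ n : Lp ℝ 2 m) x|) (min (u x) |(φ n : Lp ℝ 2 m) x|)) (C := 1)
    fun x => by
      rw [one_mul]
      exact abs_clamp_le _ _
  have henergy := fun n => G.finiteEnergy_of_abs_sub_le hc (u := w n) (A := 1) (B := 1) hu (φ n).2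
    fun x y => by
      rw [hw, hw]
      exact abs_clamp_sub_clamp_le _ _ _ _
  have hwmem : ∀ n, w n ∈ (G.dirichlet m).domain := fun n =>
    G.mem_dirichlet_of_finite m hc ((hφ n).subset fun x hx hx0 => hx (by
      rw [hw, hx0]
      simp))
  obtain ⟨B, hB⟩ := hlim.bilin_self.bddAbove_range
  refine ((G.dirichlet_isClosedForm m hc).mem_domain_of_tendsto
    (C := 2 * 1 ^ 2 * G.energy u u + 2 * 1 ^ 2 * B) (u := fun n => ⟨w n, hwmem n⟩) ?_
    fun n => ?_).1
  · rw [tendsto_iff_norm_sub_tendsto_zero]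
    refine squeeze_zero (fun n => norm_nonneg _) (fun n => ?_)
      (tendsto_iff_norm_sub_tendsto_zero.1 hlim.tendsto)
    refine norm_le_norm_of_abs_le fun x => ?_
    simp only [lp_sub_apply, hw]
    exact abs_clamp_sub_le (h x)
  · have h1 := (henergy n).2
    have h2 : G.energy (φ n : Lp ℝ 2 m) (φ n : Lp ℝ 2 m) ≤ B := hB ⟨n, rfl⟩
    rw [dirichlet_apply]
    linarith

lemma exists_mul_mem_neumann (hc : ∀ x, G.c x = 0) {f g : Lp ℝ 2 m}
    (hf : f ∈ (G.neumann m).domain) (hg : g ∈ (G.neumann m).domain) {A B : ℝ}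
    (hA : ∀ x, |f x| ≤ A) (hB : ∀ x, |g x| ≤ B) :
    ∃ u ∈ (G.neumann m).domain, ∀ x, u x = f x * g x := by
  obtain ⟨u, hu⟩ := exists_lp_of_abs_le g (g := fun x => f x * g x) (C := A) fun x => by
    rw [abs_mul]
    exact mul_le_mul_of_nonneg_right (hA x) (abs_nonneg _)
  refine ⟨u, (G.finiteEnergy_of_abs_sub_le hc (A := B) (B := A) hf hg fun x y => ?_).1, hu⟩
  rw [hu, hu]
  have h1 : f x * g x - f y * g y = (f x - f y) * g x + f y * (g x - g y) := by ring
  rw [h1]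
  refine (abs_add_le _ _).trans ?_
  rw [abs_mul, abs_mul, mul_comm B]
  gcongr
  · exact hB x
  · exact hA y

end Forms

end WGraph

/-! ### Cut-off functions -/

/-- The normal contraction that truncates at height `n` and cuts off values of modulus at most
`1 / (n + 1)`. -/
def cutOff (n : ℕ) (t : ℝ) : ℝ :=
  max (-(n : ℝ)) (min (max (t - 1 / ((n : ℝ) + 1)) (min (t + 1 / ((n : ℝ) + 1)) 0)) n)

lemma lipschitzWith_cutOff (n : ℕ) : LipschitzWith 1 (cutOff n) := by
  have h1 : LipschitzWith 1 fun t : ℝ => t - 1 / ((n : ℝ) + 1) :=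
    LipschitzWith.of_dist_le_mul fun s t => by simp [Real.dist_eq]
  have h2 : LipschitzWith 1 fun t : ℝ => t + 1 / ((n : ℝ) + 1) :=
    LipschitzWith.of_dist_le_mul fun s t => by simp [Real.dist_eq]
  have h3 := (h1.max (h2.min_const 0)).min_const (n : ℝ)
  have h4 := h3.const_max (-(n : ℝ))
  rw [max_self] at h4
  exact h4

/-- Soft thresholding followed by truncation. The monotonicity in n and in |t| and the size bounds
can be read off from this formula. -/
lemma abs_cutOff (n : ℕ) (t : ℝ) :
    |cutOff n t| = min (max (|t| - 1 / ((n : ℝ) + 1)) 0) n := by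
  have hε : 0 < 1 / ((n : ℝ) + 1) := by positivity
  have hn : (0 : ℝ) ≤ n := by positivity
  rw [cutOff]
  generalize 1 / ((n : ℝ) + 1) = ε at *
  generalize (n : ℝ) = N at *
  rcases le_total 0 t with ht | ht
  · have h1 : max (t - ε) (min (t + ε) 0) = max (t - ε) 0 := by
      rw [min_eq_right (by linarith)]
    have h2 : 0 ≤ min (max (t - ε) 0) N := le_min (le_max_right _ _) hn
    rw [h1, abs_of_nonneg ht, max_eq_right (by linarith), abs_of_nonneg h2]
  · have h1 : max (t - ε) (min (t + ε) 0) = -max (-t - ε) 0 := by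
      rw [← min_neg_neg, max_eq_right]
      · congr 1 <;> ring
      · exact le_min (by linarith) (by linarith)
    have h2 : min (-max (-t - ε) 0) N = -max (-t - ε) 0 := by
      rw [min_eq_left]
      linarith [le_max_right (-t - ε) 0]
    rw [h1, abs_of_nonpos ht, h2, max_neg_neg, abs_neg, abs_of_nonneg, min_comm]
    exact le_min hn (le_max_right _ _)

lemma cutOff_zero (n : ℕ) : cutOff n 0 = 0 := by
  have h : |cutOff n 0| = 0 := by
    rw [abs_cutOff, abs_zero, zero_sub, max_eq_right, min_eq_left (by positivity)]
    exact neg_nonpos.2 (by positivity)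
  exact abs_eq_zero.1 h

lemma abs_cutOff_le (n : ℕ) (t : ℝ) : |cutOff n t| ≤ n := by
  rw [abs_cutOff]
  exact min_le_right _ _

lemma abs_cutOff_le_abs (n : ℕ) (t : ℝ) : |cutOff n t| ≤ |t| := by
  rw [abs_cutOff]
  have hε : 0 < 1 / ((n : ℝ) + 1) := by positivity
  exact (min_le_left _ _).trans (max_le (by linarith) (abs_nonneg t))

lemma abs_cutOff_mono_abs (n : ℕ) {s t : ℝ} (h : |s| ≤ |t|) : |cutOff n s| ≤ |cutOff n t| := by
  rw [abs_cutOff, abs_cutOff]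
  gcongr

lemma abs_cutOff_mono (t : ℝ) : Monotone fun n => |cutOff n t| := fun n k h => by
  have h' : (n : ℝ) ≤ k := by exact_mod_cast h
  simp only [abs_cutOff]
  gcongr

lemma lt_abs_of_cutOff_ne_zero {n : ℕ} {t : ℝ} (h : cutOff n t ≠ 0) :
    1 / ((n : ℝ) + 1) < |t| := by
  by_contra! hcon
  have : |cutOff n t| ≤ 0 := by
    rw [abs_cutOff]
    exact (min_le_left _ _).trans (max_le (by linarith) le_rfl)
  exact h (abs_nonpos_iff.1 this)

/-- A lower bound for the modulus of the cut-off of level `n + 1` on the support of the cut-off of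
level `n`. -/
def cutOffGap (n : ℕ) : ℝ := min (1 / ((n : ℝ) + 1) - 1 / ((n : ℝ) + 1 + 1)) 1

lemma cutOffGap_pos (n : ℕ) : 0 < cutOffGap n := by
  refine lt_min (sub_pos.2 ?_) one_pos
  exact one_div_lt_one_div_of_lt (by positivity) (by linarith)

/-- Confines the support of a cut-off to a closed superlevel set of the next one. On the
compactification such a set is compact and misses the zeros of the extension, so a single function
bounded below by 1 can be found on it. -/
lemma cutOffGap_le_abs {n : ℕ} {t : ℝ} (h : cutOff n t ≠ 0) :
    cutOffGap n ≤ |cutOff (n + 1) t| := by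
  have h1 := lt_abs_of_cutOff_ne_zero h
  rw [abs_cutOff]
  refine le_min (le_max_of_le_left ?_) ?_
  · push_cast
    refine (min_le_left _ _).trans ?_
    linarith
  · refine (min_le_right _ _).trans ?_
    push_cast
    linarith [(Nat.cast_nonneg n : (0 : ℝ) ≤ n)]

lemma cutOff_nonneg {n : ℕ} {t : ℝ} (ht : 0 ≤ t) : 0 ≤ cutOff n t := by
  refine le_max_of_le_right (le_min (le_max_of_le_right (le_min ?_ le_rfl)) (by positivity))
  positivity

lemma cutOff_eq_of_abs_le {n : ℕ} {t : ℝ} (h : |t| ≤ n) :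
    cutOff n t = max (t - 1 / ((n : ℝ) + 1)) (min (t + 1 / ((n : ℝ) + 1)) 0) := by
  have hε : 0 < 1 / ((n : ℝ) + 1) := by positivity
  obtain ⟨h1, h2⟩ := abs_le.1 h
  have hn : (0 : ℝ) ≤ n := by positivity
  rw [cutOff, min_eq_left, max_eq_right]
  · rcases le_total (t + 1 / ((n : ℝ) + 1)) 0 with h | h
    · exact le_max_of_le_right (le_min (by linarith) (by linarith))
    · exact le_max_of_le_right (le_min (by linarith) (by linarith))
  · exact max_le (by linarith) ((min_le_right _ _).trans hn)

lemma abs_cutOff_sub_le {n : ℕ} {t : ℝ} (h : |t| ≤ n) : |cutOff n t - t| ≤ 1 / ((n : ℝ) + 1) := by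
  have hε : 0 < 1 / ((n : ℝ) + 1) := by positivity
  rw [cutOff_eq_of_abs_le h, abs_le]
  constructor
  · linarith [le_max_left (t - 1 / ((n : ℝ) + 1)) (min (t + 1 / ((n : ℝ) + 1)) 0)]
  · linarith [max_le (by linarith : t - 1 / ((n : ℝ) + 1) ≤ t + 1 / ((n : ℝ) + 1))
      (min_le_left (t + 1 / ((n : ℝ) + 1)) 0)]

lemma tendsto_cutOff (t : ℝ) : Tendsto (fun n => cutOff n t) atTop (𝓝 t) := by
  rw [tendsto_iff_norm_sub_tendsto_zero]
  refine squeeze_zero' (Eventually.of_forall fun n => norm_nonneg _) ?_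
    (tendsto_one_div_add_atTop_nhds_zero_nat (𝕜 := ℝ))
  filter_upwards [tendsto_natCast_atTop_atTop.eventually_ge_atTop |t|] with n hn
  exact abs_cutOff_sub_le hn

/-! ### Form-norm approximation by normal contractions. -/

namespace SymForm

variable {X : Type*} [MeasurableSpace X] [DiscreteMeasurableSpace X] {m : Measure X}
  [IsVertexMeasure m] {Q : SymForm (Lp ℝ 2 m)}

/-- Dominated convergence with majorant 4 f², because normal contractions satisfy |C n t| ≤ |t|. -/
lemma tendsto_compLp {C : ℕ → ℝ → ℝ} (hC : ∀ n, LipschitzWith 1 (C n)) (h0 : ∀ n, C n 0 = 0)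
    (hlim : ∀ t, Tendsto (fun n => C n t) atTop (𝓝 t)) (f : Lp ℝ 2 m) :
    Tendsto (fun n => (hC n).compLp (h0 n) f) atTop (𝓝 f) := by
  rw [tendsto_iff_norm_sub_tendsto_zero]
  have h1 : Tendsto (fun n => ‖(hC n).compLp (h0 n) f - f‖ ^ 2) atTop (𝓝 0) := by
    have h2 : ∀ n, ‖(hC n).compLp (h0 n) f - f‖ ^ 2 = ∫ x, (C n (f x) - f x) ^ 2 ∂m := by
      intro n
      rw [← real_inner_self_eq_norm_sq, L2.inner_def]
      refine integral_congr_ae (Eventually.of_forall fun x => ?_)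
      simp only [lp_sub_apply, compLp_apply]
      simp [sq]
    simp only [h2]
    rw [← integral_zero X ℝ (μ := m)]
    refine tendsto_integral_of_dominated_convergence (fun x => 4 * (f x) ^ 2)
      (fun n => Measurable.of_discrete.aestronglyMeasurable)
      ((Lp.memLp f).integrable_sq.const_mul 4)
      (fun n => Eventually.of_forall fun x => ?_) (Eventually.of_forall fun x => ?_)
    · have h3 : |C n (f x)| ≤ |f x| := by
        simpa [Real.dist_eq, h0 n] using (hC n).dist_le_mul (f x) 0
      rw [Real.norm_eq_abs, abs_of_nonneg (sq_nonneg _), ← sq_abs (f x)]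
      have h4 : |C n (f x) - f x| ≤ 2 * |f x| := (abs_sub _ _).trans (by linarith)
      rw [← sq_abs (C n (f x) - f x)]
      nlinarith [abs_nonneg (C n (f x) - f x)]
    · simpa using ((hlim (f x)).sub_const (f x)).pow 2
  simpa [Real.sqrt_sq] using h1.sqrt

/-- Normal contractions converging to the identity give approximations in the form norm. -/
lemma IsDirichletForm.exists_formTendsto_comp (hQ : Q.IsDirichletForm) {C : ℕ → ℝ → ℝ}
    (hC : ∀ n, LipschitzWith 1 (C n)) (h0 : ∀ n, C n 0 = 0)
    (hlim : ∀ t, Tendsto (fun n => C n t) atTop (𝓝 t)) (f : Q.domain) :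
    ∃ u : ℕ → Q.domain, (∀ n x, (u n : Lp ℝ 2 m) x = C n ((f : Lp ℝ 2 m) x)) ∧
      (∀ n, Q.bilin (u n) (u n) ≤ Q.bilin f f) ∧ Q.FormTendsto u f := by
  choose u hu hle using fun n => hQ.markovian.exists_comp (hC n) (h0 n) f
  refine ⟨u, hu, hle, hQ.closed.formTendsto_of_le ?_ hle⟩
  have : ∀ n, (u n : Lp ℝ 2 m) = (hC n).compLp (h0 n) (f : Lp ℝ 2 m) := fun n => ext fun x => by
    rw [hu, compLp_apply]
  simp only [this]
  exact tendsto_compLp hC h0 hlim _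

lemma IsDirichletForm.exists_cutOff (hQ : Q.IsDirichletForm) (f : Q.domain) :
    ∃ u : ℕ → Q.domain, (∀ n x, (u n : Lp ℝ 2 m) x = cutOff n ((f : Lp ℝ 2 m) x)) ∧
      (∀ n, Q.bilin (u n) (u n) ≤ Q.bilin f f) ∧ Q.FormTendsto u f :=
  hQ.exists_formTendsto_comp lipschitzWith_cutOff cutOff_zero tendsto_cutOff f

end SymForm

namespace WGraph

open SymForm

/-! ### The Royden compactification -/

section Royden

variable {X : Type*} [MeasurableSpace X] [DiscreteMeasurableSpace X] (G : WGraph X)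
  (m : Measure X) [IsVertexMeasure m]

instance : T2Space (Royden G m) := inferInstanceAs (T2Space (closure (range (evalMap G m))))

/-- Tychonoff: the closure lies in a product of intervals, one for each bounded function. -/
instance : CompactSpace (Royden G m) := by
  refine isCompact_iff_compactSpace.1 ?_
  refine IsCompact.of_isClosed_subset (isCompact_univ_pi
    (s := fun f : BddFun G m => Icc (-f.2.2.choose) f.2.2.choose) fun f => isCompact_Icc)
    isClosed_closure ?_
  refine closure_minimal ?_ (isClosed_set_pi fun f _ => isClosed_Icc)
  rintro _ ⟨x, rfl⟩ f -
  exact abs_le.1 (f.2.2.choose_spec x)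

lemma denseRange_incl : DenseRange (incl G m) := by
  intro ω
  refine closure_subtype.2 (closure_mono ?_ ω.2)
  rintro _ ⟨x, rfl⟩
  exact ⟨incl G m x, ⟨x, rfl⟩, rfl⟩

/-- The trace on `X` of the neighbourhood filter of a point of the Royden compactification. -/
def nhdsTrace (ω : Royden G m) : Filter X := comap (incl G m) (𝓝 ω)

instance (ω : Royden G m) : (nhdsTrace G m ω).NeBot :=
  comap_neBot fun t ht => by
    obtain ⟨_, ht', x, rfl⟩ := (mem_closure_iff_nhds.1 (denseRange_incl G m ω)) t ht
    exact ⟨x, ht'⟩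

/-- Bounded elements of `D(Q^(N))`. -/
def IsBdd (f : Lp ℝ 2 m) : Prop := f ∈ (G.neumann m).domain ∧ ∃ M : ℝ, ∀ x, |f x| ≤ M

/-- The value at `ω` of the continuous extension of a function on `X`. -/
def bval (f : X → ℝ) (ω : Royden G m) : ℝ := limUnder (nhdsTrace G m ω) f

variable {G m}

lemma bval_of_tendsto {f : X → ℝ} {ω : Royden G m} {r : ℝ}
    (h : Tendsto f (nhdsTrace G m ω) (𝓝 r)) : bval G m f ω = r := h.limUnder_eq

lemma tendsto_coord (f : BddFun G m) (ω : Royden G m) :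
    Tendsto (fun x => f.1 x) (nhdsTrace G m ω) (𝓝 (ω.1 f)) := by
  have h1 : Continuous fun ω : Royden G m => ω.1 f :=
    (continuous_apply f).comp continuous_subtype_val
  exact (h1.tendsto ω).comp tendsto_comap

lemma bval_eq_coord (f : BddFun G m) (ω : Royden G m) : bval G m f.1 ω = ω.1 f :=
  bval_of_tendsto (tendsto_coord f ω)

lemma IsBdd.tendsto_bval {f : Lp ℝ 2 m} (hf : IsBdd G m f) (ω : Royden G m) :
    Tendsto f (nhdsTrace G m ω) (𝓝 (bval G m f ω)) := by
  rw [bval_eq_coord ⟨f, hf⟩]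
  exact tendsto_coord ⟨f, hf⟩ ω

lemma IsBdd.continuous_bval {f : Lp ℝ 2 m} (hf : IsBdd G m f) : Continuous (bval G m f) := by
  have h1 : Continuous fun ω : Royden G m => ω.1 (⟨f, hf⟩ : BddFun G m) :=
    (continuous_apply _).comp continuous_subtype_val
  exact h1.congr fun ω => (bval_eq_coord ⟨f, hf⟩ ω).symm

lemma IsBdd.bval_incl {f : Lp ℝ 2 m} (hf : IsBdd G m f) (x : X) :
    bval G m f (incl G m x) = f x := bval_eq_coord ⟨f, hf⟩ _

lemma IsBdd.bval_comp {f : Lp ℝ 2 m} (hf : IsBdd G m f) {φ : ℝ → ℝ} (hφ : Continuous φ)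
    {u : X → ℝ} (hu : ∀ x, u x = φ (f x)) (ω : Royden G m) :
    bval G m u ω = φ (bval G m f ω) := by
  obtain rfl : u = fun x => φ (f x) := funext hu
  exact bval_of_tendsto ((hφ.tendsto _).comp (hf.tendsto_bval ω))

lemma IsBdd.bval_comp₂ {f g : Lp ℝ 2 m} (hf : IsBdd G m f) (hg : IsBdd G m g) {φ : ℝ × ℝ → ℝ}
    (hφ : Continuous φ) {u : X → ℝ} (hu : ∀ x, u x = φ (f x, g x)) (ω : Royden G m) :
    bval G m u ω = φ (bval G m f ω, bval G m g ω) := by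
  obtain rfl : u = fun x => φ (f x, g x) := funext hu
  exact bval_of_tendsto ((hφ.tendsto _).comp
    ((hf.tendsto_bval ω).prodMk_nhds (hg.tendsto_bval ω)))

lemma IsBdd.bval_nonneg {f : Lp ℝ 2 m} (hf : IsBdd G m f) (h : 0 ≤ f) (ω : Royden G m) :
    0 ≤ bval G m f ω :=
  ge_of_tendsto' (hf.tendsto_bval ω) (nonneg_iff.1 h)

lemma IsBdd.add {f g : Lp ℝ 2 m} (hf : IsBdd G m f) (hg : IsBdd G m g) : IsBdd G m (f + g) := by
  obtain ⟨A, hA⟩ := hf.2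
  obtain ⟨B, hB⟩ := hg.2
  refine ⟨Submodule.add_mem _ hf.1 hg.1, A + B, fun x => ?_⟩
  rw [lp_add_apply]
  exact (abs_add_le _ _).trans (add_le_add (hA x) (hB x))

lemma IsBdd.smul {f : Lp ℝ 2 m} (hf : IsBdd G m f) (a : ℝ) : IsBdd G m (a • f) := by
  obtain ⟨A, hA⟩ := hf.2
  refine ⟨Submodule.smul_mem _ a hf.1, |a| * A, fun x => ?_⟩
  rw [lp_smul_apply, abs_mul]
  exact mul_le_mul_of_nonneg_left (hA x) (abs_nonneg a)

lemma IsBdd.sub {f g : Lp ℝ 2 m} (hf : IsBdd G m f) (hg : IsBdd G m g) : IsBdd G m (f - g) := by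
  have := hf.add (hg.smul (-1))
  rwa [neg_one_smul, ← sub_eq_add_neg] at this

lemma IsBdd.of_abs_le {f g : Lp ℝ 2 m} (hf : f ∈ (G.neumann m).domain) (hg : IsBdd G m g)
    (h : ∀ x, |f x| ≤ |g x|) : IsBdd G m f :=
  ⟨hf, hg.2.choose, fun x => (h x).trans (hg.2.choose_spec x)⟩

lemma IsBdd.bval_add {f g : Lp ℝ 2 m} (hf : IsBdd G m f) (hg : IsBdd G m g) (ω : Royden G m) :
    bval G m (f + g : Lp ℝ 2 m) ω = bval G m f ω + bval G m g ω :=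
  hf.bval_comp₂ hg (φ := fun p => p.1 + p.2) (by fun_prop) (lp_add_apply f g) ω

lemma IsBdd.bval_sub {f g : Lp ℝ 2 m} (hf : IsBdd G m f) (hg : IsBdd G m g) (ω : Royden G m) :
    bval G m (f - g : Lp ℝ 2 m) ω = bval G m f ω - bval G m g ω :=
  hf.bval_comp₂ hg (φ := fun p => p.1 - p.2) (by fun_prop) (lp_sub_apply f g) ω

lemma IsBdd.bval_smul {f : Lp ℝ 2 m} (hf : IsBdd G m f) (a : ℝ) (ω : Royden G m) :
    bval G m (a • f : Lp ℝ 2 m) ω = a * bval G m f ω :=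
  hf.bval_comp (φ := fun t => a * t) (by fun_prop) (lp_smul_apply a f) ω

lemma isBdd_cutOff (hc : ∀ x, G.c x = 0) {f : Lp ℝ 2 m} (hf : f ∈ (G.neumann m).domain) (n : ℕ) :
    ∃ u : Lp ℝ 2 m, IsBdd G m u ∧ ∀ x, u x = cutOff n (f x) := by
  obtain ⟨u, hu, -⟩ := (G.neumann_isMarkovian m hc).exists_comp (lipschitzWith_cutOff n)
    (cutOff_zero n) ⟨f, hf⟩
  refine ⟨u, ⟨u.2, n, fun x => ?_⟩, hu⟩
  rw [hu]
  exact abs_cutOff_le n _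

/-! ### Extended real valued extensions -/

lemma lipschitzWith_arctan : LipschitzWith 1 Real.arctan := by
  refine lipschitzWith_of_nnnorm_deriv_le Real.differentiable_arctan fun x => ?_
  rw [← NNReal.coe_le_coe, coe_nnnorm, Real.deriv_arctan, Real.norm_eq_abs,
    abs_of_nonneg (by positivity), NNReal.coe_one, div_le_one (by positivity)]
  nlinarith [sq_nonneg x]

lemma extend_of_tendsto {f : X → ℝ} {ω : Royden G m} {e : EReal}
    (h : Tendsto (fun x => (f x : EReal)) (nhdsTrace G m ω) (𝓝 e)) : extend G m f ω = e :=
  h.limUnder_eq (f := nhdsTrace G m ω)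

/-- Along every point of the Royden compactification, a function in `D(Q^(N))` converges in the
extended real line. -/
lemma extend_cases (hc : ∀ x, G.c x = 0) {f : Lp ℝ 2 m} (hf : f ∈ (G.neumann m).domain)
    (ω : Royden G m) :
    (∃ r : ℝ, Tendsto f (nhdsTrace G m ω) (𝓝 r) ∧ extend G m f ω = r) ∨
      (Tendsto (fun x => |f x|) (nhdsTrace G m ω) atTop ∧ (extend G m f ω).abs = ⊤) := by
  -- The function arctan f is bounded and, arctan being a normal contraction, still in D(Q^(N)), so
  -- it has a limit in [-π/2, π/2]. Applying tan recovers f, and the endpoints give the infinite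
  -- values.
  obtain ⟨u, hu, -⟩ := (G.neumann_isMarkovian m hc).exists_comp lipschitzWith_arctan
    Real.arctan_zero ⟨f, hf⟩
  have hubd : IsBdd G m u := ⟨u.2, Real.pi / 2, fun x => by
    rw [hu]
    exact abs_le.2 ⟨(Real.neg_pi_div_two_lt_arctan _).le, (Real.arctan_lt_pi_div_two _).le⟩⟩
  have hlim := hubd.tendsto_bval ω
  set a := bval G m (u : Lp ℝ 2 m) ω
  have hf_eq : ∀ x, f x = Real.tan ((u : Lp ℝ 2 m) x) := fun x => by
    rw [hu, Real.tan_arctan]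
  have ha1 : a ≤ Real.pi / 2 := le_of_tendsto' hlim fun x => by
    rw [hu]
    exact (Real.arctan_lt_pi_div_two _).le
  have ha2 : -(Real.pi / 2) ≤ a := ge_of_tendsto' hlim fun x => by
    rw [hu]
    exact (Real.neg_pi_div_two_lt_arctan _).le
  rcases eq_or_lt_of_le ha1 with h1 | h1
  · right
    have h2 : Tendsto (fun x => f x) (nhdsTrace G m ω) atTop := by
      simp only [hf_eq]
      refine Real.tendsto_tan_pi_div_two.comp (tendsto_nhdsWithin_iff.2 ⟨h1 ▸ hlim, ?_⟩)
      refine Eventually.of_forall fun x => ?_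
      rw [hu]
      exact Real.arctan_lt_pi_div_two _
    refine ⟨tendsto_abs_atTop_atTop.comp h2, ?_⟩
    rw [extend_of_tendsto (EReal.tendsto_coe_atTop.comp h2)]
    rfl
  rcases eq_or_lt_of_le ha2 with h3 | h3
  · right
    have h2 : Tendsto (fun x => f x) (nhdsTrace G m ω) atBot := by
      simp only [hf_eq]
      refine Real.tendsto_tan_neg_pi_div_two.comp (tendsto_nhdsWithin_iff.2 ⟨h3 ▸ hlim, ?_⟩)
      refine Eventually.of_forall fun x => ?_
      rw [hu]
      exact Real.neg_pi_div_two_lt_arctan _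
    refine ⟨tendsto_abs_atBot_atTop.comp h2, ?_⟩
    rw [extend_of_tendsto (EReal.tendsto_coe_atBot.comp h2)]
    rfl
  · left
    have hcos : Real.cos a ≠ 0 := (Real.cos_pos_of_mem_Ioo ⟨h3, h1⟩).ne'
    have h2 : Tendsto (fun x => f x) (nhdsTrace G m ω) (𝓝 (Real.tan a)) := by
      simp only [hf_eq]
      exact (Real.continuousAt_tan.2 hcos).tendsto.comp hlim
    refine ⟨Real.tan a, h2, ?_⟩
    exact extend_of_tendsto ((continuous_coe_real_ereal.tendsto _).comp h2)

lemma extend_eq_bval {f : Lp ℝ 2 m} (hf : IsBdd G m f) (ω : Royden G m) :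
    extend G m f ω = (bval G m f ω : ℝ) :=
  extend_of_tendsto ((continuous_coe_real_ereal.tendsto _).comp (hf.tendsto_bval ω))

/-- The modulus of the extension as a supremum over the cut-offs. -/
lemma abs_extend_eq_iSup (hc : ∀ x, G.c x = 0) {f : Lp ℝ 2 m} (hf : f ∈ (G.neumann m).domain)
    (ω : Royden G m) : (extend G m f ω).abs =
      ⨆ n : ℕ, ENNReal.ofReal |bval G m (fun x => cutOff n (f x)) ω| := by
  rcases extend_cases hc hf ω with ⟨r, hr, hext⟩ | ⟨hr, hext⟩
  · have h1 : ∀ n, bval G m (fun x => cutOff n (f x)) ω = cutOff n r := fun n =>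
      bval_of_tendsto (((lipschitzWith_cutOff n).continuous.tendsto r).comp hr)
    simp only [h1]
    rw [hext, EReal.abs_def]
    refine (iSup_eq_of_tendsto (fun n k h => ENNReal.ofReal_le_ofReal (abs_cutOff_mono r h)) ?_).symm
    exact (ENNReal.continuous_ofReal.tendsto _).comp (tendsto_cutOff r).abs
  · rw [hext, eq_comm, iSup_eq_top]
    intro b hb
    obtain ⟨n, hn⟩ := ENNReal.exists_nat_gt hb.ne
    refine ⟨n, hn.trans_le ?_⟩
    obtain ⟨u, hu, hux⟩ := isBdd_cutOff hc hf n
    have hux' : (fun x => cutOff n (f x)) = u := funext fun x => (hux x).symm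
    rw [hux']
    have h1 : |bval G m u ω| = n := by
      refine tendsto_nhds_unique (hu.tendsto_bval ω).abs (tendsto_const_nhds.congr' ?_)
      filter_upwards [hr.eventually_ge_atTop ((n : ℝ) + 1 / ((n : ℝ) + 1))] with x hx
      rw [hux, abs_cutOff, min_eq_right]
      exact le_max_of_le_left (by linarith)
    rw [h1, ENNReal.ofReal_natCast]

lemma extend_eq_zero_iff (hc : ∀ x, G.c x = 0) {f : Lp ℝ 2 m} (hf : f ∈ (G.neumann m).domain)
    (ω : Royden G m) :
    extend G m f ω = 0 ↔ ∀ n : ℕ, bval G m (fun x => cutOff n (f x)) ω = 0 := by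
  rw [← EReal.abs_eq_zero_iff, abs_extend_eq_iSup hc hf, ENNReal.iSup_eq_zero]
  simp

lemma abs_extend_mono (hc : ∀ x, G.c x = 0) {f g : Lp ℝ 2 m} (hf : f ∈ (G.neumann m).domain)
    (hg : g ∈ (G.neumann m).domain) (h : ∀ x, |f x| ≤ |g x|) (ω : Royden G m) :
    (extend G m f ω).abs ≤ (extend G m g ω).abs := by
  rw [abs_extend_eq_iSup hc hf, abs_extend_eq_iSup hc hg]
  refine iSup_mono fun n => ENNReal.ofReal_le_ofReal ?_
  obtain ⟨u, hu, hux⟩ := isBdd_cutOff hc hf n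
  obtain ⟨v, hv, hvx⟩ := isBdd_cutOff hc hg n
  have hux' : (fun x => cutOff n (f x)) = u := funext fun x => (hux x).symm
  have hvx' : (fun x => cutOff n (g x)) = v := funext fun x => (hvx x).symm
  rw [hux', hvx']
  refine le_of_tendsto_of_tendsto' (hu.tendsto_bval ω).abs (hv.tendsto_bval ω).abs fun x => ?_
  rw [hux, hvx]
  exact abs_cutOff_mono_abs n (h x)

/-! ### The harmonic boundary -/

/-- Points of X are excluded automatically, since the point mass at x lies in D(Q^(D)) and does not
vanish there. Thus ∂X is an intersection of zero sets of continuous functions. -/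
lemma mem_boundary_iff (hc : ∀ x, G.c x = 0) {ω : Royden G m} : ω ∈ boundary G m ↔
    ∀ f : Lp ℝ 2 m, IsBdd G m f → f ∈ (G.dirichlet m).domain → bval G m f ω = 0 := by
  constructor
  · intro h f hf hfD
    rw [bval_eq_coord ⟨f, hf⟩]
    exact h.2 ⟨f, hf⟩ hfD
  · intro h
    refine ⟨?_, fun f hf => ?_⟩
    · rintro ⟨x, rfl⟩
      have hbd : IsBdd G m (delta m x) := ⟨G.delta_mem_neumann m hc x, 1, fun y => by
        rw [delta_apply]
        by_cases hy : y = x <;> simp [hy]⟩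
      have := h _ hbd (G.delta_mem_dirichlet m hc x)
      rw [hbd.bval_incl, delta_apply_self] at this
      exact one_ne_zero this
    · rw [← bval_eq_coord f]
      exact h f.1 f.2 hf

lemma isClosed_boundary (hc : ∀ x, G.c x = 0) : IsClosed (boundary G m) := by
  have : boundary G m = ⋂ (f : Lp ℝ 2 m) (_ : IsBdd G m f) (_ : f ∈ (G.dirichlet m).domain),
      {ω | bval G m f ω = 0} := by
    ext ω
    simp only [mem_boundary_iff hc, mem_iInter]
    rfl
  rw [this]
  exact isClosed_iInter fun f => isClosed_iInter fun hf => isClosed_iInter fun _ =>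
    isClosed_eq hf.continuous_bval continuous_const

/-- On a compact set without common zeros of the bounded functions in the domain of a Markovian
form there is such a function bounded below by one. -/
lemma exists_one_le_bval {Q : SymForm (Lp ℝ 2 m)} (hM : Q.IsMarkovian)
    (hle : Q.domain ≤ (G.neumann m).domain) {K : Set (Royden G m)} (hK : IsCompact K)
    (h : ∀ ω ∈ K, ∃ f ∈ Q.domain, IsBdd G m f ∧ bval G m f ω ≠ 0) :
    ∃ f ∈ Q.domain, IsBdd G m f ∧ 0 ≤ f ∧ ∀ ω ∈ K, 1 ≤ bval G m f ω := by
  refine hK.induction_on (p := fun K => ∃ f ∈ Q.domain, IsBdd G m f ∧ 0 ≤ f ∧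
    ∀ ω ∈ K, 1 ≤ bval G m f ω) ?_ ?_ ?_ ?_
  · exact ⟨0, Q.domain.zero_mem, ⟨Submodule.zero_mem _, 0, fun x => by
      rw [lp_zero_apply, abs_zero]⟩, le_rfl, fun ω hω => hω.elim⟩
  · rintro s t hst ⟨f, h1, h2, h3, h4⟩
    exact ⟨f, h1, h2, h3, fun ω hω => h4 ω (hst hω)⟩
  · rintro s t ⟨f, hf1, hf2, hf3, hf4⟩ ⟨g, hg1, hg2, hg3, hg4⟩
    refine ⟨f + g, Q.domain.add_mem hf1 hg1, hf2.add hg2, add_nonneg hf3 hg3, fun ω hω => ?_⟩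
    rw [hf2.bval_add hg2]
    have h1 := hf2.bval_nonneg hf3 ω
    have h2 := hg2.bval_nonneg hg3 ω
    rcases hω with hω | hω
    · linarith [hf4 ω hω]
    · linarith [hg4 ω hω]
  · intro ω hω
    obtain ⟨f, hf, hfb, hfω⟩ := h ω hω
    obtain ⟨g, hg, -⟩ := hM.exists_comp lipschitzWith_abs abs_zero ⟨f, hf⟩
    have hgb : IsBdd G m g := IsBdd.of_abs_le (hle g.2) hfb fun x => by rw [hg, abs_abs]
    have hgω : 0 < bval G m (g : Lp ℝ 2 m) ω := by
      rw [hfb.bval_comp continuous_abs hg]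
      exact abs_pos.2 hfω
    have hg0 : 0 ≤ (g : Lp ℝ 2 m) := nonneg_iff.2 fun x => by
      rw [hg]
      exact abs_nonneg _
    -- Scaling makes the value at ω equal to 2, hence greater than 1 in a neighbourhood.
    set a := 2 / bval G m (g : Lp ℝ 2 m) ω with ha
    have ha0 : 0 < a := by positivity
    refine ⟨{ω' | 1 < bval G m (a • (g : Lp ℝ 2 m) : Lp ℝ 2 m) ω'}, mem_nhdsWithin_of_mem_nhds
      ((isOpen_lt continuous_const (hgb.smul a).continuous_bval).mem_nhds ?_), a • (g : Lp ℝ 2 m),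
      Q.domain.smul_mem a g.2, hgb.smul a, smul_nonneg ha0.le hg0, fun ω' h => le_of_lt h⟩
    change 1 < bval G m (a • (g : Lp ℝ 2 m) : Lp ℝ 2 m) ω
    rw [hgb.bval_smul, ha, div_mul_cancel₀ _ hgω.ne']
    norm_num

lemma exists_dirichlet_one_le (hc : ∀ x, G.c x = 0) {K : Set (Royden G m)} (hK : IsClosed K)
    (h : Disjoint K (boundary G m)) : ∃ f ∈ (G.dirichlet m).domain, IsBdd G m f ∧ 0 ≤ f ∧
      ∀ ω ∈ K, 1 ≤ bval G m f ω := by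
  refine exists_one_le_bval (G.dirichlet_isMarkovian m hc) (G.dirichlet_le m) hK.isCompact
    fun ω hω => ?_
  have := (disjoint_left.1 h) hω
  rw [mem_boundary_iff hc] at this
  push Not at this
  obtain ⟨f, h1, h2, h3⟩ := this
  exact ⟨f, h2, h1, h3⟩

/-- Functions in `D(Q^(N))` whose extension vanishes on the boundary belong to `D(Q^(D))`. -/
lemma mem_dirichlet_of_extend_eq_zero (hc : ∀ x, G.c x = 0) {f : Lp ℝ 2 m}
    (hf : f ∈ (G.neumann m).domain) (h : ∀ ω ∈ boundary G m, extend G m f ω = 0) :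
    f ∈ (G.dirichlet m).domain := by
  obtain ⟨u, hu, hle, hlim⟩ := (G.neumann_isDirichletForm m hc).exists_cutOff ⟨f, hf⟩
  have humem : ∀ n, (u n : Lp ℝ 2 m) ∈ (G.dirichlet m).domain := by
    intro n
    obtain ⟨w, hw, hwx⟩ := isBdd_cutOff hc hf (n + 1)
    have hw0 : ∀ ω ∈ boundary G m, bval G m w ω = 0 := fun ω hω => by
      have := (extend_eq_zero_iff hc hf ω).1 (h ω hω) (n + 1)
      rwa [show (fun x => cutOff (n + 1) (f x)) = w from funext fun x => (hwx x).symm] at this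
    -- The superlevel set of the next cut-off is closed and misses ∂X, so some g in D(Q^(D)) is at
    -- least 1 on it. Then |u n| ≤ n g, and the ideal property applies.
    obtain ⟨g, hg, hgb, hg0, hg1⟩ := exists_dirichlet_one_le hc
      (K := {ω | cutOffGap n ≤ |bval G m w ω|}) (isClosed_le continuous_const hw.continuous_bval.abs)
      (disjoint_left.2 fun ω hω hω' => by
        have h1 : cutOffGap n ≤ |bval G m w ω| := hω
        rw [hw0 ω hω', abs_zero] at h1
        exact absurd (cutOffGap_pos n) h1.not_gt)
    refine G.mem_dirichlet_of_abs_le m hc (u n).2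
      (Submodule.smul_mem _ (n : ℝ) hg) fun x => ?_
    rw [lp_smul_apply, hu]
    by_cases hx : cutOff n (f x) = 0
    · rw [hx, abs_zero]
      exact mul_nonneg (by positivity) (nonneg_iff.1 hg0 x)
    · have h2 : 1 ≤ g x := by
        rw [← hgb.bval_incl]
        refine hg1 _ ?_
        change cutOffGap n ≤ |bval G m w (incl G m x)|
        rw [hw.bval_incl, hwx]
        exact cutOffGap_le_abs hx
      calc |cutOff n (f x)| ≤ n := abs_cutOff_le n _
        _ ≤ n * g x := le_mul_of_one_le_right (by positivity) h2
  exact ((G.dirichlet_isClosedForm m hc).mem_domain_of_tendsto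
    (u := fun n => (⟨(u n : Lp ℝ 2 m), humem n⟩ : (G.dirichlet m).domain)) hlim.tendsto hle).1

lemma extend_eq_zero_of_mem_dirichlet (hc : ∀ x, G.c x = 0) {f : Lp ℝ 2 m}
    (hf : f ∈ (G.dirichlet m).domain) {ω : Royden G m} (hω : ω ∈ boundary G m) :
    extend G m f ω = 0 := by
  rw [extend_eq_zero_iff hc (G.dirichlet_le m hf)]
  intro n
  obtain ⟨u, hu, -⟩ := (G.dirichlet_isMarkovian m hc).exists_comp (lipschitzWith_cutOff n)
    (cutOff_zero n) ⟨f, hf⟩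
  have hub : IsBdd G m u := ⟨G.dirichlet_le m u.2, n, fun x => by
    rw [hu]
    exact abs_cutOff_le n _⟩
  rw [show (fun x => cutOff n (f x)) = (u : Lp ℝ 2 m) from funext fun x => (hu x).symm]
  exact (mem_boundary_iff hc).1 hω _ hub u.2

lemma mem_dirichlet_of_bval_eq_zero (hc : ∀ x, G.c x = 0) {f : Lp ℝ 2 m} (hf : IsBdd G m f)
    (h : ∀ ω ∈ boundary G m, bval G m f ω = 0) : f ∈ (G.dirichlet m).domain :=
  mem_dirichlet_of_extend_eq_zero hc hf.1 fun ω hω => by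
    rw [extend_eq_bval hf, h ω hω, EReal.coe_zero]

end Royden

end WGraph

namespace SymForm

variable {X : Type*} [MeasurableSpace X] [DiscreteMeasurableSpace X] {m : Measure X}
  [IsVertexMeasure m] {Q Q' : SymForm (Lp ℝ 2 m)}

/-! ### Functions in the domain of a Dirichlet form -/

lemma IsDominated.mem_of_abs_le (h : Q.IsDominated Q') (hM' : Q'.IsMarkovian) {f g : Lp ℝ 2 m}
    (hf : f ∈ Q'.domain) (hg : g ∈ Q.domain) (hfg : ∀ x, |f x| ≤ g x) : f ∈ Q.domain := by
  obtain ⟨p, n, hpn, hp, hn, hpx, -⟩ := hM'.exists_pos_sub_neg ⟨f, hf⟩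
  have hfpn : f = p - n := congrArg Subtype.val hpn
  have hx : ∀ x, f x = (p : Lp ℝ 2 m) x - (n : Lp ℝ 2 m) x := fun x => by
    rw [← lp_sub_apply, ← hfpn]
  have hpg : (p : Lp ℝ 2 m) ≤ g := le_iff.2 fun x => by
    rw [hpx]
    exact max_le ((le_abs_self _).trans (hfg x)) ((abs_nonneg _).trans (hfg x))
  have hng : (n : Lp ℝ 2 m) ≤ g := le_iff.2 fun x => by
    have h1 := hx x
    have h2 := hfg x
    have h3 := hpx x
    change (p : Lp ℝ 2 m) x = max (f x) 0 at h3
    rcases le_total (f x) 0 with h4 | h4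
    · rw [max_eq_right h4] at h3
      linarith [neg_abs_le (f x)]
    · rw [max_eq_left h4] at h3
      linarith [abs_nonneg (f x)]
  rw [hfpn]
  exact Q.domain.sub_mem (h.ideal _ p.2 _ hg hp hpg) (h.ideal _ n.2 _ hg hn hng)

end SymForm

namespace WGraph

open SymForm

variable {X : Type*} [MeasurableSpace X] [DiscreteMeasurableSpace X] {G : WGraph X}
  {m : Measure X} [IsVertexMeasure m] {Q : SymForm (Lp ℝ 2 m)}

/-! ### The difference of a sandwiched form and the Neumann form -/

/-- The bilinear form `Q - Q^(N)` on `D(Q)`. -/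
def excess (hle : Q.domain ≤ (G.neumann m).domain) : Q.domain →ₗ[ℝ] Q.domain →ₗ[ℝ] ℝ :=
  Q.bilin - (G.neumann m).bilin.compl₁₂ (Submodule.inclusion hle) (Submodule.inclusion hle)

lemma excess_apply (hle : Q.domain ≤ (G.neumann m).domain) (f g : Q.domain) :
    excess hle f g = Q.bilin f g - G.energy (f : Lp ℝ 2 m) (g : Lp ℝ 2 m) := rfl

lemma excess_symm (hle : Q.domain ≤ (G.neumann m).domain) (f g : Q.domain) :
    excess hle f g = excess hle g f := by
  rw [excess_apply, excess_apply, Q.symm, G.energy_comm]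

lemma excess_nonneg (h₁ : Q.IsDominated (G.neumann m)) {f g : Q.domain}
    (hf : 0 ≤ (f : Lp ℝ 2 m)) (hg : 0 ≤ (g : Lp ℝ 2 m)) : 0 ≤ excess h₁.le f g :=
  sub_nonneg.2 (h₁.bilin_le f g hf hg)

/-- On positive pairs from D(Q^(D)) the two dominations bound q from both sides by 0; the general
case follows by splitting into positive and negative parts. -/
lemma excess_eq_zero_of_dirichlet (hc : ∀ x, G.c x = 0) (h₀ : (G.dirichlet m).IsDominated Q)
    (h₁ : Q.IsDominated (G.neumann m)) {f g : Q.domain}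
    (hf : (f : Lp ℝ 2 m) ∈ (G.dirichlet m).domain) (hg : (g : Lp ℝ 2 m) ∈ (G.dirichlet m).domain) :
    excess h₁.le f g = 0 := by
  have key : ∀ f g : (G.dirichlet m).domain, 0 ≤ (f : Lp ℝ 2 m) → 0 ≤ (g : Lp ℝ 2 m) →
      excess h₁.le (Submodule.inclusion h₀.le f) (Submodule.inclusion h₀.le g) = 0 := by
    intro f g hf hg
    refine le_antisymm (sub_nonpos.2 (h₀.bilin_le f g hf hg)) (excess_nonneg h₁ hf hg)
  obtain ⟨p, n, hpn, hp, hn, -, -⟩ := (G.dirichlet_isMarkovian m hc).exists_pos_sub_neg ⟨f, hf⟩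
  obtain ⟨p', n', hpn', hp', hn', -, -⟩ :=
    (G.dirichlet_isMarkovian m hc).exists_pos_sub_neg ⟨g, hg⟩
  have h1 : f = Submodule.inclusion h₀.le p - Submodule.inclusion h₀.le n :=
    Subtype.ext (show (f : Lp ℝ 2 m) = (p : Lp ℝ 2 m) - (n : Lp ℝ 2 m) from
      congrArg Subtype.val hpn)
  have h2 : g = Submodule.inclusion h₀.le p' - Submodule.inclusion h₀.le n' :=
    Subtype.ext (show (g : Lp ℝ 2 m) = (p' : Lp ℝ 2 m) - (n' : Lp ℝ 2 m) from
      congrArg Subtype.val hpn')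
  rw [h1, h2, LinearMap.map_sub₂, map_sub, map_sub, key _ _ hp hp', key _ _ hp hn',
    key _ _ hn hp', key _ _ hn hn']
  ring

/-- For disjoint positive functions (f(x) - f(y))(g(x) - g(y)) = -(f(x)g(y) + f(y)g(x)), so
restricting g only shrinks the modulus of each summand. Dominated convergence over the edges
applies. -/
lemma tendsto_energy_indicator_compl (hc : ∀ x, G.c x = 0) {f g : X → ℝ} (hf : G.FiniteEnergy f)
    (hg : G.FiniteEnergy g) (hf0 : ∀ x, 0 ≤ f x) (hg0 : ∀ x, 0 ≤ g x) (h : ∀ x, f x * g x = 0) :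
    Tendsto (fun K : Finset X => G.energy f ((K : Set X)ᶜ.indicator g)) atTop (𝓝 0) := by
  have hs := (hf.summable_b G hg).norm
  simp only [energy_eq G hc]
  rw [← mul_zero (1 / 2 : ℝ)]
  refine Tendsto.const_mul _ ?_
  rw [← tsum_zero (β := X × X) (α := ℝ)]
  refine tendsto_tsum_of_dominated_convergence hs (fun p => ?_) (Eventually.of_forall fun K p => ?_)
  · refine tendsto_const_nhds.congr' ?_
    classical
    filter_upwards [eventually_ge_atTop ({p.1, p.2} : Finset X)] with K hK
    have h1 : p.1 ∈ K := hK (by simp)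
    have h2 : p.2 ∈ K := hK (by simp)
    simp [h1, h2]
  · rw [norm_mul, norm_mul (G.b p.1 p.2)]
    refine mul_le_mul_of_nonneg_left ?_ (norm_nonneg (G.b p.1 p.2))
    set k := (K : Set X)ᶜ.indicator g
    have hk : ∀ x, 0 ≤ k x ∧ k x ≤ g x ∧ f x * k x = 0 := fun x => by
      by_cases hx : x ∈ K
      · have : k x = 0 := by simp [k, hx]
        rw [this]
        exact ⟨le_rfl, hg0 x, mul_zero _⟩
      · have : k x = g x := by simp [k, hx]
        rw [this]
        exact ⟨hg0 x, le_rfl, h x⟩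
    obtain ⟨a1, a2, a3⟩ := hk p.1
    obtain ⟨b1, b2, b3⟩ := hk p.2
    have e1 : (f p.1 - f p.2) * (k p.1 - k p.2) = -(f p.1 * k p.2 + f p.2 * k p.1) := by
      linear_combination a3 + b3
    have e2 : (f p.1 - f p.2) * (g p.1 - g p.2) = -(f p.1 * g p.2 + f p.2 * g p.1) := by
      linear_combination h p.1 + h p.2
    have c1 := mul_nonneg (hf0 p.1) b1
    have c2 := mul_nonneg (hf0 p.2) a1
    have c3 := mul_le_mul_of_nonneg_left b2 (hf0 p.1)
    have c4 := mul_le_mul_of_nonneg_left a2 (hf0 p.2)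
    rw [e1, e2, norm_neg, norm_neg, Real.norm_eq_abs, Real.norm_eq_abs, abs_of_nonneg (by linarith),
      abs_of_nonneg (by linarith)]
    linarith

/-- Removing from g its restriction to a finite set K leaves q(f, g) unchanged, and the Markov
property gives q(f, g) ≤ -Q^(N)(f, g 1_{X \ K}) → 0. The hypothesis `hfin` allows bootstrapping: it
is known first for point masses f, and from these it follows for all f. -/
lemma excess_eq_zero_of_disjoint_aux (hc : ∀ x, G.c x = 0) (hM : Q.IsMarkovian)
    (h₀ : (G.dirichlet m).IsDominated Q) (h₁ : Q.IsDominated (G.neumann m)) {f g : Q.domain}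
    (hf : 0 ≤ (f : Lp ℝ 2 m)) (hg : 0 ≤ (g : Lp ℝ 2 m))
    (h : ∀ x, (f : Lp ℝ 2 m) x * (g : Lp ℝ 2 m) x = 0)
    (hfin : ∀ ψ : Q.domain, (Function.support (ψ : Lp ℝ 2 m)).Finite → excess h₁.le f ψ = 0) :
    excess h₁.le f g = 0 := by
  refine le_antisymm ?_ (excess_nonneg h₁ hf hg)
  have hlim := tendsto_energy_indicator_compl hc (h₁.le f.2) (h₁.le g.2) (nonneg_iff.1 hf)
    (nonneg_iff.1 hg) h
  have hlim' := hlim.neg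
  rw [neg_zero] at hlim'
  refine ge_of_tendsto' hlim' fun K => ?_
  set ψ : Lp ℝ 2 m := ∑ x ∈ K, (g : Lp ℝ 2 m) x • delta m x with hψ
  have hψx : ∀ y, ψ y = (K : Set X).indicator (g : Lp ℝ 2 m) y := sum_smul_delta_apply K _
  have hψfin : (Function.support ψ).Finite := K.finite_toSet.subset fun y hy => by
    by_contra hyK
    exact hy (by rw [hψx, indicator_of_notMem hyK])
  have hψmem : ψ ∈ Q.domain := h₀.le (G.mem_dirichlet_of_finite m hc hψfin)
  have hkx : ∀ y, ((g - ⟨ψ, hψmem⟩ : Q.domain) : Lp ℝ 2 m) y =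
      (K : Set X)ᶜ.indicator (g : Lp ℝ 2 m) y := fun y => by
    rw [Submodule.coe_sub, lp_sub_apply, hψx]
    by_cases hy : y ∈ K <;> simp [hy]
  have hk0 : 0 ≤ ((g - ⟨ψ, hψmem⟩ : Q.domain) : Lp ℝ 2 m) := nonneg_iff.2 fun y => by
    rw [hkx]
    exact indicator_nonneg (fun _ _ => nonneg_iff.1 hg _) y
  have h1 : excess h₁.le f (g - ⟨ψ, hψmem⟩) = excess h₁.le f g := by
    rw [map_sub, hfin ⟨ψ, hψmem⟩ hψfin, sub_zero]
  have h2 : Q.bilin f (g - ⟨ψ, hψmem⟩) ≤ 0 := by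
    refine hM.bilin_nonpos hf hk0 fun y => ?_
    rw [hkx]
    by_cases hy : y ∈ K
    · simp [hy]
    · simp [hy, h y]
  have h3 : ((g - ⟨ψ, hψmem⟩ : Q.domain) : Lp ℝ 2 m) = (K : Set X)ᶜ.indicator (g : Lp ℝ 2 m) :=
    funext hkx
  rw [← h1, excess_apply, h3]
  linarith

/-- Subtracting g(x) times the point mass from a positive g leaves a positive function disjoint from
the point mass, to which the previous lemma applies. -/
lemma excess_delta (hc : ∀ x, G.c x = 0) (hM : Q.IsMarkovian)
    (h₀ : (G.dirichlet m).IsDominated Q) (h₁ : Q.IsDominated (G.neumann m)) (x : X)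
    (g : Q.domain) : excess h₁.le ⟨delta m x, h₀.le (G.delta_mem_dirichlet m hc x)⟩ g = 0 := by
  set d : Q.domain := ⟨delta m x, h₀.le (G.delta_mem_dirichlet m hc x)⟩ with hd
  have hdd : excess h₁.le d d = 0 := excess_eq_zero_of_dirichlet hc h₀ h₁
    (G.delta_mem_dirichlet m hc x) (G.delta_mem_dirichlet m hc x)
  have key : ∀ g : Q.domain, 0 ≤ (g : Lp ℝ 2 m) → excess h₁.le d g = 0 := by
    intro g hg
    have hx : ∀ y, ((g - (g : Lp ℝ 2 m) x • d : Q.domain) : Lp ℝ 2 m) y =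
        ({x} : Set X)ᶜ.indicator (g : Lp ℝ 2 m) y := fun y => by
      rw [Submodule.coe_sub, lp_sub_apply, Submodule.coe_smul, lp_smul_apply, hd, delta_apply]
      by_cases hy : y = x
      · subst hy
        simp
      · simp [hy]
    have h1 : excess h₁.le d (g - (g : Lp ℝ 2 m) x • d) = 0 := by
      refine excess_eq_zero_of_disjoint_aux hc hM h₀ h₁ (delta_nonneg m x) (nonneg_iff.2 fun y => ?_)
        (fun y => ?_) fun ψ hψ => excess_eq_zero_of_dirichlet hc h₀ h₁
          (G.delta_mem_dirichlet m hc x) (G.mem_dirichlet_of_finite m hc hψ)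
      · rw [hx]
        exact indicator_nonneg (fun _ _ => nonneg_iff.1 hg _) y
      · rw [hx, hd, delta_apply]
        by_cases hy : y = x <;> simp [hy]
    rw [map_sub, map_smul, hdd, smul_zero, sub_zero] at h1
    exact h1
  obtain ⟨p, n, hpn, hp, hn, -, -⟩ := hM.exists_pos_sub_neg g
  rw [hpn, map_sub, key p hp, key n hn, sub_zero]

lemma excess_of_finite (hc : ∀ x, G.c x = 0) (hM : Q.IsMarkovian)
    (h₀ : (G.dirichlet m).IsDominated Q) (h₁ : Q.IsDominated (G.neumann m)) (f : Q.domain)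
    {ψ : Q.domain} (hψ : (Function.support (ψ : Lp ℝ 2 m)).Finite) : excess h₁.le f ψ = 0 := by
  have h : ψ = ∑ x ∈ hψ.toFinset,
      (ψ : Lp ℝ 2 m) x • (⟨delta m x, h₀.le (G.delta_mem_dirichlet m hc x)⟩ : Q.domain) := by
    refine Subtype.ext ?_
    rw [AddSubmonoidClass.coe_finsetSum]
    exact eq_sum_delta hψ
  rw [h, map_sum]
  refine Finset.sum_eq_zero fun x _ => ?_
  rw [map_smul, excess_symm, excess_delta hc hM h₀ h₁, smul_zero]

/-- The form `Q - Q^(N)` is local. -/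
lemma excess_eq_zero_of_disjoint (hc : ∀ x, G.c x = 0) (hM : Q.IsMarkovian)
    (h₀ : (G.dirichlet m).IsDominated Q) (h₁ : Q.IsDominated (G.neumann m)) {f g : Q.domain}
    (h : ∀ x, (f : Lp ℝ 2 m) x * (g : Lp ℝ 2 m) x = 0) : excess h₁.le f g = 0 := by
  obtain ⟨p, n, hpn, hp, hn, hpx, hpn0⟩ := hM.exists_pos_sub_neg f
  obtain ⟨p', n', hpn', hp', hn', hpx', hpn0'⟩ := hM.exists_pos_sub_neg g
  have hzero : ∀ {f p n : Q.domain}, f = p - n → (∀ x, (p : Lp ℝ 2 m) x = max ((f : Lp ℝ 2 m) x) 0) →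
      ∀ x, (f : Lp ℝ 2 m) x = 0 → (p : Lp ℝ 2 m) x = 0 ∧ (n : Lp ℝ 2 m) x = 0 := by
    intro f p n hf hp x hx
    have h1 : (p : Lp ℝ 2 m) x = 0 := by rw [hp, hx, max_self]
    refine ⟨h1, ?_⟩
    rw [hf, Submodule.coe_sub, lp_sub_apply, h1] at hx
    linarith
  have key : ∀ u v : Q.domain, 0 ≤ (u : Lp ℝ 2 m) → 0 ≤ (v : Lp ℝ 2 m) →
      (∀ x, (f : Lp ℝ 2 m) x = 0 → (u : Lp ℝ 2 m) x = 0) →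
      (∀ x, (g : Lp ℝ 2 m) x = 0 → (v : Lp ℝ 2 m) x = 0) → excess h₁.le u v = 0 := by
    intro u v hu hv hfu hgv
    refine excess_eq_zero_of_disjoint_aux hc hM h₀ h₁ hu hv (fun x => ?_) fun ψ hψ =>
      excess_of_finite hc hM h₀ h₁ u hψ
    rcases mul_eq_zero.1 (h x) with h1 | h1
    · rw [hfu x h1, zero_mul]
    · rw [hgv x h1, mul_zero]
  have a := hzero hpn hpx
  have b := hzero hpn' hpx'
  rw [hpn, hpn', LinearMap.map_sub₂, map_sub, map_sub,
    key p p' hp hp' (fun x hx => (a x hx).1) (fun x hx => (b x hx).1),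
    key p n' hp hn' (fun x hx => (a x hx).1) (fun x hx => (b x hx).2),
    key n p' hn hp' (fun x hx => (a x hx).2) (fun x hx => (b x hx).1),
    key n n' hn hn' (fun x hx => (a x hx).2) (fun x hx => (b x hx).2)]
  ring

/-- `D(Q^(D))` belongs to the kernel of `Q - Q^(N)`. -/
lemma excess_of_mem_dirichlet (hc : ∀ x, G.c x = 0) (hM : Q.IsMarkovian)
    (h₀ : (G.dirichlet m).IsDominated Q) (h₁ : Q.IsDominated (G.neumann m)) {f : Q.domain}
    (hf : (f : Lp ℝ 2 m) ∈ (G.dirichlet m).domain) (g : Q.domain) : excess h₁.le f g = 0 := by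
  obtain ⟨φ, hφ, hlim⟩ := G.exists_formTendsto_of_mem_dirichlet m hf
  have hφD : ∀ n, (φ n : Lp ℝ 2 m) ∈ (G.dirichlet m).domain := fun n =>
    G.mem_dirichlet_of_finite m hc (hφ n)
  let ψ : ℕ → Q.domain := fun n => ⟨φ n, h₀.le (hφD n)⟩
  -- On D(Q^(D)) the energies of Q and Q^(N) agree, so the finitely supported approximation
  -- converges in both form norms.
  have hlimQ : Q.FormTendsto ψ f := by
    rw [formTendsto_iff] at hlim ⊢
    refine ⟨hlim.1.congr fun n => ?_, hlim.2⟩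
    have h1 : excess h₁.le (ψ n - f) (ψ n - f) = 0 :=
      excess_eq_zero_of_dirichlet hc h₀ h₁ (Submodule.sub_mem _ (hφD n) hf)
        (Submodule.sub_mem _ (hφD n) hf)
    rw [excess_apply, sub_eq_zero] at h1
    exact h1.symm
  have h1 : Tendsto (fun n => excess h₁.le (ψ n) g) atTop (𝓝 (excess h₁.le f g)) :=
    (hlimQ.bilin_left g).sub (hlim.bilin_left (Submodule.inclusion h₁.le g))
  refine tendsto_nhds_unique h1 (tendsto_const_nhds.congr fun n => ?_)
  rw [excess_symm, excess_of_finite hc hM h₀ h₁ g (hφ n)]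

end WGraph

/-! ### A Riesz representation theorem for positive functionals on a majorizing space -/

-- The functional induced by I on the range of r is extended positively to C_c(Y) by the theorem of
-- M. Riesz, whose cofinality condition is `hdom`; the Riesz–Markov theorem then gives the measure.
-- Density of the range in C_c(Y) plays no role.
open scoped CompactlySupported in
theorem exists_regular_measure_of_majorizing {Y V : Type*} [TopologicalSpace Y] [T2Space Y]
    [LocallyCompactSpace Y] [MeasurableSpace Y] [BorelSpace Y] [AddCommGroup V] [Module ℝ V]
    (r : V →ₗ[ℝ] C_c(Y, ℝ)) (I : V →ₗ[ℝ] ℝ) (hpos : ∀ v, (∀ y, 0 ≤ r v y) → 0 ≤ I v)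
    (hdom : ∀ φ : C_c(Y, ℝ), ∃ v, ∀ y, φ y ≤ r v y) :
    ∃ ν : Measure Y, ν.Regular ∧ ∀ v, ∫ y, r v y ∂ν = I v := by
  -- The induced functional is given through its graph. Positivity, applied to v and to -v, shows
  -- that I vanishes where r does.
  set Γ : Submodule ℝ (C_c(Y, ℝ) × ℝ) := LinearMap.range (r.prod I) with hΓ
  have hker : ∀ p ∈ Γ, p.1 = 0 → p.2 = 0 := by
    rintro _ ⟨v, rfl⟩ hv
    change r v = 0 at hv
    change I v = 0
    have h1 := hpos v fun y => by rw [hv]; rfl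
    have h2 := hpos (-v) fun y => by rw [map_neg, hv, neg_zero]; rfl
    rw [map_neg] at h2
    linarith
  have : PosSMulMono ℝ C_c(Y, ℝ) :=
    ⟨fun a ha φ ψ h y => mul_le_mul_of_nonneg_left (h y) ha⟩
  have hgraph := Γ.toLinearPMap_graph_eq hker
  obtain ⟨Λ, hΛ, hΛpos⟩ := riesz_extension (PointedCone.positive ℝ C_c(Y, ℝ)) Γ.toLinearPMap
    (fun φ hφ => by
      obtain ⟨v, hv⟩ : ((φ : C_c(Y, ℝ)), Γ.toLinearPMap φ) ∈ Γ := by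
        have := LinearPMap.mem_graph Γ.toLinearPMap φ
        rwa [hgraph] at this
      have hv1 : r v = φ := congrArg Prod.fst hv
      have hv2 : I v = Γ.toLinearPMap φ := congrArg Prod.snd hv
      rw [← hv2]
      refine hpos v fun y => ?_
      rw [hv1]
      exact ((PointedCone.mem_positive ℝ _).1 hφ) y)
    (fun φ => by
      obtain ⟨v, hv⟩ := hdom (-φ)
      have hmem : r v ∈ Γ.toLinearPMap.domain := ⟨(r v, I v), ⟨v, rfl⟩, rfl⟩
      refine ⟨⟨r v, hmem⟩, (PointedCone.mem_positive ℝ _).2 fun y => ?_⟩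
      have h1 : -φ y ≤ r v y := hv y
      change 0 ≤ r v y + φ y
      linarith)
  let Λ' : C_c(Y, ℝ) →ₚ[ℝ] ℝ := PositiveLinearMap.mk₀ Λ fun φ hφ =>
    hΛpos φ ((PointedCone.mem_positive ℝ _).2 hφ)
  refine ⟨RealRMK.rieszMeasure Λ', RealRMK.regular_rieszMeasure Λ', fun v => ?_⟩
  rw [RealRMK.integral_rieszMeasure]
  change Λ (r v) = I v
  have hmem : (r v, I v) ∈ Γ.toLinearPMap.graph := by
    rw [hgraph]
    exact ⟨v, rfl⟩
  obtain ⟨φ, h1, h2⟩ := (LinearPMap.mem_graph_iff _).1 hmem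
  exact (congrArg Λ h1).symm.trans ((hΛ φ).trans h2)

namespace WGraph

open SymForm

variable {X : Type*} [MeasurableSpace X] [DiscreteMeasurableSpace X] {G : WGraph X}
  {m : Measure X} [IsVertexMeasure m] {Q : SymForm (Lp ℝ 2 m)}

/-! ### Plateau functions -/

/-- `g` takes values in `[0, 1]` and equals `1` where `f` does not vanish. -/
structure IsPlateau (f g : Lp ℝ 2 m) : Prop where
  nonneg : ∀ x, 0 ≤ g x
  le_one : ∀ x, g x ≤ 1
  eq_one : ∀ x, f x ≠ 0 → g x = 1

lemma IsPlateau.of_imp {f f' g : Lp ℝ 2 m} (h : IsPlateau f g) (hf : ∀ x, f x = 0 → f' x = 0) :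
    IsPlateau f' g :=
  ⟨h.nonneg, h.le_one, fun x hx => h.eq_one x fun h0 => hx (hf x h0)⟩

lemma IsPlateau.mul_one_sub {f g : Lp ℝ 2 m} (h : IsPlateau f g) (x : X) : f x * (1 - g x) = 0 := by
  by_cases hx : f x = 0
  · rw [hx, zero_mul]
  · rw [h.eq_one x hx, sub_self, mul_zero]

lemma IsPlateau.exists_sup (hM : Q.IsMarkovian) {f₁ f₂ : Lp ℝ 2 m} {g₁ g₂ : Q.domain}
    (h₁ : IsPlateau f₁ (g₁ : Lp ℝ 2 m)) (h₂ : IsPlateau f₂ (g₂ : Lp ℝ 2 m)) :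
    ∃ g : Q.domain, IsPlateau f₁ (g : Lp ℝ 2 m) ∧ IsPlateau f₂ (g : Lp ℝ 2 m) := by
  obtain ⟨p, hp, -⟩ := hM.exists_comp lipschitzWith_max_zero (max_self 0) (g₂ - g₁)
  have hx : ∀ x, ((g₁ + p : Q.domain) : Lp ℝ 2 m) x =
      max ((g₁ : Lp ℝ 2 m) x) ((g₂ : Lp ℝ 2 m) x) := fun x => by
    rw [Submodule.coe_add, lp_add_apply, hp, Submodule.coe_sub, lp_sub_apply, ← max_add_add_left,
      add_sub_cancel, add_zero, max_comm]
  refine ⟨g₁ + p, ⟨fun x => ?_, fun x => ?_, fun x h => ?_⟩, ⟨fun x => ?_, fun x => ?_, fun x h => ?_⟩⟩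
  · rw [hx]
    exact le_max_of_le_left (h₁.nonneg x)
  · rw [hx]
    exact max_le (h₁.le_one x) (h₂.le_one x)
  · rw [hx, h₁.eq_one x h, max_eq_left (h₂.le_one x)]
  · rw [hx]
    exact le_max_of_le_left (h₁.nonneg x)
  · rw [hx]
    exact max_le (h₁.le_one x) (h₂.le_one x)
  · rw [hx, h₂.eq_one x h, max_eq_right (h₁.le_one x)]

/-- The witness min((n + 1)|f|, 1) equals 1 where |f| > 1/(n + 1). This is why cut-offs remove small
values besides truncating large ones. -/
lemma exists_isPlateau_cutOff (hM : Q.IsMarkovian) (f : Q.domain) {n : ℕ} {u : Lp ℝ 2 m}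
    (hu : ∀ x, u x = cutOff n ((f : Lp ℝ 2 m) x)) : ∃ g : Q.domain, IsPlateau u (g : Lp ℝ 2 m) := by
  obtain ⟨a, ha, -⟩ := hM.exists_comp lipschitzWith_abs abs_zero (((n : ℝ) + 1) • f)
  obtain ⟨g, hg, -⟩ := hM.exists_comp (LipschitzWith.id.min_const (1 : ℝ)) (by simp) a
  have hgx : ∀ x, (g : Lp ℝ 2 m) x = min (((n : ℝ) + 1) * |(f : Lp ℝ 2 m) x|) 1 := fun x => by
    rw [hg, id, ha, Submodule.coe_smul, lp_smul_apply, abs_mul, abs_of_nonneg (by positivity)]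
  refine ⟨g, fun x => ?_, fun x => ?_, fun x hx => ?_⟩
  · rw [hgx]
    positivity
  · rw [hgx]
    exact min_le_right _ _
  · rw [hu] at hx
    have h1 := lt_abs_of_cutOff_ne_zero hx
    rw [div_lt_iff₀ (by positivity)] at h1
    rw [hgx]
    exact min_eq_right (by linarith)

/-- The bounded functions in `D(Q)` with a plateau function in `D(Q)`. -/
def plateauDomain (hM : Q.IsMarkovian) : Submodule ℝ Q.domain where
  carrier := {f | (∃ M : ℝ, ∀ x, |(f : Lp ℝ 2 m) x| ≤ M) ∧
    ∃ g : Q.domain, IsPlateau (f : Lp ℝ 2 m) (g : Lp ℝ 2 m)}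
  zero_mem' := by
    have h0 : ∀ x, ((0 : Q.domain) : Lp ℝ 2 m) x = 0 := fun x => by
      rw [Submodule.coe_zero, lp_zero_apply]
    refine ⟨⟨0, fun x => by rw [h0, abs_zero]⟩, 0, fun x => (h0 x).ge, fun x => ?_, fun x hx => ?_⟩
    · rw [h0]
      exact zero_le_one
    · exact absurd (h0 x) hx
  add_mem' := by
    rintro f₁ f₂ ⟨⟨A, hA⟩, g₁, h₁⟩ ⟨⟨B, hB⟩, g₂, h₂⟩
    obtain ⟨g, hg₁, hg₂⟩ := h₁.exists_sup hM h₂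
    refine ⟨⟨A + B, fun x => ?_⟩, g, hg₁.nonneg, hg₁.le_one, fun x hx => ?_⟩
    · rw [Submodule.coe_add, lp_add_apply]
      exact (abs_add_le _ _).trans (add_le_add (hA x) (hB x))
    · by_contra hne
      have e₁ : (f₁ : Lp ℝ 2 m) x = 0 := by
        by_contra h
        exact hne (hg₁.eq_one x h)
      have e₂ : (f₂ : Lp ℝ 2 m) x = 0 := by
        by_contra h
        exact hne (hg₂.eq_one x h)
      exact hx (by rw [Submodule.coe_add, lp_add_apply, e₁, e₂, add_zero])
  smul_mem' := by
    rintro a f ⟨⟨A, hA⟩, g, hg⟩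
    refine ⟨⟨|a| * A, fun x => ?_⟩, g, hg.of_imp fun x hx => ?_⟩
    · rw [Submodule.coe_smul, lp_smul_apply, abs_mul]
      exact mul_le_mul_of_nonneg_left (hA x) (abs_nonneg a)
    · rw [Submodule.coe_smul, lp_smul_apply, hx, mul_zero]

lemma cutOff_mem_plateauDomain (hM : Q.IsMarkovian) (f : Q.domain) {n : ℕ} {u : Q.domain}
    (hu : ∀ x, (u : Lp ℝ 2 m) x = cutOff n ((f : Lp ℝ 2 m) x)) : u ∈ plateauDomain hM :=
  ⟨⟨n, fun x => by rw [hu]; exact abs_cutOff_le n _⟩, exists_isPlateau_cutOff hM f hu⟩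

/-- The functional `f ↦ (Q - Q^(N))(f, 1)`, where `1` is replaced by a plateau function. -/
lemma exists_plateauFunctional (hc : ∀ x, G.c x = 0) (hM : Q.IsMarkovian)
    (h₀ : (G.dirichlet m).IsDominated Q) (h₁ : Q.IsDominated (G.neumann m)) :
    ∃ I : plateauDomain hM →ₗ[ℝ] ℝ, ∀ (f : plateauDomain hM) (g : Q.domain),
      IsPlateau (f : Lp ℝ 2 m) (g : Lp ℝ 2 m) → I f = excess h₁.le f g := by
  choose g hg using fun f : plateauDomain hM => f.2.2
  -- Two plateau functions for f differ by a function disjoint from f, so locality applies.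
  have huniq : ∀ {f k k' : Q.domain}, IsPlateau (f : Lp ℝ 2 m) (k : Lp ℝ 2 m) →
      IsPlateau (f : Lp ℝ 2 m) (k' : Lp ℝ 2 m) → excess h₁.le f k = excess h₁.le f k' := by
    intro f k k' hk hk'
    rw [← sub_eq_zero, ← map_sub]
    refine excess_eq_zero_of_disjoint hc hM h₀ h₁ fun x => ?_
    rw [Submodule.coe_sub, lp_sub_apply]
    linear_combination hk'.mul_one_sub x - hk.mul_one_sub x
  refine ⟨⟨⟨fun f => excess h₁.le f (g f), fun f f' => ?_⟩, fun a f => ?_⟩,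
    fun f k hk => huniq (hg f) hk⟩
  · obtain ⟨k, hk, hk'⟩ := (hg f).exists_sup hM (hg f')
    have e : IsPlateau (((f + f' : plateauDomain hM) : Q.domain) : Lp ℝ 2 m) (k : Lp ℝ 2 m) := by
      refine ⟨hk.nonneg, hk.le_one, fun x hx => ?_⟩
      by_contra hne
      refine hx ?_
      rw [Submodule.coe_add, Submodule.coe_add, lp_add_apply, not_not.1 (mt (hk.eq_one x) hne),
        not_not.1 (mt (hk'.eq_one x) hne), add_zero]
    rw [huniq (hg (f + f')) e, huniq (hg f) hk, huniq (hg f') hk', Submodule.coe_add,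
      LinearMap.map_add₂]
  · have e : IsPlateau (((a • f : plateauDomain hM) : Q.domain) : Lp ℝ 2 m) (g f : Lp ℝ 2 m) :=
      (hg f).of_imp fun x hx => by
        rw [Submodule.coe_smul, Submodule.coe_smul, lp_smul_apply, hx, mul_zero]
    exact (huniq (hg (a • f)) e).trans (LinearMap.map_smul₂ (excess h₁.le) a (f : Q.domain) (g f))

/-! ### The square of a function under the excess form -/

/-- The ideal property applies because 0 ≤ f² ≤ M f. -/
lemma exists_sq_mem (hc : ∀ x, G.c x = 0) (h₁ : Q.IsDominated (G.neumann m)) (f : Q.domain)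
    {M : ℝ} (hf : ∀ x, 0 ≤ (f : Lp ℝ 2 m) x) (hfM : ∀ x, (f : Lp ℝ 2 m) x ≤ M) :
    ∃ s : Q.domain, ∀ x, (s : Lp ℝ 2 m) x = (f : Lp ℝ 2 m) x ^ 2 := by
  have hb : ∀ x, |(f : Lp ℝ 2 m) x| ≤ M := fun x => by
    rw [abs_of_nonneg (hf x)]
    exact hfM x
  obtain ⟨s, hs, hsx⟩ := G.exists_mul_mem_neumann m hc (h₁.le f.2) (h₁.le f.2) hb hb
  refine ⟨⟨s, h₁.ideal s hs _ (Q.domain.smul_mem M f.2) (nonneg_iff.2 fun x => ?_)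
    (le_iff.2 fun x => ?_)⟩, fun x => ?_⟩
  · rw [hsx]
    exact mul_self_nonneg _
  · rw [hsx, lp_smul_apply]
    exact mul_le_mul_of_nonneg_right (hfM x) (hf x)
  · change s x = _
    rw [hsx, sq]

/-- Bisection of the range. For k = 0 both terms lie between 0 and M q(f, g). For the step, split f
= u + v with u = min(f, M/2) and v = (f - M/2)⁺. Where v ≠ 0, u equals M/2, so locality gives q(u,
v) = (M/2) q(v, g), while f² = u² + M v + v² pointwise. The cross terms cancel and the error is the
sum of the errors of u and v, whose bound M/2 is halved. -/
lemma abs_excess_sub_excess_sq_le (hc : ∀ x, G.c x = 0) (hM : Q.IsMarkovian)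
    (h₀ : (G.dirichlet m).IsDominated Q) (h₁ : Q.IsDominated (G.neumann m)) (k : ℕ) :
    ∀ {f g s : Q.domain} {M : ℝ}, (∀ x, 0 ≤ (f : Lp ℝ 2 m) x) → (∀ x, (f : Lp ℝ 2 m) x ≤ M) →
      0 ≤ M → IsPlateau (f : Lp ℝ 2 m) (g : Lp ℝ 2 m) →
      (∀ x, (s : Lp ℝ 2 m) x = (f : Lp ℝ 2 m) x ^ 2) →
      |excess h₁.le f f - excess h₁.le s g| ≤ M / 2 ^ k * excess h₁.le f g := by
  induction k with
  | zero =>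
    intro f g s M hf hfM hM0 hg hs
    have g0 : 0 ≤ (g : Lp ℝ 2 m) := nonneg_iff.2 hg.nonneg
    have e1 : 0 ≤ excess h₁.le f f := excess_nonneg h₁ (nonneg_iff.2 hf) (nonneg_iff.2 hf)
    have e2 : 0 ≤ excess h₁.le s g := excess_nonneg h₁ (nonneg_iff.2 fun x => by
      rw [hs]; positivity) g0
    have e3 : 0 ≤ excess h₁.le f (M • g - f) := by
      refine excess_nonneg h₁ (nonneg_iff.2 hf) (nonneg_iff.2 fun x => ?_)
      rw [Submodule.coe_sub, lp_sub_apply, Submodule.coe_smul, lp_smul_apply]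
      by_cases hx : (f : Lp ℝ 2 m) x = 0
      · rw [hx, sub_zero]
        exact mul_nonneg hM0 (hg.nonneg x)
      · rw [hg.eq_one x hx]
        linarith [hfM x]
    have e4 : 0 ≤ excess h₁.le (M • f - s) g := by
      refine excess_nonneg h₁ (nonneg_iff.2 fun x => ?_) g0
      rw [Submodule.coe_sub, lp_sub_apply, Submodule.coe_smul, lp_smul_apply, hs]
      nlinarith [hf x, hfM x]
    rw [map_sub, map_smul, smul_eq_mul] at e3
    rw [LinearMap.map_sub₂, LinearMap.map_smul₂, smul_eq_mul] at e4
    rw [pow_zero, div_one, abs_le]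
    constructor <;> linarith
  | succ k ih =>
    intro f g s M hf hfM hM0 hg hs
    have hCl : LipschitzWith 1 fun t : ℝ => max (t - M / 2) 0 := by
      have h : LipschitzWith 1 fun t : ℝ => t - M / 2 :=
        LipschitzWith.of_dist_le_mul fun s t => by simp [Real.dist_eq]
      exact h.max_const 0
    obtain ⟨v, hv, -⟩ := hM.exists_comp hCl (by rw [max_eq_right]; linarith) f
    have hu : ∀ x, ((f - v : Q.domain) : Lp ℝ 2 m) x = min ((f : Lp ℝ 2 m) x) (M / 2) := fun x => by
      rw [Submodule.coe_sub, lp_sub_apply, hv]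
      rcases le_total ((f : Lp ℝ 2 m) x) (M / 2) with h | h
      · rw [max_eq_right (by linarith), min_eq_left h, sub_zero]
      · rw [max_eq_left (by linarith), min_eq_right h]
        ring
    set u := f - v with hudef
    have hfuv : f = u + v := by rw [hudef, sub_add_cancel]
    have hu0 : ∀ x, 0 ≤ (u : Lp ℝ 2 m) x := fun x => by
      rw [hu]
      exact le_min (hf x) (by linarith)
    have huM : ∀ x, (u : Lp ℝ 2 m) x ≤ M / 2 := fun x => by
      rw [hu]
      exact min_le_right _ _
    have hv0 : ∀ x, 0 ≤ (v : Lp ℝ 2 m) x := fun x => by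
      rw [hv]
      exact le_max_right _ _
    have hvM : ∀ x, (v : Lp ℝ 2 m) x ≤ M / 2 := fun x => by
      rw [hv]
      exact max_le (by linarith [hfM x]) (by linarith)
    have hgu : IsPlateau (u : Lp ℝ 2 m) (g : Lp ℝ 2 m) := hg.of_imp fun x hx => by
      rw [hu, hx]
      exact min_eq_left (by linarith)
    have hgv : IsPlateau (v : Lp ℝ 2 m) (g : Lp ℝ 2 m) := hg.of_imp fun x hx => by
      rw [hv, hx]
      exact max_eq_right (by linarith)
    have huv : ∀ x, (v : Lp ℝ 2 m) x ≠ 0 → (u : Lp ℝ 2 m) x = M / 2 := fun x hx => by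
      rw [hu]
      rw [hv] at hx
      refine min_eq_right ?_
      by_contra! h
      exact hx (max_eq_right (by linarith))
    obtain ⟨su, hsu⟩ := exists_sq_mem hc h₁ u hu0 huM
    obtain ⟨sv, hsv⟩ := exists_sq_mem hc h₁ v hv0 hvM
    have hloc : excess h₁.le u v = M / 2 * excess h₁.le v g := by
      have : excess h₁.le (u - (M / 2) • g) v = 0 := by
        refine excess_eq_zero_of_disjoint hc hM h₀ h₁ fun x => ?_
        by_cases hx : (v : Lp ℝ 2 m) x = 0
        · rw [hx, mul_zero]
        · rw [Submodule.coe_sub, lp_sub_apply, Submodule.coe_smul, lp_smul_apply, huv x hx,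
            hgv.eq_one x hx, mul_one, sub_self, zero_mul]
      rw [LinearMap.map_sub₂, LinearMap.map_smul₂, smul_eq_mul, sub_eq_zero] at this
      rw [this, excess_symm]
    have hsplit : s = su + M • v + sv := domain_ext fun x => by
      have e : (f : Lp ℝ 2 m) x = (u : Lp ℝ 2 m) x + (v : Lp ℝ 2 m) x := by
        rw [hfuv, Submodule.coe_add, lp_add_apply]
      rw [Submodule.coe_add, lp_add_apply, Submodule.coe_add, lp_add_apply, Submodule.coe_smul,
        lp_smul_apply, hs, hsu, hsv, e]
      by_cases hx : (v : Lp ℝ 2 m) x = 0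
      · rw [hx]
        ring
      · rw [huv x hx]
        ring
    have i1 := ih hu0 huM (by linarith) hgu hsu
    have i2 := ih hv0 hvM (by linarith) hgv hsv
    have e1 : excess h₁.le f f - excess h₁.le s g =
        (excess h₁.le u u - excess h₁.le su g) + (excess h₁.le v v - excess h₁.le sv g) := by
      rw [hsplit, hfuv]
      simp only [map_add, LinearMap.add_apply, LinearMap.map_smul₂, smul_eq_mul]
      rw [excess_symm h₁.le v u, hloc]
      ring
    have e2 : excess h₁.le f g = excess h₁.le u g + excess h₁.le v g := by
      rw [hfuv, LinearMap.map_add₂]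
    rw [e1, e2, pow_succ]
    refine (abs_add_le _ _).trans ((add_le_add i1 i2).trans_eq ?_)
    field_simp

lemma excess_self_eq_of_nonneg (hc : ∀ x, G.c x = 0) (hM : Q.IsMarkovian)
    (h₀ : (G.dirichlet m).IsDominated Q) (h₁ : Q.IsDominated (G.neumann m)) {f g s : Q.domain}
    {M : ℝ} (hf : ∀ x, 0 ≤ (f : Lp ℝ 2 m) x) (hfM : ∀ x, (f : Lp ℝ 2 m) x ≤ M)
    (hg : IsPlateau (f : Lp ℝ 2 m) (g : Lp ℝ 2 m))
    (hs : ∀ x, (s : Lp ℝ 2 m) x = (f : Lp ℝ 2 m) x ^ 2) :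
    excess h₁.le f f = excess h₁.le s g := by
  have hlim : Tendsto (fun k : ℕ => max M 0 / 2 ^ k * excess h₁.le f g) atTop (𝓝 0) := by
    have h1 := (tendsto_pow_atTop_nhds_zero_of_lt_one (r := (1 / 2 : ℝ)) (by norm_num)
      (by norm_num)).const_mul (max M 0 * excess h₁.le f g)
    rw [mul_zero] at h1
    refine h1.congr fun k => ?_
    rw [one_div, inv_pow]
    ring
  have h2 := ge_of_tendsto' hlim fun k => abs_excess_sub_excess_sq_le hc hM h₀ h₁ k hf
    (fun x => (hfM x).trans (le_max_left _ _)) (le_max_right _ _) hg hs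
  exact sub_eq_zero.1 (abs_nonpos_iff.1 h2)

/-- `(Q - Q^(N))(f, f) = (Q - Q^(N))(f², 1)`, where `1` is replaced by a plateau function. -/
lemma exists_excess_self_eq (hc : ∀ x, G.c x = 0) (hM : Q.IsMarkovian)
    (h₀ : (G.dirichlet m).IsDominated Q) (h₁ : Q.IsDominated (G.neumann m)) {f g : Q.domain}
    {M : ℝ} (hfM : ∀ x, |(f : Lp ℝ 2 m) x| ≤ M) (hg : IsPlateau (f : Lp ℝ 2 m) (g : Lp ℝ 2 m)) :
    ∃ s : Q.domain, (∀ x, (s : Lp ℝ 2 m) x = (f : Lp ℝ 2 m) x ^ 2) ∧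
      excess h₁.le f f = excess h₁.le s g := by
  obtain ⟨p, n, hpn, hp, hn, hpx, hpn0⟩ := hM.exists_pos_sub_neg f
  have hp0 := nonneg_iff.1 hp
  have hn0 := nonneg_iff.1 hn
  have hfx : ∀ x, (f : Lp ℝ 2 m) x = (p : Lp ℝ 2 m) x - (n : Lp ℝ 2 m) x := fun x => by
    rw [hpn, Submodule.coe_sub, lp_sub_apply]
  have hbd : ∀ x, (p : Lp ℝ 2 m) x ≤ |(f : Lp ℝ 2 m) x| ∧ (n : Lp ℝ 2 m) x ≤ |(f : Lp ℝ 2 m) x| :=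
    fun x => by
      rcases mul_eq_zero.1 (hpn0 x) with h | h
      · have e := hfx x
        rw [h, zero_sub] at e
        rw [h, e, abs_neg]
        exact ⟨abs_nonneg _, le_abs_self _⟩
      · have e := hfx x
        rw [h, sub_zero] at e
        rw [h, e]
        exact ⟨le_abs_self _, abs_nonneg _⟩
  have hgp : IsPlateau (p : Lp ℝ 2 m) (g : Lp ℝ 2 m) := hg.of_imp fun x hx =>
    le_antisymm ((hbd x).1.trans_eq (by rw [hx, abs_zero])) (hp0 x)
  have hgn : IsPlateau (n : Lp ℝ 2 m) (g : Lp ℝ 2 m) := hg.of_imp fun x hx =>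
    le_antisymm ((hbd x).2.trans_eq (by rw [hx, abs_zero])) (hn0 x)
  have hpM := fun x => (hbd x).1.trans (hfM x)
  have hnM := fun x => (hbd x).2.trans (hfM x)
  obtain ⟨sp, hsp⟩ := exists_sq_mem hc h₁ p hp0 hpM
  obtain ⟨sn, hsn⟩ := exists_sq_mem hc h₁ n hn0 hnM
  refine ⟨sp + sn, fun x => ?_, ?_⟩
  · rw [Submodule.coe_add, lp_add_apply, hsp, hsn, hfx]
    linear_combination 2 * hpn0 x
  · rw [LinearMap.map_add₂, ← excess_self_eq_of_nonneg hc hM h₀ h₁ hp0 hpM hgp hsp,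
      ← excess_self_eq_of_nonneg hc hM h₀ h₁ hn0 hnM hgn hsn, hpn, map_sub, LinearMap.map_sub₂,
      LinearMap.map_sub₂, excess_symm h₁.le n p, excess_eq_zero_of_disjoint hc hM h₀ h₁ hpn0]
    ring

end WGraph

namespace WGraph

open SymForm

variable {X : Type*} [MeasurableSpace X] [DiscreteMeasurableSpace X] {G : WGraph X}
  {m : Measure X} [IsVertexMeasure m] {Q : SymForm (Lp ℝ 2 m)}

/-! ### The boundary measure of a sandwiched form -/

/-- The points of `∂X` at which all bounded functions in `D(Q)` vanish. -/
def zeroSet (G : WGraph X) (Q : SymForm (Lp ℝ 2 m)) : Set (Royden G m) :=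
  {ω ∈ boundary G m | ∀ f ∈ Q.domain, IsBdd G m f → bval G m f ω = 0}

lemma isClosed_zeroSet (hc : ∀ x, G.c x = 0) (Q : SymForm (Lp ℝ 2 m)) :
    IsClosed (zeroSet G Q) := by
  have : zeroSet G Q = boundary G m ∩ ⋂ (f : Lp ℝ 2 m) (_ : f ∈ Q.domain) (_ : IsBdd G m f),
      {ω | bval G m f ω = 0} := by
    ext ω
    simp only [zeroSet, mem_inter_iff, mem_iInter]
    rfl
  rw [this]
  refine (isClosed_boundary hc).inter (isClosed_iInter fun f => isClosed_iInter fun _ =>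
    isClosed_iInter fun hf => ?_)
  exact isClosed_eq hf.continuous_bval continuous_const

lemma locallyCompactSpace_boundary_diff (hc : ∀ x, G.c x = 0) {F : Set (Royden G m)}
    (hF : IsClosed F) : LocallyCompactSpace ↥(boundary G m \ F) := by
  refine IsLocallyClosed.locallyCompactSpace ?_
  exact (isClosed_boundary hc).isLocallyClosed.inter hF.isOpen_compl.isLocallyClosed

lemma isBdd_of_mem_plateauDomain {hM : Q.IsMarkovian} (hle : Q.domain ≤ (G.neumann m).domain)
    (f : plateauDomain hM) : IsBdd G m (f : Lp ℝ 2 m) := ⟨hle f.1.2, f.2.1⟩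

lemma IsPlateau.isBdd {f g : Lp ℝ 2 m} (h : IsPlateau f g) (hg : g ∈ (G.neumann m).domain) :
    IsBdd G m g :=
  ⟨hg, 1, fun x => by
    rw [abs_of_nonneg (h.nonneg x)]
    exact h.le_one x⟩

/-- The extension of f vanishes off {g = 1} by continuity. The part of this set in ∂X is compact and
avoids the zero set, because g itself lies in D(Q). -/
lemma hasCompactSupport_bval (hc : ∀ x, G.c x = 0) {f g : Lp ℝ 2 m} (hf : IsBdd G m f)
    (hg : IsBdd G m g) (hgQ : g ∈ Q.domain) (h : IsPlateau f g) :
    HasCompactSupport fun y : ↥(boundary G m \ zeroSet G Q) => bval G m f y.1 := by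
  refine HasCompactSupport.intro (K := Subtype.val ⁻¹' (boundary G m ∩ {ω | bval G m g ω = 1})) ?_ ?_
  · rw [Topology.IsInducing.subtypeVal.isCompact_preimage_iff]
    · exact ((isClosed_boundary hc).inter
        (isClosed_eq hg.continuous_bval continuous_const)).isCompact
    · rw [Subtype.range_val]
      rintro ω ⟨h1, h2⟩
      refine ⟨h1, fun h3 => ?_⟩
      have h4 : bval G m g ω = 1 := h2
      rw [h3.2 g hgQ hg] at h4
      exact zero_ne_one h4
  · intro y hy
    have h1 : bval G m (0 : Lp ℝ 2 m) y.1 = bval G m f y.1 * (1 - bval G m g y.1) :=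
      hf.bval_comp₂ hg (φ := fun p => p.1 * (1 - p.2)) (by fun_prop)
        (fun x => by rw [lp_zero_apply, h.mul_one_sub x]) y.1
    have h0 : bval G m (0 : Lp ℝ 2 m) y.1 = 0 := bval_of_tendsto (by
      rw [coe_zero]
      exact tendsto_const_nhds)
    rw [h0] at h1
    rcases mul_eq_zero.1 h1.symm with h2 | h2
    · exact h2
    · exact absurd ⟨y.2.1, (sub_eq_zero.1 h2).symm⟩ hy

open scoped CompactlySupported in
/-- Restriction of functions in `plateauDomain` to `∂X`. -/
lemma exists_restriction (hc : ∀ x, G.c x = 0) (hM : Q.IsMarkovian)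
    (hle : Q.domain ≤ (G.neumann m).domain) :
    ∃ r : plateauDomain hM →ₗ[ℝ] C_c(↥(boundary G m \ zeroSet G Q), ℝ),
      ∀ f y, r f y = bval G m (f : Lp ℝ 2 m) y.1 := by
  have hb := isBdd_of_mem_plateauDomain (G := G) (hM := hM) hle
  refine ⟨⟨⟨fun f => ⟨⟨fun y => bval G m (f : Lp ℝ 2 m) y.1,
    (hb f).continuous_bval.comp continuous_subtype_val⟩, ?_⟩, fun f f' => ?_⟩, fun a f => ?_⟩,
    fun f y => rfl⟩
  · obtain ⟨g, hg⟩ := f.2.2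
    exact hasCompactSupport_bval hc (hb f) (hg.isBdd (hle g.2)) g.2 hg
  · ext y
    exact (hb f).bval_add (hb f') y.1
  · ext y
    exact (hb f).bval_smul a y.1

lemma excess_self_nonneg (hc : ∀ x, G.c x = 0) (hM : Q.IsMarkovian)
    (h₀ : (G.dirichlet m).IsDominated Q) (h₁ : Q.IsDominated (G.neumann m)) (f : Q.domain) :
    0 ≤ excess h₁.le f f := by
  obtain ⟨p, n, hpn, hp, hn, -, hpn0⟩ := hM.exists_pos_sub_neg f
  have h1 := excess_nonneg h₁ hp hp
  have h2 := excess_nonneg h₁ hn hn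
  rw [hpn, map_sub, LinearMap.map_sub₂, LinearMap.map_sub₂, excess_symm h₁.le n p,
    excess_eq_zero_of_disjoint hc hM h₀ h₁ hpn0]
  linarith

/-- The passage from X to ∂X: the negative part of f vanishes on ∂X, hence lies in D(Q^(D)), which q
annihilates. -/
lemma excess_nonneg_of_bval_nonneg (hc : ∀ x, G.c x = 0) (hM : Q.IsMarkovian)
    (h₀ : (G.dirichlet m).IsDominated Q) (h₁ : Q.IsDominated (G.neumann m)) {f g : Q.domain}
    (hf : IsBdd G m (f : Lp ℝ 2 m)) (hg : 0 ≤ (g : Lp ℝ 2 m))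
    (h : ∀ ω ∈ boundary G m, 0 ≤ bval G m (f : Lp ℝ 2 m) ω) : 0 ≤ excess h₁.le f g := by
  obtain ⟨p, n, hpn, hp, hn, hpx, -⟩ := hM.exists_pos_sub_neg f
  have hnx : ∀ x, (n : Lp ℝ 2 m) x = max (-(f : Lp ℝ 2 m) x) 0 := fun x => by
    have e : (f : Lp ℝ 2 m) x = (p : Lp ℝ 2 m) x - (n : Lp ℝ 2 m) x := by
      rw [hpn, Submodule.coe_sub, lp_sub_apply]
    have e2 := hpx x
    rcases le_total ((f : Lp ℝ 2 m) x) 0 with h | h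
    · rw [max_eq_right h] at e2
      rw [max_eq_left (by linarith)]
      linarith
    · rw [max_eq_left h] at e2
      rw [max_eq_right (by linarith)]
      linarith
  have hnb : IsBdd G m (n : Lp ℝ 2 m) := IsBdd.of_abs_le (h₁.le n.2) hf fun x => by
    rw [hnx, abs_of_nonneg (le_max_right _ _)]
    exact max_le (neg_le_abs _) (abs_nonneg _)
  have hnD : (n : Lp ℝ 2 m) ∈ (G.dirichlet m).domain :=
    mem_dirichlet_of_bval_eq_zero hc hnb fun ω hω => by
      rw [hf.bval_comp (φ := fun t => max (-t) 0) (by fun_prop) hnx ω]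
      exact max_eq_right (neg_nonpos.2 (h ω hω))
  rw [hpn, LinearMap.map_sub₂, excess_of_mem_dirichlet hc hM h₀ h₁ hnD, sub_zero]
  exact excess_nonneg h₁ hp hg

/-- The measure represents I on the restrictions of plateau-domain functions; the identity q(f, f) =
I(f²) then turns it into the density-free formula for the quadratic form. -/
lemma exists_boundary_measure (hc : ∀ x, G.c x = 0) (hM : Q.IsMarkovian)
    (h₀ : (G.dirichlet m).IsDominated Q) (h₁ : Q.IsDominated (G.neumann m)) :
    ∃ ν : Measure ↥(boundary G m \ zeroSet G Q), ν.Regular ∧ ∀ f ∈ plateauDomain hM,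
      ∫⁻ y, ENNReal.ofReal (bval G m (f : Lp ℝ 2 m) y.1 ^ 2) ∂ν =
        ENNReal.ofReal (excess h₁.le f f) := by
  have := locallyCompactSpace_boundary_diff hc (isClosed_zeroSet hc Q)
  obtain ⟨I, hI⟩ := exists_plateauFunctional hc hM h₀ h₁
  obtain ⟨r, hr⟩ := exists_restriction hc hM h₁.le
  have hb := isBdd_of_mem_plateauDomain (G := G) (hM := hM) h₁.le
  obtain ⟨ν, hν, hint⟩ := exists_regular_measure_of_majorizing r I
    (fun f hf => by
      obtain ⟨g, hg⟩ := f.2.2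
      rw [hI f g hg]
      refine excess_nonneg_of_bval_nonneg hc hM h₀ h₁ (hb f) (nonneg_iff.2 hg.nonneg) fun ω hω => ?_
      by_cases hF : ω ∈ zeroSet G Q
      · exact (hF.2 _ f.1.2 (hb f)).ge
      · have := hf ⟨ω, hω, hF⟩
        rwa [hr] at this)
    (fun φ => by
      have hK : IsCompact (Subtype.val '' tsupport φ) :=
        φ.hasCompactSupport.isCompact.image continuous_subtype_val
      obtain ⟨h, hhQ, hhb, hh0, hh1⟩ := exists_one_le_bval hM h₁.le hK (by
        rintro _ ⟨y, -, rfl⟩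
        by_contra! hcon
        exact y.2.2 ⟨y.2.1, hcon⟩)
      obtain ⟨C, hC⟩ := φ.hasCompactSupport.exists_bound_of_continuous φ.continuous
      obtain ⟨u, hu, -⟩ := hM.exists_comp (lipschitzWith_cutOff 1) (cutOff_zero 1) ⟨h, hhQ⟩
      have huV : u ∈ plateauDomain hM := cutOff_mem_plateauDomain hM ⟨h, hhQ⟩ hu
      -- On the support of φ one has h ≥ 1, hence `cutOff 1 h` ≥ 1/2; the factor 2 compensates for
      -- this and |C| bounds φ.
      refine ⟨(2 * |C|) • ⟨u, huV⟩, fun y => ?_⟩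
      have hbu : bval G m (u : Lp ℝ 2 m) y.1 = cutOff 1 (bval G m h y.1) :=
        hhb.bval_comp (lipschitzWith_cutOff 1).continuous hu y.1
      rw [hr, Submodule.coe_smul, Submodule.coe_smul, (hb ⟨u, huV⟩).bval_smul, hbu]
      have h0 : 0 ≤ cutOff 1 (bval G m h y.1) := cutOff_nonneg (hhb.bval_nonneg hh0 y.1)
      by_cases hy : y ∈ tsupport φ
      · have h2 : 1 ≤ bval G m h y.1 := hh1 _ ⟨y, hy, rfl⟩
        have h3 : 1 / 2 ≤ cutOff 1 (bval G m h y.1) := by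
          rw [← abs_of_nonneg h0, abs_cutOff, abs_of_nonneg (by linarith)]
          refine le_min (le_max_of_le_left ?_) (by norm_num)
          norm_num
          linarith
        have h4 : φ y ≤ |C| := (le_abs_self _).trans ((hC y).trans (le_abs_self C))
        nlinarith [abs_nonneg C]
      · rw [image_eq_zero_of_notMem_tsupport hy]
        positivity)
  refine ⟨ν, hν, fun f hf => ?_⟩
  obtain ⟨⟨M, hfM⟩, g, hg⟩ := hf
  obtain ⟨s, hs, hsq⟩ := exists_excess_self_eq hc hM h₀ h₁ hfM hg
  have hgs : IsPlateau (s : Lp ℝ 2 m) (g : Lp ℝ 2 m) := hg.of_imp fun x hx => by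
    rw [hs, hx, zero_pow two_ne_zero]
  have hsV : s ∈ plateauDomain hM := ⟨⟨M ^ 2, fun x => by
    rw [hs, abs_pow]
    exact pow_le_pow_left₀ (abs_nonneg _) (hfM x) 2⟩, g, hgs⟩
  have hbf : IsBdd G m (f : Lp ℝ 2 m) := ⟨h₁.le f.2, M, hfM⟩
  have hsb : ∀ y : ↥(boundary G m \ zeroSet G Q),
      r ⟨s, hsV⟩ y = bval G m (f : Lp ℝ 2 m) y.1 ^ 2 := fun y => by
    rw [hr]
    exact hbf.bval_comp (φ := fun t => t ^ 2) (by fun_prop) hs y.1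
  rw [hsq, ← hI ⟨s, hsV⟩ g hgs, ← hint]
  rw [ofReal_integral_eq_lintegral_ofReal]
  · simp only [hsb]
  · exact (r ⟨s, hsV⟩).continuous.integrable_of_hasCompactSupport (r ⟨s, hsV⟩).hasCompactSupport
  · exact Eventually.of_forall fun y => by
      change 0 ≤ r ⟨s, hsV⟩ y
      rw [hsb]
      positivity

/-- The boundary integral as a supremum over the cut-offs. -/
lemma boundaryIntegral_eq_iSup (hc : ∀ x, G.c x = 0) {F : Set (Royden G m)}
    (ν : Measure ↥(boundary G m \ F)) {f : Lp ℝ 2 m} (hf : f ∈ (G.neumann m).domain) :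
    boundaryIntegral G m ν f =
      ⨆ n : ℕ, ∫⁻ y, ENNReal.ofReal (bval G m (fun x => cutOff n (f x)) y.1 ^ 2) ∂ν := by
  choose u hu hux using fun n => isBdd_cutOff hc hf n
  have hfun : ∀ n, (fun x => cutOff n (f x)) = u n := fun n => (funext (hux n)).symm
  have h1 : ∀ ω : Royden G m, (extend G m f ω).abs ^ 2 =
      ⨆ n : ℕ, ENNReal.ofReal (bval G m (fun x => cutOff n (f x)) ω ^ 2) := fun ω => by
    rw [abs_extend_eq_iSup hc hf, ENNReal.iSup_pow]
    simp only [← ENNReal.ofReal_pow (abs_nonneg _), sq_abs]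
  simp only [boundaryIntegral, h1]
  refine lintegral_iSup (fun n => ?_) (fun i j hij y => ?_)
  · rw [hfun]
    exact (((hu n).continuous_bval.comp continuous_subtype_val).pow 2).measurable.ennreal_ofReal
  · refine ENNReal.ofReal_le_ofReal ?_
    rw [hfun, hfun]
    refine sq_le_sq.2 ?_
    exact le_of_tendsto_of_tendsto' ((hu i).tendsto_bval y.1).abs ((hu j).tendsto_bval y.1).abs
      fun x => by
        rw [hux, hux]
        exact abs_cutOff_mono _ hij

/-- The formula is known for cut-offs, which have plateau functions. The integrals converge
monotonically, and q converges because the cut-offs converge in both form norms. -/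
lemma boundaryIntegral_of_mem (hc : ∀ x, G.c x = 0) (hQ : Q.IsDirichletForm)
    (h₁ : Q.IsDominated (G.neumann m)) {ν : Measure ↥(boundary G m \ zeroSet G Q)}
    (hν : ∀ f ∈ plateauDomain hQ.markovian,
      ∫⁻ y, ENNReal.ofReal (bval G m (f : Lp ℝ 2 m) y.1 ^ 2) ∂ν =
        ENNReal.ofReal (excess h₁.le f f)) (f : Q.domain) :
    boundaryIntegral G m ν (f : Lp ℝ 2 m) = ENNReal.ofReal (excess h₁.le f f) := by
  obtain ⟨u, hu, hle, hlim⟩ := hQ.exists_cutOff f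
  -- Convergence for Q^(N) is proved separately: cut-offs are normal contractions for Q^(N) too, and
  -- they converge in ℓ².
  have hlimN : (G.neumann m).FormTendsto (fun n => Submodule.inclusion h₁.le (u n))
      (Submodule.inclusion h₁.le f) := by
    refine (G.neumann_isClosedForm m hc).formTendsto_of_le hlim.tendsto fun n => ?_
    obtain ⟨w, hw, hwle⟩ := (G.neumann_isMarkovian m hc).exists_comp (lipschitzWith_cutOff n)
      (cutOff_zero n) (Submodule.inclusion h₁.le f)
    have : w = Submodule.inclusion h₁.le (u n) := domain_ext fun x => (hw x).trans (hu n x).symm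
    rwa [← this]
  have hq : Tendsto (fun n => excess h₁.le (u n) (u n)) atTop (𝓝 (excess h₁.le f f)) :=
    hlim.bilin_self.sub hlimN.bilin_self
  have hterm : ∀ n : ℕ, ∫⁻ y, ENNReal.ofReal
      (bval G m (fun x => cutOff n ((f : Lp ℝ 2 m) x)) y.1 ^ 2) ∂ν =
        ENNReal.ofReal (excess h₁.le (u n) (u n)) := fun n => by
    rw [← hν (u n) (cutOff_mem_plateauDomain hQ.markovian f (hu n))]
    rw [show (fun x => cutOff n ((f : Lp ℝ 2 m) x)) = (u n : Lp ℝ 2 m) from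
      (funext (hu n)).symm]
  rw [boundaryIntegral_eq_iSup hc ν (h₁.le f.2)]
  refine tendsto_nhds_unique (tendsto_atTop_iSup fun i j hij => ?_)
    ((ENNReal.tendsto_ofReal hq).congr fun n => (hterm n).symm)
  refine lintegral_mono fun y => ENNReal.ofReal_le_ofReal ?_
  have hub : ∀ n, IsBdd G m (u n : Lp ℝ 2 m) := fun n =>
    ⟨h₁.le (u n).2, n, fun x => by rw [hu]; exact abs_cutOff_le n _⟩
  have hfun : ∀ n, (fun x => cutOff n ((f : Lp ℝ 2 m) x)) = (u n : Lp ℝ 2 m) := fun n =>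
    (funext (hu n)).symm
  rw [hfun, hfun]
  refine sq_le_sq.2 ?_
  exact le_of_tendsto_of_tendsto' ((hub i).tendsto_bval y.1).abs ((hub j).tendsto_bval y.1).abs
    fun x => by
      rw [hu, hu]
      exact abs_cutOff_mono _ hij

/-- Truncations of functions that vanish on the zero set of `D(Q)` belong to `D(Q)`. -/
lemma cutOff_mem_of_extend_eq_zero (hc : ∀ x, G.c x = 0) (hM : Q.IsMarkovian)
    (h₀ : (G.dirichlet m).IsDominated Q) (h₁ : Q.IsDominated (G.neumann m)) {f : Lp ℝ 2 m}
    (hf : f ∈ (G.neumann m).domain) (h0 : ∀ ω ∈ zeroSet G Q, extend G m f ω = 0) {n : ℕ}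
    {u : Lp ℝ 2 m} (hu : u ∈ (G.neumann m).domain) (hux : ∀ x, u x = cutOff n (f x)) :
    u ∈ Q.domain := by
  obtain ⟨w, hw, hwx⟩ := isBdd_cutOff hc hf (n + 1)
  have hub : IsBdd G m u := ⟨hu, n, fun x => by rw [hux]; exact abs_cutOff_le n _⟩
  set K : Set (Royden G m) := boundary G m ∩ {ω | cutOffGap n ≤ |bval G m w ω|} with hK
  have hKc : IsCompact K := ((isClosed_boundary hc).inter
    (isClosed_le continuous_const hw.continuous_bval.abs)).isCompact
  obtain ⟨h, hhQ, hhb, hh0, hh1⟩ := exists_one_le_bval hM h₁.le hKc (by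
    rintro ω ⟨hω, hω'⟩
    by_contra! hcon
    have h1 := (extend_eq_zero_iff hc hf ω).1 (h0 ω ⟨hω, hcon⟩) (n + 1)
    rw [show (fun x => cutOff (n + 1) (f x)) = w from (funext hwx).symm] at h1
    have h2 : cutOffGap n ≤ |bval G m w ω| := hω'
    rw [h1, abs_zero] at h2
    exact (cutOffGap_pos n).not_ge h2)
  have hnh : ((n : ℝ) • h) ∈ Q.domain := Q.domain.smul_mem _ hhQ
  have hnhx : ∀ x, ((n : ℝ) • h) x = n * h x := lp_smul_apply _ _
  have hnh0 : ∀ x, 0 ≤ ((n : ℝ) • h) x := fun x => by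
    rw [hnhx]
    exact mul_nonneg (Nat.cast_nonneg n) (nonneg_iff.1 hh0 x)
  -- The function v is u clamped to [-n h, n h]. It lies in D(Q) by the ideal property; what remains
  -- is to see that u - v vanishes on ∂X.
  obtain ⟨v, hv⟩ := exists_lp_of_abs_le u
    (g := fun x => max (-|((n : ℝ) • h) x|) (min (u x) |((n : ℝ) • h) x|)) (C := 1) fun x => by
      rw [one_mul]
      rw [abs_le]
      constructor
      · exact le_max_of_le_right (le_min (neg_abs_le _)
          ((neg_nonpos.2 (abs_nonneg _)).trans (abs_nonneg _)))
      · exact max_le ((neg_nonpos.2 (abs_nonneg _)).trans (abs_nonneg _))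
          ((min_le_left _ _).trans (le_abs_self _))
  have hvN : v ∈ (G.neumann m).domain :=
    (G.finiteEnergy_of_abs_sub_le hc hu (h₁.le hnh) (u := v) (A := 1) (B := 1) fun x y => by
      rw [hv, hv]
      exact abs_clamp_sub_clamp_le _ _ _ _).1
  have hvQ : v ∈ Q.domain := h₁.mem_of_abs_le (G.neumann_isMarkovian m hc) hvN hnh fun x => by
    rw [hv]
    refine (abs_clamp_le _ _).trans_eq ?_
    exact abs_of_nonneg (hnh0 x)
  have hvb : IsBdd G m v := IsBdd.of_abs_le hvN (hhb.smul n) fun x => by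
    rw [hv]
    exact abs_clamp_le _ _
  -- On K the bound n h ≥ n ≥ |u| makes the clamp inactive. At boundary points off K the next
  -- cut-off is below the gap nearby, so u vanishes near the point and so does v.
  have hdD : u - v ∈ (G.dirichlet m).domain :=
    mem_dirichlet_of_bval_eq_zero hc (hub.sub hvb) fun ω hω => by
      rw [hub.bval_sub hvb, hub.bval_comp₂ (hhb.smul n)
        (φ := fun p => max (-|p.2|) (min p.1 |p.2|)) (by fun_prop) hv, hhb.bval_smul]
      have huω : |bval G m u ω| ≤ n := le_of_tendsto' (hub.tendsto_bval ω).abs fun x => by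
        rw [hux]
        exact abs_cutOff_le n _
      by_cases hωK : ω ∈ K
      · have h3 : (n : ℝ) ≤ |n * bval G m h ω| :=
          (le_mul_of_one_le_right (Nat.cast_nonneg n) (hh1 ω hωK)).trans (le_abs_self _)
        obtain ⟨h4, h5⟩ := abs_le.1 huω
        rw [min_eq_left (h5.trans h3), max_eq_right (by linarith), sub_self]
      · have hω' : |bval G m w ω| < cutOffGap n := by
          by_contra! hcon
          exact hωK ⟨hω, hcon⟩
        have hz : bval G m u ω = 0 := by
          refine bval_of_tendsto (tendsto_const_nhds.congr' ?_)
          filter_upwards [(hw.tendsto_bval ω).abs.eventually_lt_const hω'] with x hx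
          rw [hux]
          by_contra hne
          refine hx.not_ge ?_
          rw [hwx]
          exact cutOffGap_le_abs (Ne.symm hne)
        rw [hz, min_eq_left (abs_nonneg _), max_eq_right (neg_nonpos.2 (abs_nonneg _)), sub_self]
  have := Q.domain.add_mem (h₀.le hdD) hvQ
  rwa [sub_add_cancel] at this

/-- A Dirichlet form sandwiched between the Dirichlet and the Neumann form is given by a closed
subset of `∂X` and a Radon measure on its complement. -/
theorem hasBoundaryRepresentation_of_isDominated (hc : ∀ x, G.c x = 0) (hQ : Q.IsDirichletForm)
    (h₀ : (G.dirichlet m).IsDominated Q) (h₁ : Q.IsDominated (G.neumann m)) :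
    G.HasBoundaryRepresentation m Q := by
  have hM := hQ.markovian
  obtain ⟨ν, hν, hint⟩ := exists_boundary_measure hc hM h₀ h₁
  have hB := boundaryIntegral_of_mem hc hQ h₁ hint
  refine ⟨zeroSet G Q, fun ω hω => hω.1, isClosed_zeroSet hc Q, ν, hν, fun f => ⟨fun hf => ?_, ?_⟩,
    fun f hf => ?_⟩
  · refine ⟨h₁.le hf, fun ω hω => ?_, ?_⟩
    · rw [extend_eq_zero_iff hc (h₁.le hf)]
      intro n
      obtain ⟨u, hu, -⟩ := hM.exists_comp (lipschitzWith_cutOff n) (cutOff_zero n) ⟨f, hf⟩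
      have hub : IsBdd G m (u : Lp ℝ 2 m) := ⟨h₁.le u.2, n, fun x => by
        rw [hu]
        exact abs_cutOff_le n _⟩
      rw [show (fun x => cutOff n (f x)) = (u : Lp ℝ 2 m) from (funext hu).symm]
      exact hω.2 u u.2 hub
    · rw [hB ⟨f, hf⟩]
      exact ENNReal.ofReal_lt_top
  · rintro ⟨hfN, hf0, hfB⟩
    obtain ⟨u, hu, hle, hlim⟩ := (G.neumann_isDirichletForm m hc).exists_cutOff ⟨f, hfN⟩
    have huQ : ∀ n, (u n : Lp ℝ 2 m) ∈ Q.domain := fun n =>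
      cutOff_mem_of_extend_eq_zero hc hM h₀ h₁ hfN hf0 (u n).2 (hu n)
    -- The truncations satisfy Q(u n) ≤ Q^(N)(f) + ∫ |f|² dν, so lower semicontinuity of Q yields f
    -- ∈ D(Q).
    obtain ⟨hmem, -⟩ := hQ.closed.mem_domain_of_tendsto (u := fun n => (⟨u n, huQ n⟩ : Q.domain))
      (w := f)
      (C := (G.neumann m).bilin ⟨f, hfN⟩ ⟨f, hfN⟩ + (boundaryIntegral G m ν f).toReal)
      hlim.tendsto fun n => by
        have h2 : ENNReal.ofReal (excess h₁.le ⟨u n, huQ n⟩ ⟨u n, huQ n⟩) ≤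
            boundaryIntegral G m ν f := by
          rw [← hB ⟨u n, huQ n⟩]
          refine lintegral_mono fun y => ?_
          gcongr
          refine abs_extend_mono hc (u n).2 hfN (fun x => ?_) y.1
          rw [hu]
          exact abs_cutOff_le_abs n _
        have h3 := (ENNReal.ofReal_le_iff_le_toReal hfB.ne).1 h2
        rw [excess_apply] at h3
        have h4 : G.energy (u n : Lp ℝ 2 m) (u n : Lp ℝ 2 m) ≤
          (G.neumann m).bilin ⟨f, hfN⟩ ⟨f, hfN⟩ := hle n
        have h5 : Q.bilin ⟨u n, huQ n⟩ ⟨u n, huQ n⟩ - G.energy (u n : Lp ℝ 2 m) (u n : Lp ℝ 2 m) ≤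
          (boundaryIntegral G m ν f).toReal := h3
        linarith
    exact hmem
  · rw [hB ⟨f, hf⟩, value_of_mem hf, value_of_mem (h₁.le hf), ← ENNReal.ofReal_add
      ((G.neumann m).nonneg _)]
    · congr 1
      rw [excess_apply]
      change _ = G.energy f f + _
      ring
    · exact excess_self_nonneg hc hM h₀ h₁ ⟨f, hf⟩

end WGraph

/-- A compact neighbourhood in S is closed in Z. If it contains U ∩ S with U open, then by density
it also contains U. -/
lemma Dense.isOpen_of_locallyCompactSpace {Z : Type*} [TopologicalSpace Z] [T2Space Z] {S : Set Z}
    (hS : Dense S) [LocallyCompactSpace S] : IsOpen S := by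
  rw [isOpen_iff_mem_nhds]
  intro z hz
  obtain ⟨N, hNc, hN⟩ := exists_compact_mem_nhds (⟨z, hz⟩ : S)
  obtain ⟨V, hV, hVN⟩ := mem_nhds_subtype S ⟨z, hz⟩ N |>.1 hN
  obtain ⟨U, hUV, hU, hzU⟩ := mem_nhds_iff.1 hV
  refine mem_of_superset (hU.mem_nhds hzU) ((hS.open_subset_closure_inter hU).trans ?_)
  refine (closure_minimal (t := Subtype.val '' N) ?_
    (hNc.image continuous_subtype_val).isClosed).trans (Subtype.coe_image_subset S N)
  rintro w ⟨hwU, hwS⟩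
  exact ⟨⟨w, hwS⟩, hVN (hUV hwU), rfl⟩

namespace SymForm

variable {H : Type*} [NormedAddCommGroup H] [InnerProductSpace ℝ H]

lemma normSq_sub_comm (Q : SymForm H) (f g : Q.domain) : Q.normSq (f - g) = Q.normSq (g - f) := by
  rw [← neg_sub g f, ← neg_one_smul ℝ, normSq_smul]
  norm_num

lemma isFormDense_of_approx {Q : SymForm H} {S S' : Set H} (hS : Q.IsFormDense S)
    (h : ∀ f : Q.domain, (f : H) ∈ S → ∀ ε > 0, ∃ g : Q.domain, (g : H) ∈ S' ∧ Q.normSq (f - g) < ε) :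
    Q.IsFormDense S' := by
  intro f ε hε
  obtain ⟨g, hg, h1⟩ := hS f (ε / 4) (by positivity)
  obtain ⟨k, hk, h2⟩ := h g hg (ε / 4) (by positivity)
  refine ⟨k, hk, ?_⟩
  have h3 := Q.bilin_add_le (f - g) (g - k)
  rw [sub_add_sub_cancel] at h3
  linarith

end SymForm

namespace WGraph

open SymForm

variable {X : Type*} [MeasurableSpace X] [DiscreteMeasurableSpace X] {G : WGraph X}
  {m : Measure X} [IsVertexMeasure m] {Q : SymForm (Lp ℝ 2 m)}

/-! ### Forms given by a boundary measure are sandwiched -/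

lemma boundaryIntegral_mono (hc : ∀ x, G.c x = 0) {F : Set (Royden G m)}
    (ν : Measure ↥(boundary G m \ F)) {f g : Lp ℝ 2 m} (hf : f ∈ (G.neumann m).domain)
    (hg : g ∈ (G.neumann m).domain) (h : ∀ x, |f x| ≤ |g x|) :
    boundaryIntegral G m ν f ≤ boundaryIntegral G m ν g :=
  lintegral_mono fun y => pow_le_pow_left' (abs_extend_mono hc hf hg h y.1) 2

lemma boundaryIntegral_of_mem_dirichlet (hc : ∀ x, G.c x = 0) {F : Set (Royden G m)}
    (ν : Measure ↥(boundary G m \ F)) {f : Lp ℝ 2 m} (hf : f ∈ (G.dirichlet m).domain) :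
    boundaryIntegral G m ν f = 0 := by
  have h : ∀ y : ↥(boundary G m \ F), (extend G m f y.1).abs ^ 2 = 0 := fun y => by
    rw [extend_eq_zero_of_mem_dirichlet hc hf y.2.1, EReal.abs_zero, zero_pow two_ne_zero]
  simp only [boundaryIntegral, h, lintegral_zero]

lemma HasBoundaryRepresentation.le_neumann (h : G.HasBoundaryRepresentation m Q) :
    Q.domain ≤ (G.neumann m).domain := by
  obtain ⟨F, -, -, ν, -, hdom, -⟩ := h
  exact fun f hf => ((hdom f).1 hf).1

lemma excess_self_eq_boundaryIntegral {F : Set (Royden G m)} {ν : Measure ↥(boundary G m \ F)}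
    (hle : Q.domain ≤ (G.neumann m).domain)
    (hdom : ∀ f ∈ Q.domain, boundaryIntegral G m ν f < ⊤)
    (hval : ∀ f ∈ Q.domain, Q.value f = (G.neumann m).value f + boundaryIntegral G m ν f)
    (f : Q.domain) : excess hle f f = (boundaryIntegral G m ν (f : Lp ℝ 2 m)).toReal := by
  have h := congrArg ENNReal.toReal (hval f f.2)
  rw [ENNReal.toReal_add _ (hdom f f.2).ne, value_of_mem f.2, value_of_mem (hle f.2),
    ENNReal.toReal_ofReal (Q.nonneg _), ENNReal.toReal_ofReal ((G.neumann m).nonneg _)] at h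
  · rw [excess_apply, sub_eq_iff_eq_add']
    exact h
  · rw [value_of_mem (hle f.2)]
    exact ENNReal.ofReal_ne_top

lemma HasBoundaryRepresentation.dirichlet_le (hc : ∀ x, G.c x = 0)
    (h : G.HasBoundaryRepresentation m Q) : (G.dirichlet m).domain ≤ Q.domain := by
  obtain ⟨F, hF, -, ν, -, hdom, -⟩ := h
  intro f hf
  refine (hdom f).2 ⟨G.dirichlet_le m hf, fun ω hω =>
    extend_eq_zero_of_mem_dirichlet hc hf (hF hω), ?_⟩
  rw [boundaryIntegral_of_mem_dirichlet hc ν hf]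
  exact ENNReal.zero_lt_top

/-- The boundary part of `Q` vanishes on `D(Q^(D))`. -/
lemma HasBoundaryRepresentation.excess_eq_zero (hc : ∀ x, G.c x = 0)
    (h : G.HasBoundaryRepresentation m Q) {f : Q.domain}
    (hf : (f : Lp ℝ 2 m) ∈ (G.dirichlet m).domain) (g : Q.domain) :
    excess h.le_neumann f g = 0 := by
  have hle := h.le_neumann
  obtain ⟨F, hF, -, ν, -, hdom, hval⟩ := h
  have hself := excess_self_eq_boundaryIntegral hle (fun f hf => ((hdom f).1 hf).2.2) hval
  -- The excess is itself a positive symmetric form, being given by a boundary integral, so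
  -- Cauchy–Schwarz reduces the claim to its vanishing at (f, f).
  have h1 := bilin_sq_le ⟨Q.domain, excess hle, excess_symm hle, fun f => by
    rw [hself]
    exact ENNReal.toReal_nonneg⟩ f g
  have h2 : excess hle f f = 0 := by
    rw [hself, boundaryIntegral_of_mem_dirichlet hc ν hf, ENNReal.toReal_zero]
  change excess hle f g ^ 2 ≤ excess hle f f * excess hle g g at h1
  rw [h2, zero_mul] at h1
  exact pow_eq_zero_iff two_ne_zero |>.1 (le_antisymm h1 (sq_nonneg _))

lemma HasBoundaryRepresentation.dirichlet_isDominated (hc : ∀ x, G.c x = 0)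
    (h : G.HasBoundaryRepresentation m Q) : (G.dirichlet m).IsDominated Q where
  le := h.dirichlet_le hc
  ideal f hf g hg h0 hfg := G.mem_dirichlet_of_abs_le m hc (h.le_neumann hf) hg fun x => by
    rw [abs_of_nonneg (nonneg_iff.1 h0 x)]
    exact le_iff.1 hfg x
  bilin_le f g _ _ :=
    (sub_eq_zero.1 (h.excess_eq_zero hc (f := Submodule.inclusion (h.dirichlet_le hc) f) f.2
      (Submodule.inclusion (h.dirichlet_le hc) g))).le

lemma HasBoundaryRepresentation.isDominated_neumann (hc : ∀ x, G.c x = 0)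
    (h : G.HasBoundaryRepresentation m Q) : Q.IsDominated (G.neumann m) where
  le := h.le_neumann
  ideal f hf g hg h0 hfg := by
    have hle := h.le_neumann
    obtain ⟨F, hF, -, ν, -, hdom, -⟩ := h
    have habs : ∀ x, |f x| ≤ |g x| := fun x => by
      rw [abs_of_nonneg (nonneg_iff.1 h0 x)]
      exact (le_iff.1 hfg x).trans (le_abs_self _)
    obtain ⟨-, hg0, hgB⟩ := (hdom g).1 hg
    refine (hdom f).2 ⟨hf, fun ω hω => ?_,
      (boundaryIntegral_mono hc ν hf (hle hg) habs).trans_lt hgB⟩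
    have h1 := abs_extend_mono hc hf (hle hg) habs ω
    rw [hg0 ω hω, EReal.abs_zero] at h1
    exact EReal.abs_eq_zero_iff.1 (le_antisymm h1 zero_le)
  bilin_le f g hf hg := by
    have hle := h.le_neumann
    obtain ⟨F, hF, -, ν, -, hdom, hval⟩ := h
    have hself := excess_self_eq_boundaryIntegral hle (fun f hf => ((hdom f).1 hf).2.2) hval
    -- For positive f, g one has |f - g| ≤ f + g; monotonicity of the boundary integral and
    -- polarization give 4 q(f, g) ≥ 0.
    have h1 : excess hle (f - g) (f - g) ≤ excess hle (f + g) (f + g) := by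
      rw [hself, hself]
      refine ENNReal.toReal_mono ((hdom _).1 (f + g).2).2.2.ne
        (boundaryIntegral_mono hc ν (hle (f - g).2) (hle (f + g).2) fun x => ?_)
      have hf0 := nonneg_iff.1 hf x
      have hg0 := nonneg_iff.1 hg x
      rw [Submodule.coe_sub, lp_sub_apply, Submodule.coe_add, lp_add_apply,
        abs_of_nonneg (add_nonneg hf0 hg0), abs_le]
      constructor <;> linarith
    simp only [map_sub, map_add, LinearMap.sub_apply, LinearMap.add_apply] at h1
    rw [excess_symm hle g f] at h1
    have h2 : 0 ≤ excess hle f g := by linarith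
    exact sub_nonneg.1 h2

theorem HasBoundaryRepresentation.isSandwiched (hc : ∀ x, G.c x = 0) (hQ : Q.IsDirichletForm)
    (h : G.HasBoundaryRepresentation m Q) : Q.IsSandwiched (G.dirichlet m) (G.neumann m) :=
  (isSandwiched_iff hQ (G.dirichlet_isDirichletForm m hc) (G.neumann_isDirichletForm m hc)).2
    ⟨h.dirichlet_isDominated hc, h.isDominated_neumann hc⟩

/-! ### Density of continuous functions -/

/-- Cut-offs of f are bounded and converge to f in the form norm. -/
lemma isFormDense_isBdd (hQ : Q.IsDirichletForm) (hle : Q.domain ≤ (G.neumann m).domain) :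
    Q.IsFormDense {f | IsBdd G m f} := by
  intro f ε hε
  obtain ⟨u, hu, -, hlim⟩ := hQ.exists_cutOff f
  obtain ⟨n, hn⟩ := (hlim.eventually_lt_const hε).exists
  refine ⟨u n, ⟨hle (u n).2, n, fun x => ?_⟩, ?_⟩
  · rw [hu]
    exact abs_cutOff_le n _
  · rwa [normSq_sub_comm]

lemma IsBdd.mem_contFun {f : Lp ℝ 2 m} (hf : IsBdd G m f) : f ∈ G.contFun m :=
  ⟨fun y => bval G m f y.1, hf.continuous_bval.comp continuous_subtype_val, hf.bval_incl⟩

lemma isFormDense_contFun (hQ : Q.IsDirichletForm) (hle : Q.domain ≤ (G.neumann m).domain) :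
    Q.IsFormDense (G.contFun m) := fun f ε hε => by
  obtain ⟨g, hg, h⟩ := isFormDense_isBdd (G := G) hQ hle f ε hε
  exact ⟨g, hg.mem_contFun, h⟩

lemma isBdd_of_finite (hc : ∀ x, G.c x = 0) {ψ : Lp ℝ 2 m} (hψ : (Function.support ψ).Finite) :
    IsBdd G m ψ := by
  obtain ⟨M, hM⟩ := (hψ.image fun x => |ψ x|).bddAbove
  refine ⟨G.mem_neumann_of_finite m hc hψ, max M 0, fun x => ?_⟩
  by_cases hx : ψ x = 0
  · rw [hx, abs_zero]
    exact le_max_right _ _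
  · exact le_max_of_le_left (hM ⟨x, hx, rfl⟩)

/-- A bounded function is compactly supported in `X ∪ ∂X` if it vanishes, up to finitely many
points, where a function `g` with `g ≥ 1` off `X ∪ ∂X` exceeds `1/2`. -/
lemma IsBdd.mem_compactSuppFun {w g : Lp ℝ 2 m} (hw : IsBdd G m w) (hg : IsBdd G m g)
    (hg1 : ∀ ω ∈ (withBoundary G m)ᶜ, 1 ≤ bval G m g ω) {S : Set X} (hS : S.Finite)
    (hwS : ∀ x ∉ S, 1 / 2 < g x → w x = 0) : w ∈ G.compactSuppFun m := by
  refine ⟨fun y => bval G m w y.1, hw.continuous_bval.comp continuous_subtype_val, ?_,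
    hw.bval_incl⟩
  refine HasCompactSupport.intro
    (K := Subtype.val ⁻¹' (incl G m '' S ∪ {ω | bval G m g ω ≤ 1 / 2})) ?_ fun y hy => ?_
  · rw [Topology.IsInducing.subtypeVal.isCompact_preimage_iff]
    · exact (hS.image _).isCompact.union
        (isClosed_le hg.continuous_bval continuous_const).isCompact
    · rw [Subtype.range_val]
      rintro ω (⟨x, -, rfl⟩ | hω)
      · exact Or.inl ⟨x, rfl⟩
      · by_contra hcon
        have h1 : bval G m g ω ≤ 1 / 2 := hω
        linarith [hg1 ω hcon]
  · have h1 : y.1 ∉ incl G m '' S := fun h => hy (Or.inl h)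
    have h2 : 1 / 2 < bval G m g y.1 := by
      by_contra! h
      exact hy (Or.inr h)
    refine bval_of_tendsto (tendsto_const_nhds.congr' ?_)
    have h3 : ∀ᶠ x in nhdsTrace G m y.1, incl G m x ∉ incl G m '' S :=
      tendsto_comap.eventually ((hS.image _).isClosed.isOpen_compl.mem_nhds h1)
    filter_upwards [(hg.tendsto_bval y.1).eventually_const_lt h2, h3] with x hx hxS
    exact (hwS x (fun h => hxS ⟨x, h, rfl⟩) hx).symm

/-- Local compactness makes X ∪ ∂X open, so some g in D(Q^(D)) is at least 1 on its closed
complement. From a bounded f one removes the part near this complement, which lies in D(Q^(D)), and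
restores it approximately by a finitely supported function. -/
lemma HasBoundaryRepresentation.isFormDense_compactSuppFun (hc : ∀ x, G.c x = 0)
    (hQ : Q.IsDirichletForm) (h : G.HasBoundaryRepresentation m Q)
    [LocallyCompactSpace (G.withBoundary m)] : Q.IsFormDense (G.compactSuppFun m) := by
  have hle := h.le_neumann
  refine isFormDense_of_approx (isFormDense_isBdd (G := G) hQ hle) fun f hf ε hε => ?_
  have hopen : IsOpen (G.withBoundary m) :=
    Dense.isOpen_of_locallyCompactSpace ((denseRange_incl G m).mono subset_union_left)
  obtain ⟨g, hgD, hgb, hg0, hg1⟩ := exists_dirichlet_one_le hc hopen.isClosed_compl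
    (disjoint_left.2 fun ω h1 h2 => h1 (Or.inr h2))
  -- The factor 2 makes k = min(2g, 1) equal to 1 wherever g ≥ 1/2, so f - f k vanishes on a
  -- neighbourhood of the complement.
  obtain ⟨k, hk, -⟩ := (G.dirichlet_isMarkovian m hc).exists_comp
    (LipschitzWith.id.min_const (1 : ℝ)) (by simp) ((2 : ℝ) • ⟨g, hgD⟩)
  have hkx : ∀ x, (k : Lp ℝ 2 m) x = min (2 * g x) 1 := fun x => by
    rw [hk, id, Submodule.coe_smul, lp_smul_apply]
  have hk0 : ∀ x, 0 ≤ (k : Lp ℝ 2 m) x := fun x => by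
    rw [hkx]
    exact le_min (mul_nonneg zero_le_two (nonneg_iff.1 hg0 x)) zero_le_one
  have hk1 : ∀ x, |(k : Lp ℝ 2 m) x| ≤ 1 := fun x => by
    rw [abs_of_nonneg (hk0 x), hkx]
    exact min_le_right _ _
  obtain ⟨A, hA⟩ := hf.2
  obtain ⟨v, hvN, hvx⟩ := G.exists_mul_mem_neumann m hc hf.1 (G.dirichlet_le m k.2) hA hk1
  have hvD : v ∈ (G.dirichlet m).domain := by
    refine G.mem_dirichlet_of_abs_le m hc hvN (Submodule.smul_mem _ A k.2) fun x => ?_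
    rw [hvx, lp_smul_apply, abs_mul, abs_of_nonneg (hk0 x)]
    exact mul_le_mul_of_nonneg_right (hA x) (hk0 x)
  have hvb : IsBdd G m v := IsBdd.of_abs_le hvN hf fun x => by
    rw [hvx, abs_mul]
    exact mul_le_of_le_one_right (abs_nonneg _) (hk1 x)
  obtain ⟨φ, hφ, hlim⟩ := G.exists_formTendsto_of_mem_dirichlet m hvD
  obtain ⟨n, hn⟩ := (hlim.eventually_lt_const hε).exists
  have hφD : (φ n : Lp ℝ 2 m) ∈ (G.dirichlet m).domain := G.mem_dirichlet_of_finite m hc (hφ n)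
  have hDQ := h.dirichlet_le hc
  refine ⟨f - ⟨v, hDQ hvD⟩ + ⟨φ n, hDQ hφD⟩, ?_, ?_⟩
  · refine ((hf.sub hvb).add (isBdd_of_finite hc (hφ n))).mem_compactSuppFun hgb hg1 (hφ n)
      fun x hx hgx => ?_
    have h1 : (φ n : Lp ℝ 2 m) x = 0 := not_not.1 hx
    rw [lp_add_apply, lp_sub_apply, h1, hvx, hkx, min_eq_right (by linarith)]
    ring
  · have e : f - (f - ⟨v, hDQ hvD⟩ + ⟨φ n, hDQ hφD⟩) =
        (⟨v, hDQ hvD⟩ - ⟨φ n, hDQ hφD⟩ : Q.domain) := by abel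
    rw [e, normSq_sub_comm]
    refine lt_of_eq_of_lt ?_ hn
    have hd : (φ n : Lp ℝ 2 m) - v ∈ (G.dirichlet m).domain := Submodule.sub_mem _ hφD hvD
    set d : Q.domain := ⟨φ n, hDQ hφD⟩ - ⟨v, hDQ hvD⟩
    -- The error lies in D(Q^(D)), where the energies of Q and Q^(N) coincide, so the approximation
    -- in the Neumann norm is enough.
    have h1 := h.excess_eq_zero hc (f := d) hd d
    rw [excess_apply, sub_eq_zero] at h1
    rw [normSq, h1]
    rfl

/-! ### The operator -/

lemma summable_b_mul_abs_sub {f : X → ℝ} (hf : G.FiniteEnergy f) (x : X) :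
    Summable fun y => G.b x y * |f x - f y| := by
  have h1 : Summable fun y => G.b x y * (f x - f y) ^ 2 :=
    hf.1.comp_injective (Prod.mk_right_injective x)
  refine Summable.of_nonneg_of_le (fun y => mul_nonneg (G.b_nonneg x y) (abs_nonneg _)) (fun y => ?_)
    ((G.b_summable x).add h1)
  have h2 : |f x - f y| ≤ 1 + (f x - f y) ^ 2 := by
    nlinarith [sq_abs (f x - f y), sq_nonneg (|f x - f y| - 1), abs_nonneg (f x - f y)]
  calc G.b x y * |f x - f y| ≤ G.b x y * (1 + (f x - f y) ^ 2) :=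
        mul_le_mul_of_nonneg_left h2 (G.b_nonneg x y)
    _ = G.b x y + G.b x y * (f x - f y) ^ 2 := by ring

lemma memF_of_finiteEnergy {f : X → ℝ} (hf : G.FiniteEnergy f) : G.MemF f := fun x => by
  refine Summable.of_nonneg_of_le (fun y => mul_nonneg (G.b_nonneg x y) (abs_nonneg _)) (fun y => ?_)
    (((G.b_summable x).mul_right |f x|).add (summable_b_mul_abs_sub hf x))
  rw [← mul_add]
  refine mul_le_mul_of_nonneg_left ?_ (G.b_nonneg x y)
  have := abs_sub_abs_le_abs_sub (f y) (f x)
  rw [abs_sub_comm (f x)]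
  linarith

/-- The edge sum splits into edges leaving x and edges entering x; by symmetry of b both contribute
the same, which cancels the factor 1/2. -/
lemma energy_delta (hc : ∀ x, G.c x = 0) {f : X → ℝ} (hf : G.FiniteEnergy f) (x : X) :
    G.energy (delta m x) f = ∑' y, G.b x y * (f x - f y) := by
  have hs : Summable fun y => G.b x y * (f x - f y) :=
    ((summable_b_mul_abs_sub hf x).congr fun y => by
      rw [Real.norm_eq_abs, abs_mul, abs_of_nonneg (G.b_nonneg x y)]).of_norm
  have hl : HasSum (fun p : X × X => delta m x p.1 * (G.b p.1 p.2 * (f p.1 - f p.2)))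
      (∑' y, G.b x y * (f x - f y)) := by
    rw [← (Prod.mk_right_injective x).hasSum_iff]
    · convert hs.hasSum using 2 with y
      rw [Function.comp_apply, delta_apply_self, one_mul]
    · rintro ⟨a, b⟩ hab
      have : a ≠ x := fun h => hab ⟨b, by rw [h]⟩
      rw [delta_apply_of_ne m this, zero_mul]
  have hr : HasSum (fun p : X × X => delta m x p.2 * (G.b p.1 p.2 * (f p.1 - f p.2)))
      (-∑' y, G.b x y * (f x - f y)) := by
    rw [← (Prod.mk_left_injective x).hasSum_iff]
    · have e : (fun p : X × X => delta m x p.2 * (G.b p.1 p.2 * (f p.1 - f p.2))) ∘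
          (fun y => (y, x)) = fun y => -(G.b x y * (f x - f y)) := funext fun y => by
        rw [Function.comp_apply, delta_apply_self, one_mul, G.b_symm y x]
        ring
      rw [e]
      exact hs.hasSum.neg
    · rintro ⟨a, b⟩ hab
      have : b ≠ x := fun h => hab ⟨a, by rw [h]⟩
      rw [delta_apply_of_ne m this, zero_mul]
  have h := hl.sub hr
  rw [energy_eq G hc]
  have h2 : ∀ p : X × X, G.b p.1 p.2 * ((delta m x p.1 - delta m x p.2) * (f p.1 - f p.2)) =
      delta m x p.1 * (G.b p.1 p.2 * (f p.1 - f p.2)) -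
        delta m x p.2 * (G.b p.1 p.2 * (f p.1 - f p.2)) := fun p => by ring
  simp only [h2]
  rw [h.tsum_eq]
  ring

/-- Test the operator relation with the point mass at x. It lies in D(Q^(D)), where the boundary
part of Q does not contribute, so only the energy remains. -/
theorem HasBoundaryRepresentation.operatorRestrictsLaplacian (hc : ∀ x, G.c x = 0)
    (h : G.HasBoundaryRepresentation m Q) : G.OperatorRestrictsLaplacian m Q := by
  rintro f k ⟨hf, hfk⟩
  have hfN : G.FiniteEnergy f := h.le_neumann hf
  refine ⟨memF_of_finiteEnergy hfN, funext fun x => ?_⟩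
  have hD := G.delta_mem_dirichlet m hc x
  have h1 := h.excess_eq_zero hc (f := ⟨delta m x, h.dirichlet_le hc hD⟩) hD ⟨f, hf⟩
  rw [excess_apply, hfk, inner_delta, sub_eq_zero] at h1
  change m.real {x} * k x = G.energy (delta m x) f at h1
  rw [energy_delta hc hfN] at h1
  have hx := real_pos m x
  rw [formalLaplacian, hc, zero_div, zero_mul, add_zero, ← h1]
  field_simp

end WGraph

end

/-! ### The theorem. -/

theorem mainTheorem5 {X : Type*} [Countable X] [MeasurableSpace X] [DiscreteMeasurableSpace X]
    (m : MeasureTheory.Measure X) [IsVertexMeasure m] (hm : m Set.univ < ⊤)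
    (G : WGraph X) (hc : ∀ x, G.c x = 0)
    (Q : SymForm (MeasureTheory.Lp ℝ 2 m)) (hQ : Q.IsDirichletForm) :
    -- the equivalence, with continuous functions on `X ∪ ∂X`
    (Q.IsSandwiched (G.dirichlet m) (G.neumann m) ∧ Q.IsFormDense (G.contFun m) ↔
      G.HasBoundaryRepresentation m Q) ∧
    -- with compactly supported functions: one direction in general ...
    (Q.IsSandwiched (G.dirichlet m) (G.neumann m) ∧ Q.IsFormDense (G.compactSuppFun m) →
      G.HasBoundaryRepresentation m Q) ∧
    -- ... and both directions if `X ∪ ∂X` is locally compact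
    (LocallyCompactSpace (G.withBoundary m) →
      (Q.IsSandwiched (G.dirichlet m) (G.neumann m) ∧ Q.IsFormDense (G.compactSuppFun m) ↔
        G.HasBoundaryRepresentation m Q)) ∧
    (G.HasBoundaryRepresentation m Q → G.OperatorRestrictsLaplacian m Q) := by
  have key : Q.IsSandwiched (G.dirichlet m) (G.neumann m) → G.HasBoundaryRepresentation m Q := by
    intro h
    obtain ⟨h₀, h₁⟩ := (SymForm.isSandwiched_iff hQ (G.dirichlet_isDirichletForm m hc)
      (G.neumann_isDirichletForm m hc)).1 h
    exact WGraph.hasBoundaryRepresentation_of_isDominated hc hQ h₀ h₁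
  refine ⟨⟨fun h => key h.1, fun h => ⟨h.isSandwiched hc hQ, ?_⟩⟩, fun h => key h.1,
    fun hlc => ⟨fun h => key h.1, fun h => ⟨h.isSandwiched hc hQ, ?_⟩⟩,
    fun h => h.operatorRestrictsLaplacian hc⟩
  · exact WGraph.isFormDense_contFun hQ h.le_neumann
  · exact h.isFormDense_compactSuppFun hc hQ
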